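/- Let $\mathcal S$ be the set of continuous, piecewise linear functions $f:\mathbb R\to\mathbb R$ with $f'(x)\in\{-1,1\}$ for all $x\notin\mathbb Z$ and $f(x)=|x|$ for $|x|$ sufficiently large; the graph of such an $f$ is the boundary of a Young diagram in Russian coordinates, whose cells are squares of side $\sqrt2$ rotated by $45^\circ$. For an integer $N\ge 1$ let $\mathcal S_N$ be the set of $f\in\mathcal S$ with $\frac12\int_{-\infty}^{\infty}(f(x)-|x|)\,dx=N$; these correspond to the partitions of $N$. Let $$\Omega(x)=\tfrac2\pi\big(x\arcsin x+\sqrt{1-x^2}\big)\ (|x|\le1),\qquad \Omega(x)=|x|\ (|x|\ge1),\qquad \Omega_N(x)=\sqrt{4N}\,\Omega\big(x/\sqrt{4N}\big),$$ and let $\varphi(x)=\sum_{k\ge1}\frac{1}{k(k+1)(2k+1)x^{2k}}$. For $f\in\mathcal S$ put $$\theta_N(f)=\int_{-\infty}^{\infty}\int_{-\infty}^{\infty}\Big(\frac{f(x)-f(y)}{x-y}-\frac{\Omega_N(x)-\Omega_N(y)}{x-y}\Big)^2dx\,dy,\qquad \tilde\theta(f)=\sum_{(i,j)}\varphi(h_{i,j}),\qquad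 \Theta_N(f)=\tfrac18\theta_N(f)+\tilde\theta(f),$$ where the sum is over the cells of the Young diagram of $f$ and $h_{i,j}$ is the hook length of the cell $(i,j)$. For $n\ge1$ let $\mathcal S^{\rm loc}_n$ be the set of continuous, piecewise linear $f:[0,n]\to\mathbb R$ with $f(0)=0$ and $f'(x)\in\{-1,1\}$ for $x\notin\mathbb Z$. For $\rho\in[-1,1]$ and $f\in\mathcal S^{\rm loc}_n$ let $$\Theta_n^\rho(f)=\frac18\int_0^n\int_0^n\Big(\frac{f(x)-f(y)}{x-y}-\rho\Big)^2dx\,dy+\sum_{(i,j)}\varphi(h_{i,j}),$$ where the sum is over the cells lying below the graph of $f$ and above the graph of $x\mapsto\max(-x,\,x-n+f(n))$, with their hook lengths in the diagram formed by these cells. Let $\sigma_n^\rho=\min_{f\in\mathcal S_n^{\rm loc}}\Theta_n^\rho(f)$. Then the limit $\sigma^\rho=\lim_{n\to\infty}\sigma_n^\rho/n$ exists and is finite for every $\rho\in[-1,1]$, the function $x\mapsto\sigma^{\Omega'(x)}$ is integrable on $[-1,1]$, and there is a universal constant $C>0$ such that for every integer $N\ge2$ and every $f\in\mathcal S_N$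 the double integral $\theta_N(f)$ converges and $$\Theta_N(f)\ \ge\ 2\sqrt N\int_{-1}^{1}\sigma^{\Omega'(x)}\,dx-\frac{C\sqrt N}{\log N}.$$ -/

import Mathlib

open MeasureTheory Filter Topology Set

noncomputable section

namespace MaxDim

/-- The set `𝒮` of global step functions: continuous functions on `ℝ` which at every non-integer
point have derivative `1` or `-1`, and which agree with `|x|` for `|x|` large. (The derivative
takes only the values `±1` on each interval between consecutive integers, so by Darboux's theorem
it is constant there: such functions are automatically piecewise linear.) -/
def StepFun : Set (ℝ → ℝ) :=
  {f | Continuous f ∧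
    (∀ x : ℝ, x ∉ range ((↑) : ℤ → ℝ) → HasDerivAt f 1 x ∨ HasDerivAt f (-1) x) ∧
    ∃ M : ℝ, ∀ x : ℝ, M ≤ |x| → f x = |x|}

/-- The size `N(f)` of the partition of `f`. -/
def size (f : ℝ → ℝ) : ℝ := 1 / 2 * ∫ x : ℝ, (f x - |x|)

/-- The set `𝒮_N`. -/
def StepFunOfSize (N : ℕ) : Set (ℝ → ℝ) := {f | f ∈ StepFun ∧ size f = N}

/-- The set `𝒮ₙˡᵒᶜ` of step functions on `[0, n]`. The functions are total, but only their
restriction to `[0, n]` is constrained, and only this restriction is used below. -/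
def LocalStepFun (n : ℕ) : Set (ℝ → ℝ) :=
  {f | ContinuousOn f (Icc 0 (n : ℝ)) ∧ f 0 = 0 ∧
    ∀ x ∈ Ioo 0 (n : ℝ), x ∉ range ((↑) : ℤ → ℝ) → HasDerivAt f 1 x ∨ HasDerivAt f (-1) x}

/-- The Logan-Shepp-Vershik-Kerov limit shape. -/
def Omega (x : ℝ) : ℝ :=
  if |x| ≤ 1 then 2 / Real.pi * (x * Real.arcsin x + √(1 - x ^ 2)) else |x|

/-- The limit shape at scale `√(4N)`. -/
def OmegaN (N : ℕ) (x : ℝ) : ℝ := √(4 * N) * Omega (x / √(4 * N))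

/-- `φ(x) = ∑_{k ≥ 1} 1 / (k (k + 1) (2k + 1) x ^ (2k))`, the sum being indexed by `k - 1`. -/
def phi (x : ℝ) : ℝ :=
  ∑' k : ℕ, 1 / (((k : ℝ) + 1) * ((k : ℝ) + 2) * (2 * (k : ℝ) + 3) * x ^ (2 * (k + 1)))

/-- The cells of the Young diagram of `f`. The pair `(i, j)` stands for the rotated square of side
`√2` with lowest vertex `(j - i, i + j)` and highest vertex `(j - i, i + j + 2)`. Cells are the
squares above the graph of `|x|` (that is, `0 ≤ i` and `0 ≤ j`) and below the graph of `f`; since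
both functions are `1`-Lipschitz it suffices to look at the lowest and the highest vertex. -/
def cells (f : ℝ → ℝ) : Set (ℤ × ℤ) :=
  {p | |(p.2 : ℝ) - p.1| ≤ p.1 + p.2 ∧ (p.1 : ℝ) + p.2 + 2 ≤ f (p.2 - p.1)}

/-- The cells, labelled as in `cells`, that lie over `[0, n]`, below the graph of `f` and above
the graph of `x ↦ max (-x) (x - n + f n)`. -/
def localCells (n : ℕ) (f : ℝ → ℝ) : Set (ℤ × ℤ) :=
  {p | 0 < p.2 - p.1 ∧ p.2 - p.1 < n ∧
    max (-((p.2 : ℝ) - p.1)) ((p.2 : ℝ) - p.1 - n + f n) ≤ p.1 + p.2 ∧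
    (p.1 : ℝ) + p.2 + 2 ≤ f (p.2 - p.1)}

/-- The hook length of the cell `p` in a diagram `D`: the number of cells of `D` in the hook
with corner `p`. -/
def hookLength (D : Set (ℤ × ℤ)) (p : ℤ × ℤ) : ℕ :=
  Set.ncard {q ∈ D | (q.1 = p.1 ∧ p.2 ≤ q.2) ∨ (q.2 = p.2 ∧ p.1 ≤ q.1)}

/-- The sum of `φ(h)` over the cells of a (finite) diagram `D`. -/
def hookSum (D : Set (ℤ × ℤ)) : ℝ := ∑ᶠ p ∈ D, phi (hookLength D p)

/-- The integrand of `θ_N(f)`. -/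
def thetaIntegrand (N : ℕ) (f : ℝ → ℝ) (x y : ℝ) : ℝ :=
  ((f x - f y) / (x - y) - (OmegaN N x - OmegaN N y) / (x - y)) ^ 2

/-- `θ_N(f)`. -/
def theta (N : ℕ) (f : ℝ → ℝ) : ℝ := ∫ x : ℝ, ∫ y : ℝ, thetaIntegrand N f x y

/-- `Θ_N(f) = θ_N(f) / 8 + θ̃(f)`. -/
def bigTheta (N : ℕ) (f : ℝ → ℝ) : ℝ := 1 / 8 * theta N f + hookSum (cells f)

/-- `θₙ^ρ(f)`. -/
def localTheta (n : ℕ) (ρ : ℝ) (f : ℝ → ℝ) : ℝ :=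
  ∫ x in (0 : ℝ)..n, ∫ y in (0 : ℝ)..n, ((f x - f y) / (x - y) - ρ) ^ 2

/-- `Θₙ^ρ(f) = θₙ^ρ(f) / 8 + θ̃ₙ(f)`. -/
def localBigTheta (n : ℕ) (ρ : ℝ) (f : ℝ → ℝ) : ℝ :=
  1 / 8 * localTheta n ρ f + hookSum (localCells n f)

/-- `σₙ^ρ`, the minimum of `Θₙ^ρ` over `𝒮ₙˡᵒᶜ` (the set of values is finite and non-empty,
as an element of `𝒮ₙˡᵒᶜ` is determined on `[0, n]` by its `n` slopes). -/
def sigmaLoc (n : ℕ) (ρ : ℝ) : ℝ := sInf (localBigTheta n ρ '' LocalStepFun n)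

/-- `σ^ρ = lim σₙ^ρ / n`. -/
def sigma (ρ : ℝ) : ℝ := limUnder atTop fun n : ℕ => sigmaLoc n ρ / n

theorem finite_of_bounds {D : Set (ℤ × ℤ)} (K : ℝ)
    (h : ∀ p ∈ D, |(p.2 : ℝ) - p.1| ≤ K ∧ |(p.1 : ℝ) + p.2| ≤ K) : D.Finite := by
  obtain ⟨m, hm⟩ := exists_nat_ge K
  refine (Set.finite_Icc ((-m, -m) : ℤ × ℤ) (m, m)).subset fun p hp => ?_
  obtain ⟨h1, h2⟩ := h p hp
  rw [abs_le] at h1 h2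
  simp only [Set.mem_Icc, Prod.le_def]
  refine ⟨⟨?_, ?_⟩, ?_, ?_⟩ <;> rify <;> linarith

/-- The Young diagram of a step function is finite. -/
theorem finite_cells {f : ℝ → ℝ} (hf : f ∈ StepFun) : (cells f).Finite := by
  obtain ⟨hc, -, M, hM⟩ := hf
  obtain ⟨B, hB⟩ := (isCompact_Icc (a := -M) (b := M)).bddAbove_image hc.continuousOn
  refine finite_of_bounds (max M B) fun p hp => ?_
  obtain ⟨h1, h2⟩ := hp
  have h3 : |(p.2 : ℝ) - p.1| < M := by
    by_contra! h
    have := hM _ h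
    linarith
  have h4 := hB (mem_image_of_mem f (abs_le.1 h3.le))
  refine ⟨h3.le.trans (le_max_left _ _), ?_⟩
  rw [abs_of_nonneg ((abs_nonneg _).trans h1)]
  exact le_trans (by linarith) (le_max_right M B)

/-- The diagram of a local step function is finite. -/
theorem finite_localCells {n : ℕ} {f : ℝ → ℝ} (hf : f ∈ LocalStepFun n) :
    (localCells n f).Finite := by
  obtain ⟨hc, -⟩ := hf
  obtain ⟨B, hB⟩ := (isCompact_Icc (a := (0 : ℝ)) (b := n)).bddAbove_image hc
  refine finite_of_bounds (max n B) fun p hp => ?_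
  obtain ⟨h1, h2, h3, h4⟩ := hp
  rify at h1 h2
  have h5 := hB (mem_image_of_mem f ⟨h1.le, h2.le⟩)
  have h6 := (le_max_left _ _).trans h3
  have h7 := le_max_left (n : ℝ) B
  have h8 := le_max_right (n : ℝ) B
  constructor <;> rw [abs_le] <;> constructor <;> linarith

end MaxDim

end

namespace MaxDim

/-! A step function on `[0, n]` is a lattice path, that is, a word of up-steps and down-steps. The
cells of its diagram correspond to the pairs of an up-step and a later down-step, and the hook
length is the distance between the two. The local functional thus becomes `energy`, a double sum of
nonnegative interactions between steps. Dropping the interactions between two consecutive pieces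
shows that `sigmaLoc` is superadditive in `n`; balanced words bound it linearly, and Fekete's lemma
gives the limit `sigma`.

Superadditivity only gives `sigmaLoc n ρ ≤ n * sigma ρ`. The theorem rests on a quantitative
converse, `n * sigma ρ ≤ energy w ρ n + O(n / log n)` for every word (`mul_sigma_le_energy_add`). At
a scale `m = p ^ 4`, take a window of `w` of length `m`, change a few evenly spread steps so that it
has the number of down-steps that the slope `ρ` demands, and concatenate such blocks; this bounds
`sigma ρ` from above (`mul_sigma_le`). Gluing costs interactions across the block ends, measured by
`edge`; tilting costs a factor `1 + (d / m) ^ (1/4)` on the quadratic interactions at distance `d`,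
and smaller terms (`exists_tilt`, `pow_mul_sigma_le`). Averaged over all windows, both costs are
bounded by the energy weighted with `(d / m) ^ (1/4)` for `d ≤ m`, up to lower order
(`mul_sigma_le_of_scale`). Over dyadic `p` these weights form a geometric series, so every pair of
steps has bounded total weight. The costs at `K` scales therefore sum to `O(n)`, and their average
is `O(n / K)`.

For the global bound, `[-√(4N), √(4N)]` is cut into windows of length `n`, a small power of `N`, and
all interactions outside the windows are dropped. Within a window the difference quotients of
`OmegaN` are replaced by the slope at one point; since the slope is monotone, these errors telescope
to `O(n ^ 2)`. Each window then controls the integral of `sigma` over it up to `O(n / K)`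
(`integral_window_le`), and `K` of order `log N` gives the error `√N / log N`. -/

/-! ### Lattice paths and words -/

/-- The slope of a step. -/
noncomputable def sg (b : Bool) : ℝ := if b then 1 else -1

/-- The height after `i` steps of the lattice path with up-steps at the places where `w` is
`true`. -/
noncomputable def ht (w : ℕ → Bool) (i : ℕ) : ℝ := ∑ k ∈ Finset.range i, sg (w k)

/-- The lattice path of a word, as a function of a real variable. -/
noncomputable def path (w : ℕ → Bool) (x : ℝ) : ℝ :=
  ht w ⌊x⌋₊ + sg (w ⌊x⌋₊) * (x - ⌊x⌋₊)

/-- The number of up-steps among the first `i` steps. -/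
def ups (w : ℕ → Bool) (i : ℕ) : ℕ := Nat.count (fun k => w k = true) i

/-- The number of down-steps among the first `i` steps. -/
def downs (w : ℕ → Bool) (i : ℕ) : ℕ := Nat.count (fun k => w k = false) i

/-- The word without its first `a` letters. -/
def shift (a : ℕ) (w : ℕ → Bool) : ℕ → Bool := fun k => w (a + k)

theorem abs_sg (b : Bool) : |sg b| = 1 := by cases b <;> simp [sg]

theorem ht_succ (w : ℕ → Bool) (i : ℕ) : ht w (i + 1) = ht w i + sg (w i) := by
  simp [ht, Finset.sum_range_succ]

theorem ups_succ (w : ℕ → Bool) (i : ℕ) :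
    ups w (i + 1) = ups w i + if w i = true then 1 else 0 := by
  simp [ups, Nat.count_succ]

theorem downs_succ (w : ℕ → Bool) (i : ℕ) :
    downs w (i + 1) = downs w i + if w i = false then 1 else 0 := by
  simp [downs, Nat.count_succ]

theorem ups_add_downs (w : ℕ → Bool) (i : ℕ) : ups w i + downs w i = i := by
  induction i with
  | zero => simp [ups, downs]
  | succ i ih =>
    rw [ups_succ, downs_succ]
    cases w i <;> simp <;> omega

theorem ups_mono (w : ℕ → Bool) : Monotone (ups w) := Nat.count_monotone _

theorem downs_mono (w : ℕ → Bool) : Monotone (downs w) := Nat.count_monotone _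

theorem ht_eq (w : ℕ → Bool) (i : ℕ) : ht w i = i - 2 * downs w i := by
  induction i with
  | zero => simp [ht, downs]
  | succ i ih =>
    rw [ht_succ, downs_succ, ih]
    cases w i <;> simp [sg] <;> ring

theorem abs_ht_sub_le (w : ℕ → Bool) {i j : ℕ} (h : i ≤ j) : |ht w j - ht w i| ≤ j - i := by
  induction j, h using Nat.le_induction with
  | base => simp
  | succ j hj ih =>
    rw [ht_succ]
    have h1 := abs_sg (w j)
    have h2 : |ht w j + sg (w j) - ht w i| ≤ |ht w j - ht w i| + |sg (w j)| := by
      rw [show ht w j + sg (w j) - ht w i = (ht w j - ht w i) + sg (w j) by ring]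
      exact abs_add_le _ _
    push_cast
    linarith

/-- At the right end the formulas of two consecutive steps agree, so closed unit intervals may be
used throughout. -/
theorem path_cell (w : ℕ → Bool) {i : ℕ} {x : ℝ} (h0 : (i : ℝ) ≤ x) (h1 : x ≤ i + 1) :
    path w x = ht w i + sg (w i) * (x - i) := by
  rcases h1.lt_or_eq with h | rfl
  · have : ⌊x⌋₊ = i := (Nat.floor_eq_iff ((Nat.cast_nonneg i).trans h0)).2 ⟨h0, h⟩
    simp [path, this]
  · have : ⌊(i : ℝ) + 1⌋₊ = i + 1 := by exact_mod_cast Nat.floor_natCast (R := ℝ) (i + 1)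
    simp [path, this, ht_succ]

theorem path_nat (w : ℕ → Bool) (i : ℕ) : path w i = ht w i := by
  simp [path]

theorem abs_path_sub_le_of_le (w : ℕ → Bool) {x y : ℝ} (hx : 0 ≤ x) (h : x ≤ y) :
    |path w x - path w y| ≤ y - x := by
  have hi := Nat.floor_le hx
  have hi' := (Nat.lt_floor_add_one x).le
  have hj := Nat.floor_le (hx.trans h)
  have hj' := (Nat.lt_floor_add_one y).le
  have hij : ⌊x⌋₊ ≤ ⌊y⌋₊ := Nat.floor_le_floor h
  generalize ⌊x⌋₊ = i at *
  generalize ⌊y⌋₊ = j at *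
  rw [path_cell w hi hi', path_cell w hj hj']
  have hsi := abs_le.1 (abs_sg (w i)).le
  have hsj := abs_le.1 (abs_sg (w j)).le
  rcases hij.lt_or_eq with hlt | rfl
  · have h1 := abs_le.1 (abs_ht_sub_le w (Nat.succ_le_of_lt hlt))
    rw [Nat.succ_eq_add_one, ht_succ] at h1
    push_cast at h1
    rw [abs_le]
    constructor <;> nlinarith
  · rw [abs_le]
    constructor <;> nlinarith

theorem abs_path_sub_le (w : ℕ → Bool) {x y : ℝ} (hx : 0 ≤ x) (hy : 0 ≤ y) :
    |path w x - path w y| ≤ |x - y| := by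
  rcases le_total x y with h | h
  · rw [abs_sub_comm x y, abs_of_nonneg (sub_nonneg.2 h)]
    exact abs_path_sub_le_of_le w hx h
  · rw [abs_sub_comm (path w x), abs_of_nonneg (sub_nonneg.2 h)]
    exact abs_path_sub_le_of_le w hy h

theorem ht_shift (w : ℕ → Bool) (a i : ℕ) : ht (shift a w) i = ht w (a + i) - ht w a := by
  simp [ht, shift, Finset.sum_range_add]

theorem path_shift (w : ℕ → Bool) (a : ℕ) {x : ℝ} (hx : 0 ≤ x) :
    path (shift a w) x = path w (a + x) - path w a := by
  have hi := Nat.floor_le hx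
  have hi' := (Nat.lt_floor_add_one x).le
  rw [path_cell _ hi hi', path_cell w (i := a + ⌊x⌋₊) (by push_cast; linarith)
    (by push_cast; linarith), path_nat, ht_shift]
  simp only [shift]
  push_cast
  ring

theorem ht_congr {w w' : ℕ → Bool} {n : ℕ} (h : ∀ k < n, w k = w' k) {i : ℕ} (hi : i ≤ n) :
    ht w i = ht w' i :=
  Finset.sum_congr rfl fun k hk => by rw [h k ((Finset.mem_range.1 hk).trans_le hi)]

theorem path_congr {w w' : ℕ → Bool} {n : ℕ} (h : ∀ k < n, w k = w' k) {x : ℝ}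
    (hx : x ∈ Icc (0 : ℝ) n) : path w x = path w' x := by
  rcases hx.2.lt_or_eq with h1 | rfl
  · have h2 : ⌊x⌋₊ < n := (Nat.floor_lt hx.1).2 h1
    simp [path, ht_congr h h2.le, h _ h2]
  · rw [path_nat, path_nat, ht_congr h le_rfl]

theorem measurable_path (w : ℕ → Bool) : Measurable (path w) := by
  have h1 : Measurable fun x : ℝ => ht w ⌊x⌋₊ :=
    (measurable_from_nat (f := ht w)).comp Nat.measurable_floor
  have h2 : Measurable fun x : ℝ => sg (w ⌊x⌋₊) :=
    (measurable_from_nat (f := fun k => sg (w k))).comp Nat.measurable_floor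
  have h3 : Measurable fun x : ℝ => ((⌊x⌋₊ : ℕ) : ℝ) :=
    (measurable_from_nat (f := fun k : ℕ => (k : ℝ))).comp Nat.measurable_floor
  exact h1.add (h2.mul (measurable_id.sub h3))

theorem continuousOn_path (w : ℕ → Bool) : ContinuousOn (path w) (Ici 0) := by
  have : LipschitzOnWith 1 (path w) (Ici 0) := LipschitzOnWith.of_dist_le_mul fun x hx y hy => by
    simpa [Real.dist_eq] using abs_path_sub_le w hx hy
  exact this.continuousOn

theorem hasDerivAt_path (w : ℕ → Bool) {i : ℕ} {x : ℝ} (h0 : (i : ℝ) < x) (h1 : x < i + 1) :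
    HasDerivAt (path w) (sg (w i)) x := by
  have h : HasDerivAt (fun y : ℝ => ht w i + sg (w i) * (y - i)) (sg (w i)) x := by
    simpa using (((hasDerivAt_id x).sub_const (i : ℝ)).const_mul (sg (w i))).const_add (ht w i)
  refine h.congr_of_eventuallyEq ?_
  filter_upwards [Ioo_mem_nhds h0 h1] with y hy
  exact path_cell w hy.1.le hy.2.le

theorem path_mem (w : ℕ → Bool) (n : ℕ) : path w ∈ LocalStepFun n := by
  refine ⟨(continuousOn_path w).mono fun x hx => hx.1, ?_, fun x hx hxi => ?_⟩
  · simpa [ht] using path_nat w 0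
  · have hi := Nat.floor_le hx.1.le
    have hi' := Nat.lt_floor_add_one x
    have hne : ((⌊x⌋₊ : ℕ) : ℝ) ≠ x := fun h => hxi ⟨(⌊x⌋₊ : ℤ), by simpa using h⟩
    have h := hasDerivAt_path w (hi.lt_of_ne hne) hi'
    cases hw : w ⌊x⌋₊ <;> simp [hw, sg] at h
    · exact Or.inr h
    · exact Or.inl h

/-- A function with derivative `±1` on an open interval has constant slope there. -/
theorem exists_slope {f : ℝ → ℝ} {a : ℝ} (hc : ContinuousOn f (Icc a (a + 1)))
    (hd : ∀ x ∈ Ioo a (a + 1), HasDerivAt f 1 x ∨ HasDerivAt f (-1) x) :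
    ∃ b : Bool, ∀ x ∈ Icc a (a + 1), f x = f a + sg b * (x - a) := by
  -- By Darboux a derivative that never vanishes has constant sign, which leaves only one of the two
  -- values.
  have key : ∃ b : Bool, ∀ x ∈ Ioo a (a + 1), HasDerivAt f (sg b) x := by
    have h0 : ∀ x ∈ Ioo a (a + 1), HasDerivWithinAt f (deriv f x) (Ioo a (a + 1)) x := by
      intro x hx
      rcases hd x hx with h | h <;> exact h.differentiableAt.hasDerivAt.hasDerivWithinAt
    have hne : ∀ x ∈ Ioo a (a + 1), deriv f x ≠ 0 := by
      intro x hx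
      rcases hd x hx with h | h <;> rw [h.deriv] <;> norm_num
    rcases hasDerivWithinAt_forall_lt_or_forall_gt_of_forall_ne (convex_Ioo a (a + 1)) h0 hne
      with h | h
    · refine ⟨false, fun x hx => ?_⟩
      rcases hd x hx with h1 | h1
      · have := h x hx
        rw [h1.deriv] at this
        norm_num at this
      · simpa [sg] using h1
    · refine ⟨true, fun x hx => ?_⟩
      rcases hd x hx with h1 | h1
      · simpa [sg] using h1
      · have := h x hx
        rw [h1.deriv] at this
        norm_num at this
  obtain ⟨b, hb⟩ := key
  refine ⟨b, fun x hx => ?_⟩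
  rcases hx.1.eq_or_lt with rfl | hlt
  · simp
  obtain ⟨c, hc1, hc2⟩ := exists_hasDerivAt_eq_slope f (fun _ => sg b) hlt
    (hc.mono (Icc_subset_Icc_right hx.2)) fun y hy => hb y ⟨hy.1, hy.2.trans_le hx.2⟩
  have : x - a ≠ 0 := (sub_pos.2 hlt).ne'
  field_simp at hc2
  linarith

theorem exists_word {n : ℕ} {f : ℝ → ℝ} (hf : f ∈ LocalStepFun n) :
    ∃ w : ℕ → Bool, ∀ x ∈ Icc (0 : ℝ) n, f x = path w x := by
  obtain ⟨hc, h0, hd⟩ := hf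
  have key : ∀ k : ℕ, ∃ b : Bool, k < n → ∀ x ∈ Icc (k : ℝ) (k + 1), f x = f k + sg b * (x - k) := by
    intro k
    by_cases hk : k < n
    · have hk' : (k : ℝ) + 1 ≤ n := by exact_mod_cast hk
      have hk0 : (0 : ℝ) ≤ k := k.cast_nonneg
      obtain ⟨b, hb⟩ := exists_slope (f := f) (a := k) (hc.mono (Icc_subset_Icc hk0 hk'))
        fun x hx => hd x ⟨hk0.trans_lt hx.1, hx.2.trans_le hk'⟩ fun ⟨z, hz⟩ => by
          rw [← hz] at hx
          have h1 : ((k : ℤ) : ℝ) < z := by exact_mod_cast hx.1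
          have h2 : (z : ℝ) < ((k : ℤ) + 1 : ℤ) := by exact_mod_cast hx.2
          have h1' := Int.cast_lt.1 h1
          have h2' := Int.cast_lt.1 h2
          omega
      exact ⟨b, fun _ => hb⟩
    · exact ⟨true, fun h => absurd h hk⟩
  choose w hw using key
  have hN : ∀ k : ℕ, k ≤ n → f k = ht w k := by
    intro k
    induction k with
    | zero => intro _; simp [ht, h0]
    | succ k ih =>
      intro hk
      have := hw k hk (k + 1) ⟨by linarith, le_rfl⟩
      push_cast
      rw [this, ih (by omega), ht_succ]
      ring
  refine ⟨w, fun x hx => ?_⟩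
  rcases hx.2.lt_or_eq with h1 | rfl
  · have h2 : ⌊x⌋₊ < n := (Nat.floor_lt hx.1).2 h1
    have hi := Nat.floor_le hx.1
    have hi' := (Nat.lt_floor_add_one x).le
    rw [path_cell w hi hi', hw _ h2 x ⟨hi, hi'⟩, hN _ h2.le]
  · rw [path_nat, hN _ le_rfl]

/-! ### Cells and hooks of a lattice path -/

/-- A discrete intermediate value property: the count grows by at most one per step, so it passes
through `k` exactly at a place where `p` holds. -/
theorem exists_count_eq (p : ℕ → Prop) [DecidablePred p] {n k : ℕ} (h : k < Nat.count p n) :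
    ∃ b < n, p b ∧ Nat.count p b = k := by
  induction n with
  | zero => simp at h
  | succ n ih =>
    by_cases h1 : k < Nat.count p n
    · obtain ⟨b, hb, hb'⟩ := ih h1
      exact ⟨b, hb.trans n.lt_succ_self, hb'⟩
    · rw [Nat.count_succ] at h
      by_cases hp : p n
      · simp only [hp, if_true] at h
        exact ⟨n, n.lt_succ_self, hp, by omega⟩
      · simp only [hp, if_false] at h
        omega

/-- The cell in the row of the up-step `a` and in the column of the down-step `b`. -/
def cell (w : ℕ → Bool) (a b : ℕ) : ℤ × ℤ := (-(downs w b : ℤ) - 1, (ups w a : ℤ))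

theorem ups_lt {w : ℕ → Bool} {a b : ℕ} (ha : w a = true) (h : a < b) : ups w a < ups w b := by
  have := ups_mono w (Nat.succ_le_of_lt h)
  rw [Nat.succ_eq_add_one, ups_succ, if_pos ha] at this
  omega

theorem downs_lt {w : ℕ → Bool} {a b : ℕ} (ha : w a = false) (h : a < b) :
    downs w a < downs w b := by
  have := downs_mono w (Nat.succ_le_of_lt h)
  rw [Nat.succ_eq_add_one, downs_succ, if_pos ha] at this
  omega

/-- For a cell `(i, j)` and `c = j - i`, the defining inequalities amount to `0 ≤ j < ups w c` and
`downs w c ≤ -i - 1 < downs w n`: the up-step number `j` comes before `c`, the down-step number `-i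
- 1` at or after `c`. Conversely, `a < b` gives `c = ups w a + downs w b + 1 ≤ b`, and monotonicity
of `downs` finishes. -/
theorem mem_localCells_path {w : ℕ → Bool} {n : ℕ} {p : ℤ × ℤ} :
    p ∈ localCells n (path w) ↔
      ∃ a b, a < b ∧ b < n ∧ w a = true ∧ w b = false ∧ p = cell w a b := by
  obtain ⟨i, j⟩ := p
  have hn := ups_add_downs w n
  constructor
  · rintro ⟨h1, h2, h3, h4⟩
    simp only at h1 h2 h3 h4
    obtain ⟨c, hc⟩ : ∃ c : ℕ, (c : ℤ) = j - i := ⟨(j - i).toNat, Int.toNat_of_nonneg h1.le⟩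
    have hcr : (j : ℝ) - i = (c : ℝ) := by exact_mod_cast hc.symm
    rw [hcr, path_nat, ht_eq] at h4
    rw [hcr, path_nat, ht_eq, max_le_iff] at h3
    have h3a : -(c : ℤ) ≤ i + j := by
      have := h3.1
      exact_mod_cast this
    have h3b : (c : ℤ) - n + (n - 2 * downs w n) ≤ i + j := by
      have := h3.2
      exact_mod_cast this
    have h4' : i + j + 2 ≤ (c : ℤ) - 2 * downs w c := by exact_mod_cast h4
    have hcs := ups_add_downs w c
    obtain ⟨k, hk⟩ : ∃ k : ℕ, (k : ℤ) = - i - 1 := ⟨(-i - 1).toNat, Int.toNat_of_nonneg (by omega)⟩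
    obtain ⟨l, hl⟩ : ∃ l : ℕ, (l : ℤ) = j := ⟨j.toNat, Int.toNat_of_nonneg (by omega)⟩
    obtain ⟨b, hb, hwb, hbk⟩ := exists_count_eq (fun k => w k = false) (n := n) (k := k)
      (show k < downs w n by omega)
    obtain ⟨a, ha, hwa, hal⟩ := exists_count_eq (fun k => w k = true) (n := c) (k := l)
      (show l < ups w c by omega)
    change downs w b = k at hbk
    change ups w a = l at hal
    refine ⟨a, b, ?_, hb, hwa, hwb, ?_⟩
    · by_contra! hba
      have hne : b ≠ a := fun h => by simp [h, hwa] at hwb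
      have := downs_lt hwb (show b < c by omega)
      omega
    · simp only [cell, Prod.mk.injEq]
      omega
  · rintro ⟨a, b, hab, hbn, hwa, hwb, h⟩
    simp only [cell, Prod.mk.injEq] at h
    obtain ⟨rfl, rfl⟩ := h
    have h1 := ups_lt hwa hab
    have h2 := ups_add_downs w b
    have h3 := downs_lt hwb hbn
    have h4 := downs_mono w (show ups w a + downs w b + 1 ≤ b by omega)
    have hcr : (((ups w a : ℤ) : ℝ) - ((-(downs w b : ℤ) - 1 : ℤ) : ℝ))
        = ((ups w a + downs w b + 1 : ℕ) : ℝ) := by push_cast; ring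
    refine ⟨by simp only; omega, by simp only; omega, ?_, ?_⟩
    · simp only
      rw [hcr, path_nat, ht_eq, max_le_iff]
      have h3' : (downs w b : ℝ) + 1 ≤ downs w n := by exact_mod_cast h3
      have h5 : (0 : ℝ) ≤ ups w a := Nat.cast_nonneg _
      push_cast
      constructor <;> linarith
    · simp only
      rw [hcr, path_nat, ht_eq]
      have h4' : (downs w (ups w a + downs w b + 1) : ℝ) ≤ downs w b := by exact_mod_cast h4
      push_cast
      linarith

theorem cell_inj {w : ℕ → Bool} {a b a' b' : ℕ} (ha : w a = true) (ha' : w a' = true)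
    (hb : w b = false) (hb' : w b' = false) (h : cell w a b = cell w a' b') : a = a' ∧ b = b' := by
  simp only [cell, Prod.mk.injEq] at h
  exact ⟨Nat.count_injective ha ha' (show ups w a = ups w a' by omega),
    Nat.count_injective hb hb' (show downs w b = downs w b' by omega)⟩

/-- The hook has one cell for each step `k` with `a < k ≤ b`: an up-step `k` shares the column of
`b`, a down-step `k` shares the row of `a`, and `k = b` is the corner itself. -/
theorem hookLength_cell {w : ℕ → Bool} {n a b : ℕ} (hab : a < b) (hbn : b < n) (ha : w a = true)
    (hb : w b = false) : hookLength (localCells n (path w)) (cell w a b) = b - a := by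
  let F : ℕ → ℤ × ℤ := fun k => if w k = true then cell w k b else cell w a k
  have himg : {q ∈ localCells n (path w) | (q.1 = (cell w a b).1 ∧ (cell w a b).2 ≤ q.2) ∨
      (q.2 = (cell w a b).2 ∧ (cell w a b).1 ≤ q.1)} = F '' (Finset.Ioc a b : Set ℕ) := by
    ext q
    simp only [Set.mem_ofPred_eq, Set.mem_image, Finset.coe_Ioc, Set.mem_Ioc]
    constructor
    · rintro ⟨hq, hq'⟩
      obtain ⟨a', b', hab', hbn', ha', hb', rfl⟩ := mem_localCells_path.1 hq
      simp only [cell] at hq'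
      rcases hq' with ⟨h1, h2⟩ | ⟨h1, h2⟩
      · have hbb : b' = b := Nat.count_injective hb' hb (show downs w b' = downs w b by omega)
        subst hbb
        rcases Nat.lt_trichotomy a a' with h | h | h
        · exact ⟨a', ⟨h, hab'.le⟩, by simp [F, ha']⟩
        · subst h
          exact ⟨b', ⟨hab, le_rfl⟩, by simp [F, hb]⟩
        · have := ups_lt ha' h
          omega
      · have haa : a' = a := Nat.count_injective ha' ha (show ups w a' = ups w a by omega)
        subst haa
        refine ⟨b', ⟨hab', ?_⟩, by simp [F, hb']⟩
        by_contra! h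
        have := downs_lt hb h
        omega
    · rintro ⟨k, ⟨hk1, hk2⟩, rfl⟩
      by_cases hw : w k = true
      · have hkb : k < b := lt_of_le_of_ne hk2 fun h => by simp [h, hb] at hw
        simp only [F, hw, if_true]
        refine ⟨mem_localCells_path.2 ⟨k, b, hkb, hbn, hw, hb, rfl⟩, Or.inl ⟨rfl, ?_⟩⟩
        simp only [cell]
        exact_mod_cast ups_mono w hk1.le
      · have hw' : w k = false := by simpa using hw
        simp only [F, hw']
        refine ⟨mem_localCells_path.2 ⟨a, k, hk1, by omega, ha, hw', by simp⟩, Or.inr ⟨by simp [cell], ?_⟩⟩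
        have := downs_mono w hk2
        simp [cell]
        omega
  have hinj : Set.InjOn F (Finset.Ioc a b : Set ℕ) := by
    intro k hk l hl h
    simp only [Finset.coe_Ioc, Set.mem_Ioc] at hk hl
    by_cases hwk : w k = true <;> by_cases hwl : w l = true <;>
      simp only [F, hwk, hwl, if_true, if_false, Bool.false_eq_true] at h
    · exact (cell_inj hwk hwl hb hb h).1
    · exact absurd (cell_inj hwk ha hb (by simpa using hwl) h).1 hk.1.ne'
    · exact absurd (cell_inj ha hwl (by simpa using hwk) hb h).1 hl.1.ne
    · exact (cell_inj ha ha (by simpa using hwk) (by simpa using hwl) h).2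
  rw [hookLength, himg, hinj.ncard_image, Set.ncard_coe_finset, Nat.card_Ioc]

/-- The contribution of the pair of steps `i`, `j` to the hook sum. -/
noncomputable def hookPair (w : ℕ → Bool) (i j : ℕ) : ℝ :=
  if i < j ∧ w i = true ∧ w j = false then phi ((j - i : ℕ) : ℝ) else 0

theorem hookSum_localCells_path (w : ℕ → Bool) (n : ℕ) :
    hookSum (localCells n (path w)) =
      ∑ i ∈ Finset.range n, ∑ j ∈ Finset.range n, hookPair w i j := by
  rw [← Finset.sum_product']
  simp only [hookPair]
  rw [← Finset.sum_filter, hookSum, ← finsum_mem_coe_finset]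
  symm
  refine finsum_mem_eq_of_bijOn (fun q : ℕ × ℕ => cell w q.1 q.2) ⟨?_, ?_, ?_⟩ ?_
  · rintro ⟨a, b⟩ h
    simp only [Finset.coe_filter, Finset.mem_product, Finset.mem_range, Set.mem_ofPred_eq] at h
    exact mem_localCells_path.2 ⟨a, b, h.2.1, h.1.2, h.2.2.1, h.2.2.2, rfl⟩
  · rintro ⟨a, b⟩ h ⟨a', b'⟩ h' heq
    simp only [Finset.coe_filter, Finset.mem_product, Finset.mem_range, Set.mem_ofPred_eq] at h h'
    obtain ⟨rfl, rfl⟩ := cell_inj h.2.2.1 h'.2.2.1 h.2.2.2 h'.2.2.2 heq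
    rfl
  · intro p hp
    obtain ⟨a, b, hab, hbn, ha, hb, rfl⟩ := mem_localCells_path.1 hp
    refine ⟨(a, b), ?_, rfl⟩
    simp only [Finset.coe_filter, Finset.mem_product, Finset.mem_range, Set.mem_ofPred_eq]
    exact ⟨⟨by omega, hbn⟩, hab, ha, hb⟩
  · rintro ⟨a, b⟩ h
    simp only [Finset.coe_filter, Finset.mem_product, Finset.mem_range, Set.mem_ofPred_eq] at h
    simp only
    rw [hookLength_cell h.2.1 h.1.2 h.2.2.1 h.2.2.2]

/-! ### Size of the hook terms -/

theorem phi_nonneg {x : ℝ} (hx : 0 ≤ x) : 0 ≤ phi x := tsum_nonneg fun k => by positivity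

/-- Since `(k + 2) * (2 * k + 3) ≥ 6 * (k + 1)`, the series is dominated by `ζ(2) / (6 * x ^ 2)`. -/
theorem phi_le {x : ℝ} (hx : 1 ≤ x) : phi x ≤ 1 / x ^ 2 := by
  have hx0 : 0 < x := by linarith
  have hs : HasSum (fun k : ℕ => 1 / ((k : ℝ) + 1) ^ 2) (Real.pi ^ 2 / 6) := by
    have := (hasSum_nat_add_iff' 1).2 hasSum_zeta_two
    simpa using this
  have hs' := hs.mul_right (1 / 6 * (1 / x ^ 2))
  have hle : ∀ k : ℕ, 1 / (((k : ℝ) + 1) * ((k : ℝ) + 2) * (2 * (k : ℝ) + 3) * x ^ (2 * (k + 1)))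
      ≤ 1 / ((k : ℝ) + 1) ^ 2 * (1 / 6 * (1 / x ^ 2)) := by
    intro k
    have h1 : x ^ 2 ≤ x ^ (2 * (k + 1)) := pow_le_pow_right₀ hx (by omega)
    have hk : (0 : ℝ) ≤ k := k.cast_nonneg
    rw [one_div_mul_one_div, one_div_mul_one_div]
    refine one_div_le_one_div_of_le (by positivity) ?_
    have h2 : ((k : ℝ) + 1) ^ 2 * 6 ≤ ((k : ℝ) + 1) * ((k : ℝ) + 2) * (2 * (k : ℝ) + 3) := by
      nlinarith [mul_nonneg hk hk, mul_nonneg hk (mul_nonneg hk hk)]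
    calc ((k : ℝ) + 1) ^ 2 * (6 * x ^ 2) = (((k : ℝ) + 1) ^ 2 * 6) * x ^ 2 := by ring
      _ ≤ _ := mul_le_mul h2 h1 (by positivity) (by positivity)
  have hpi : Real.pi ^ 2 / 6 * (1 / 6 * (1 / x ^ 2)) ≤ 1 / x ^ 2 := by
    have h1 : Real.pi ^ 2 ≤ 16 := by nlinarith [Real.pi_le_four, Real.pi_pos]
    have h2 : 0 ≤ 1 / x ^ 2 := by positivity
    nlinarith
  refine le_trans ?_ hpi
  rw [phi, ← hs'.tsum_eq]
  exact Summable.tsum_le_tsum hle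
    (Summable.of_nonneg_of_le (fun k => by positivity) hle hs'.summable) hs'.summable

theorem hookPair_nonneg (w : ℕ → Bool) (i j : ℕ) : 0 ≤ hookPair w i j := by
  unfold hookPair
  split_ifs
  · exact phi_nonneg (Nat.cast_nonneg _)
  · exact le_rfl

/-- On the diagonal both sides are `0`, the right one by the convention for division by zero. -/
theorem hookPair_le (w : ℕ → Bool) {i j : ℕ} : hookPair w i j ≤ 1 / ((i : ℝ) - j) ^ 2 := by
  unfold hookPair
  split_ifs with h
  · have h1 : (1 : ℝ) ≤ ((j - i : ℕ) : ℝ) := by exact_mod_cast Nat.sub_pos_of_lt h.1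
    refine (phi_le h1).trans_eq ?_
    rw [Nat.cast_sub h.1.le]
    congr 1
    ring
  · positivity

/-! ### The local functional as a double sum over steps -/

/-- The squared deviation of the difference quotient of `f` from `ρ`. -/
noncomputable def quotSq (f : ℝ → ℝ) (ρ : ℝ) (z : ℝ × ℝ) : ℝ :=
  ((f z.1 - f z.2) / (z.1 - z.2) - ρ) ^ 2

theorem quotSq_nonneg (f : ℝ → ℝ) (ρ : ℝ) (z : ℝ × ℝ) : 0 ≤ quotSq f ρ z := sq_nonneg _

theorem measurable_quotSq {f : ℝ → ℝ} (hf : Measurable f) (ρ : ℝ) : Measurable (quotSq f ρ) := by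
  unfold quotSq
  fun_prop

theorem abs_div_sub_le {f : ℝ → ℝ} {x y : ℝ} (h : |f x - f y| ≤ |x - y|) :
    |(f x - f y) / (x - y)| ≤ 1 := by
  rw [abs_div]
  exact div_le_one_of_le₀ h (abs_nonneg _)

theorem quotSq_le {f : ℝ → ℝ} (ρ : ℝ) {z : ℝ × ℝ} (h : |f z.1 - f z.2| ≤ |z.1 - z.2|) :
    quotSq f ρ z ≤ (1 + |ρ|) ^ 2 := by
  have h1 := abs_div_sub_le h
  unfold quotSq
  rw [← sq_abs]
  have h2 := abs_sub ((f z.1 - f z.2) / (z.1 - z.2)) ρ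
  gcongr
  linarith

theorem integrableOn_quotSq {f : ℝ → ℝ} (hf : Measurable f) (ρ : ℝ) {s : Set (ℝ × ℝ)}
    (hs : MeasurableSet s) (hs' : volume s ≠ ⊤) (h : ∀ z ∈ s, |f z.1 - f z.2| ≤ |z.1 - z.2|) :
    IntegrableOn (quotSq f ρ) s := by
  refine Measure.integrableOn_of_bounded (M := (1 + |ρ|) ^ 2) hs'
    (measurable_quotSq hf ρ).aestronglyMeasurable ?_
  filter_upwards [ae_restrict_mem hs] with z hz
  rw [Real.norm_of_nonneg (quotSq_nonneg _ _ _)]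
  exact quotSq_le ρ (h z hz)

theorem volume_box_ne_top (a b c d : ℝ) : volume (Ioc a b ×ˢ Ioc c d : Set (ℝ × ℝ)) ≠ ⊤ := by
  rw [Measure.volume_eq_prod, Measure.prod_prod]
  exact ENNReal.mul_ne_top measure_Ioc_lt_top.ne measure_Ioc_lt_top.ne

theorem measurableSet_box (a b c d : ℝ) : MeasurableSet (Ioc a b ×ˢ Ioc c d : Set (ℝ × ℝ)) :=
  measurableSet_Ioc.prod measurableSet_Ioc

theorem integrableOn_quotSq_path (w : ℕ → Bool) (ρ : ℝ) {a b c d : ℝ} (ha : 0 ≤ a) (hc : 0 ≤ c) :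
    IntegrableOn (quotSq (path w) ρ) (Ioc a b ×ˢ Ioc c d) :=
  integrableOn_quotSq (measurable_path w) ρ (measurableSet_box _ _ _ _) (volume_box_ne_top _ _ _ _)
    fun _ hz => abs_path_sub_le w (ha.trans hz.1.1.le) (hc.trans hz.2.1.le)

/-- The integral of `quotSq` over a unit cell. -/
noncomputable def cellE (f : ℝ → ℝ) (ρ : ℝ) (i j : ℕ) : ℝ :=
  ∫ z in Ioc (i : ℝ) (i + 1) ×ˢ Ioc (j : ℝ) (j + 1), quotSq f ρ z

/-- The interaction of the steps `i` and `j` of a word. -/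
noncomputable def inter (w : ℕ → Bool) (ρ : ℝ) (i j : ℕ) : ℝ :=
  1 / 8 * cellE (path w) ρ i j + hookPair w i j

/-- The energy of the first `n` steps of a word. -/
noncomputable def energy (w : ℕ → Bool) (ρ : ℝ) (n : ℕ) : ℝ :=
  ∑ i ∈ Finset.range n, ∑ j ∈ Finset.range n, inter w ρ i j

theorem cellE_nonneg (f : ℝ → ℝ) (ρ : ℝ) (i j : ℕ) : 0 ≤ cellE f ρ i j :=
  integral_nonneg fun _ => quotSq_nonneg _ _ _

theorem inter_nonneg (w : ℕ → Bool) (ρ : ℝ) (i j : ℕ) : 0 ≤ inter w ρ i j := by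
  have := cellE_nonneg (path w) ρ i j
  have := hookPair_nonneg w i j
  unfold inter
  linarith

theorem energy_nonneg (w : ℕ → Bool) (ρ : ℝ) (n : ℕ) : 0 ≤ energy w ρ n :=
  Finset.sum_nonneg fun _ _ => Finset.sum_nonneg fun _ _ => inter_nonneg _ _ _ _

theorem Ioc_prod_eq_biUnion (n : ℕ) : (Ioc (0 : ℝ) n ×ˢ Ioc (0 : ℝ) n : Set (ℝ × ℝ)) =
    ⋃ p ∈ Finset.range n ×ˢ Finset.range n,
      Ioc (p.1 : ℝ) (p.1 + 1) ×ˢ Ioc (p.2 : ℝ) (p.2 + 1) := by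
  have key : ∀ x : ℝ, x ∈ Ioc (0 : ℝ) n ↔ ∃ i < n, x ∈ Ioc (i : ℝ) (i + 1) := by
    intro x
    have h := (Nat.mono_cast (α := ℝ)).biUnion_Ico_Ioc_map_succ 0 n
    have h' := Set.ext_iff.1 h x
    simpa [and_left_comm] using h'.symm
  ext ⟨x, y⟩
  simp only [mem_prod, mem_iUnion, Finset.mem_product, Finset.mem_range, key]
  constructor
  · rintro ⟨⟨i, hi, hx⟩, j, hj, hy⟩
    exact ⟨(i, j), ⟨hi, hj⟩, hx, hy⟩
  · rintro ⟨⟨i, j⟩, ⟨hi, hj⟩, hx, hy⟩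
    exact ⟨⟨i, hi, hx⟩, j, hj, hy⟩

theorem setIntegral_quotSq_eq_sum (w : ℕ → Bool) (ρ : ℝ) (n : ℕ) :
    ∫ z in Ioc (0 : ℝ) n ×ˢ Ioc (0 : ℝ) n, quotSq (path w) ρ z =
      ∑ i ∈ Finset.range n, ∑ j ∈ Finset.range n, cellE (path w) ρ i j := by
  have hd := (Nat.mono_cast (α := ℝ)).pairwise_disjoint_on_Ioc_succ
  rw [← Finset.sum_product', Ioc_prod_eq_biUnion, integral_biUnion_finset]
  · rfl
  · exact fun p _ => measurableSet_box _ _ _ _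
  · rintro ⟨i, j⟩ - ⟨i', j'⟩ - hne
    simp only [Function.onFun, Set.disjoint_prod]
    by_cases h : i = i'
    · refine Or.inr ?_
      have := hd (show j ≠ j' by rintro rfl; exact hne (by rw [h]))
      simpa [Function.onFun] using this
    · refine Or.inl ?_
      simpa [Function.onFun] using hd h
  · exact fun p _ => integrableOn_quotSq_path w ρ (Nat.cast_nonneg _) (Nat.cast_nonneg _)

theorem localTheta_path (w : ℕ → Bool) (ρ : ℝ) (n : ℕ) :
    localTheta n ρ (path w) = ∫ z in Ioc (0 : ℝ) n ×ˢ Ioc (0 : ℝ) n, quotSq (path w) ρ z := by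
  rw [Measure.volume_eq_prod, setIntegral_prod]
  · rw [localTheta, intervalIntegral.integral_of_le (Nat.cast_nonneg n)]
    simp only [intervalIntegral.integral_of_le (Nat.cast_nonneg (α := ℝ) n), quotSq]
  · exact integrableOn_quotSq_path w ρ le_rfl le_rfl

theorem localBigTheta_path (w : ℕ → Bool) (ρ : ℝ) (n : ℕ) :
    localBigTheta n ρ (path w) = energy w ρ n := by
  simp only [localBigTheta, localTheta_path, setIntegral_quotSq_eq_sum, hookSum_localCells_path,
    energy, inter, Finset.sum_add_distrib, Finset.mul_sum]

theorem localBigTheta_congr {f g : ℝ → ℝ} {n : ℕ} (h : ∀ x ∈ Icc (0 : ℝ) n, f x = g x) (ρ : ℝ) :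
    localBigTheta n ρ f = localBigTheta n ρ g := by
  have hn : (0 : ℝ) ≤ n := Nat.cast_nonneg n
  have h1 : localTheta n ρ f = localTheta n ρ g := by
    refine intervalIntegral.integral_congr fun x hx => ?_
    refine intervalIntegral.integral_congr fun y hy => ?_
    rw [uIcc_of_le hn] at hx hy
    simp only [h x hx, h y hy]
  have h2 : localCells n f = localCells n g := by
    ext p
    simp only [localCells, Set.mem_ofPred_eq, h n ⟨hn, le_rfl⟩]
    refine and_congr_right fun h1 => and_congr_right fun h2 => ?_
    rw [h]
    rify at h1 h2
    exact ⟨h1.le, h2.le⟩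
  rw [localBigTheta, localBigTheta, h1, h2]

/-- The functional depends only on the restriction to `[0, n]`, where every local step function is
the path of a word. -/
theorem sigmaLoc_eq (n : ℕ) (ρ : ℝ) : sigmaLoc n ρ = ⨅ w : ℕ → Bool, energy w ρ n := by
  rw [sigmaLoc, iInf]
  congr 1
  ext t
  constructor
  · rintro ⟨f, hf, rfl⟩
    obtain ⟨w, hw⟩ := exists_word hf
    exact ⟨w, by rw [localBigTheta_congr hw, localBigTheta_path]⟩
  · rintro ⟨w, rfl⟩
    exact ⟨path w, path_mem w n, localBigTheta_path w ρ n⟩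

theorem bddBelow_energy (ρ : ℝ) (n : ℕ) : BddBelow (range fun w : ℕ → Bool => energy w ρ n) :=
  ⟨0, by rintro _ ⟨w, rfl⟩; exact energy_nonneg w ρ n⟩

theorem sigmaLoc_le (w : ℕ → Bool) (ρ : ℝ) (n : ℕ) : sigmaLoc n ρ ≤ energy w ρ n := by
  rw [sigmaLoc_eq]
  exact ciInf_le (bddBelow_energy ρ n) w

theorem sigmaLoc_nonneg (n : ℕ) (ρ : ℝ) : 0 ≤ sigmaLoc n ρ := by
  rw [sigmaLoc_eq]
  exact le_ciInf fun w => energy_nonneg w ρ n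

/-! ### Shifts and superadditivity -/

theorem cellE_shift (w : ℕ → Bool) (ρ : ℝ) (a i j : ℕ) :
    cellE (path (shift a w)) ρ i j = cellE (path w) ρ (a + i) (a + j) := by
  have hmp : MeasurePreserving (fun z : ℝ × ℝ => ((a : ℝ), (a : ℝ)) + z) volume volume :=
    measurePreserving_add_left volume _
  have hemb : MeasurableEmbedding (fun z : ℝ × ℝ => ((a : ℝ), (a : ℝ)) + z) :=
    (MeasurableEquiv.addLeft ((a : ℝ), (a : ℝ))).measurableEmbedding
  have h := hmp.setIntegral_preimage_emb hemb (quotSq (path w) ρ)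
    (Ioc ((a + i : ℕ) : ℝ) ((a + i : ℕ) + 1) ×ˢ Ioc ((a + j : ℕ) : ℝ) ((a + j : ℕ) + 1))
  rw [cellE, cellE, ← h]
  have hset : (fun z : ℝ × ℝ => ((a : ℝ), (a : ℝ)) + z) ⁻¹'
      (Ioc ((a + i : ℕ) : ℝ) ((a + i : ℕ) + 1) ×ˢ Ioc ((a + j : ℕ) : ℝ) ((a + j : ℕ) + 1)) =
      Ioc (i : ℝ) (i + 1) ×ˢ Ioc (j : ℝ) (j + 1) := by
    ext ⟨x, y⟩
    simp only [mem_preimage, mem_prod, Prod.mk_add_mk, mem_Ioc]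
    push_cast
    constructor <;> rintro ⟨⟨h1, h2⟩, h3, h4⟩ <;> refine ⟨⟨?_, ?_⟩, ?_, ?_⟩ <;> linarith
  rw [hset]
  refine setIntegral_congr_fun (measurableSet_box _ _ _ _) fun z hz => ?_
  have h1 : 0 ≤ z.1 := (Nat.cast_nonneg i).trans hz.1.1.le
  have h2 : 0 ≤ z.2 := (Nat.cast_nonneg j).trans hz.2.1.le
  simp only [quotSq, path_shift w a h1, path_shift w a h2, Prod.fst_add, Prod.snd_add]
  congr 3 <;> ring

theorem inter_shift (w : ℕ → Bool) (ρ : ℝ) (a i j : ℕ) :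
    inter (shift a w) ρ i j = inter w ρ (a + i) (a + j) := by
  simp only [inter, cellE_shift, hookPair, shift, Nat.add_sub_add_left, add_lt_add_iff_left]
  congr

theorem inter_congr {w w' : ℕ → Bool} {n : ℕ} (h : ∀ k < n, w k = w' k) (ρ : ℝ) {i j : ℕ}
    (hi : i < n) (hj : j < n) : inter w ρ i j = inter w' ρ i j := by
  have hi' : (i : ℝ) + 1 ≤ n := by exact_mod_cast hi
  have hj' : (j : ℝ) + 1 ≤ n := by exact_mod_cast hj
  have h1 : cellE (path w) ρ i j = cellE (path w') ρ i j := by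
    refine setIntegral_congr_fun (measurableSet_box _ _ _ _) fun z hz => ?_
    have h1 : 0 ≤ z.1 := (Nat.cast_nonneg i).trans hz.1.1.le
    have h2 : 0 ≤ z.2 := (Nat.cast_nonneg j).trans hz.2.1.le
    simp only [quotSq, path_congr h ⟨h1, hz.1.2.trans hi'⟩, path_congr h ⟨h2, hz.2.2.trans hj'⟩]
  simp only [inter, h1, hookPair, h i hi, h j hj]

theorem energy_congr {w w' : ℕ → Bool} {n : ℕ} (h : ∀ k < n, w k = w' k) (ρ : ℝ) :
    energy w ρ n = energy w' ρ n :=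
  Finset.sum_congr rfl fun _ hi => Finset.sum_congr rfl fun _ hj =>
    inter_congr h ρ (Finset.mem_range.1 hi) (Finset.mem_range.1 hj)

/-- The interactions between the first `m` and the last `n` steps are nonnegative and are dropped.
-/
theorem energy_add_le (w : ℕ → Bool) (ρ : ℝ) (m n : ℕ) :
    energy w ρ m + energy (shift m w) ρ n ≤ energy w ρ (m + n) := by
  simp only [energy, inter_shift, Finset.sum_range_add _ m n, Finset.sum_add_distrib]
  have h1 : 0 ≤ ∑ i ∈ Finset.range m, ∑ j ∈ Finset.range n, inter w ρ i (m + j) :=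
    Finset.sum_nonneg fun _ _ => Finset.sum_nonneg fun _ _ => inter_nonneg _ _ _ _
  have h2 : 0 ≤ ∑ i ∈ Finset.range n, ∑ j ∈ Finset.range m, inter w ρ (m + i) j :=
    Finset.sum_nonneg fun _ _ => Finset.sum_nonneg fun _ _ => inter_nonneg _ _ _ _
  linarith

theorem sigmaLoc_add_le (ρ : ℝ) (m n : ℕ) :
    sigmaLoc m ρ + sigmaLoc n ρ ≤ sigmaLoc (m + n) ρ := by
  rw [sigmaLoc_eq (m + n)]
  exact le_ciInf fun w => (add_le_add (sigmaLoc_le w ρ m) (sigmaLoc_le _ ρ n)).trans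
    (energy_add_le w ρ m n)

/-! ### Interactions and deviations from a line -/

/-- The deviation of the path of `w` from the line of slope `ρ`. -/
noncomputable def dev (w : ℕ → Bool) (ρ : ℝ) (i : ℕ) : ℝ := ht w i - ρ * i

theorem ae_fst_ne_snd : ∀ᵐ z : ℝ × ℝ, z.1 ≠ z.2 := by
  have h : MeasurableSet {z : ℝ × ℝ | z.1 = z.2} := measurableSet_eq_fun measurable_fst measurable_snd
  have h0 : volume {z : ℝ × ℝ | z.1 = z.2} = 0 := by
    rw [Measure.volume_eq_prod, Measure.measure_prod_null h]
    refine Eventually.of_forall fun x => ?_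
    have : Prod.mk x ⁻¹' {z : ℝ × ℝ | z.1 = z.2} = {x} := by
      ext y
      simp [eq_comm]
    simp only [this]
    simp
  rw [ae_iff]
  simpa using h0

theorem volume_real_cell (i j : ℕ) :
    volume.real (Ioc (i : ℝ) (i + 1) ×ˢ Ioc (j : ℝ) (j + 1) : Set (ℝ × ℝ)) = 1 := by
  rw [Measure.real, Measure.volume_eq_prod, Measure.prod_prod]
  simp

theorem setIntegral_cell_const (i j : ℕ) (c : ℝ) :
    ∫ _ in (Ioc (i : ℝ) (i + 1) ×ˢ Ioc (j : ℝ) (j + 1) : Set (ℝ × ℝ)), c = c := by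
  rw [setIntegral_const, volume_real_cell, one_smul]

theorem integrableOn_cell (w : ℕ → Bool) (ρ : ℝ) (i j : ℕ) :
    IntegrableOn (quotSq (path w) ρ) (Ioc (i : ℝ) (i + 1) ×ˢ Ioc (j : ℝ) (j + 1)) :=
  integrableOn_quotSq_path w ρ (Nat.cast_nonneg _) (Nat.cast_nonneg _)

theorem cellE_le_mul_add {w w' : ℕ → Bool} {ρ c B : ℝ} {i j : ℕ}
    (h : ∀ z ∈ Ioc (i : ℝ) (i + 1) ×ˢ Ioc (j : ℝ) (j + 1), z.1 ≠ z.2 →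
      quotSq (path w') ρ z ≤ c * quotSq (path w) ρ z + B) :
    cellE (path w') ρ i j ≤ c * cellE (path w) ρ i j + B := by
  have hconst : IntegrableOn (fun _ : ℝ × ℝ => B) (Ioc (i : ℝ) (i + 1) ×ˢ Ioc (j : ℝ) (j + 1)) :=
    integrableOn_const (volume_box_ne_top _ _ _ _)
  have hint := ((integrableOn_cell w ρ i j).const_mul c)
  have : c * cellE (path w) ρ i j + B = ∫ z in Ioc (i : ℝ) (i + 1) ×ˢ Ioc (j : ℝ) (j + 1),
      (c * quotSq (path w) ρ z + B) := by
    rw [integral_add hint hconst, integral_const_mul, setIntegral_cell_const]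
    rfl
  rw [this]
  refine setIntegral_mono_on_ae (integrableOn_cell w' ρ i j) (hint.add hconst)
    (measurableSet_box _ _ _ _) ?_
  filter_upwards [ae_fst_ne_snd] with z hz hz'
  exact h z hz' hz

theorem cellE_le {w : ℕ → Bool} {ρ B : ℝ} {i j : ℕ}
    (h : ∀ z ∈ Ioc (i : ℝ) (i + 1) ×ˢ Ioc (j : ℝ) (j + 1), z.1 ≠ z.2 → quotSq (path w) ρ z ≤ B) :
    cellE (path w) ρ i j ≤ B := by
  have := cellE_le_mul_add (w := w) (w' := w) (ρ := ρ) (c := 0) (B := B) (i := i) (j := j)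
    fun z hz hne => by linarith [h z hz hne]
  linarith

theorem abs_path_sub_le_of_mem (w : ℕ → Bool) {z : ℝ × ℝ} {i j : ℕ}
    (hz : z ∈ Ioc (i : ℝ) (i + 1) ×ˢ Ioc (j : ℝ) (j + 1)) :
    |path w z.1 - path w z.2| ≤ |z.1 - z.2| :=
  abs_path_sub_le w ((Nat.cast_nonneg i).trans hz.1.1.le) ((Nat.cast_nonneg j).trans hz.2.1.le)

theorem cellE_le_four (w : ℕ → Bool) {ρ : ℝ} (hρ : |ρ| ≤ 1) (i j : ℕ) :
    cellE (path w) ρ i j ≤ 4 := by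
  refine cellE_le fun z hz _ => (quotSq_le ρ (abs_path_sub_le_of_mem w hz)).trans ?_
  nlinarith [abs_nonneg ρ]

theorem inter_self_le (w : ℕ → Bool) {ρ : ℝ} (hρ : |ρ| ≤ 1) (i : ℕ) : inter w ρ i i ≤ 1 / 2 := by
  have := cellE_le_four w hρ i i
  simp only [inter, hookPair, lt_irrefl, false_and, if_false]
  linarith

theorem quotSq_eq_div {f : ℝ → ℝ} {ρ : ℝ} {z : ℝ × ℝ} (h : z.1 ≠ z.2) :
    quotSq f ρ z = ((f z.1 - ρ * z.1) - (f z.2 - ρ * z.2)) ^ 2 / (z.1 - z.2) ^ 2 := by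
  have : z.1 - z.2 ≠ 0 := sub_ne_zero.2 h
  rw [quotSq, ← div_pow]
  congr 1
  field_simp
  ring

theorem abs_dev_sub_le (w : ℕ → Bool) {ρ : ℝ} (hρ : |ρ| ≤ 1) {i : ℕ} {p : ℕ} {x : ℝ}
    (hp : (p : ℝ) = i ∨ (p : ℝ) = i + 1) (hx : x ∈ Ioc (i : ℝ) (i + 1)) :
    |(path w x - ρ * x) - dev w ρ p| ≤ 2 := by
  have hx0 : 0 ≤ x := (Nat.cast_nonneg i).trans hx.1.le
  have h1 := abs_path_sub_le w hx0 (Nat.cast_nonneg p)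
  have h3 : |x - p| ≤ 1 := by
    have := hx.1
    have := hx.2
    rw [abs_le]
    rcases hp with h | h <;> rw [h] <;> constructor <;> linarith
  rw [dev, ← path_nat, show path w x - ρ * x - (path w p - ρ * p) =
    (path w x - path w p) - ρ * (x - p) by ring]
  have h4 : |ρ * (x - p)| ≤ 1 := by
    rw [abs_mul]
    nlinarith [abs_nonneg ρ, abs_nonneg (x - p)]
  have := abs_sub (path w x - path w p) (ρ * (x - p))
  linarith

/-- Over a unit cell the deviations vary by at most `2` and, once `|i - j| ≥ 2`, distances change by
at most a factor `2`; for neighbouring steps the trivial bound `4` on the integrand suffices. The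
constant is `128 / 8 + 1`, the `1` coming from the hook term. -/
theorem inter_le (w : ℕ → Bool) {ρ : ℝ} (hρ : |ρ| ≤ 1) {i j : ℕ} (hij : i ≠ j) :
    inter w ρ i j ≤ 17 * ((dev w ρ i - dev w ρ j) ^ 2 + 1) / ((i : ℝ) - j) ^ 2 := by
  have hne : (i : ℝ) - j ≠ 0 := sub_ne_zero.2 (by exact_mod_cast hij)
  have hpos : 0 < ((i : ℝ) - j) ^ 2 := by positivity
  set D := dev w ρ i - dev w ρ j with hD
  have hcell : cellE (path w) ρ i j ≤ 128 * (D ^ 2 + 1) / ((i : ℝ) - j) ^ 2 := by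
    refine cellE_le fun z hz hzne => ?_
    by_cases h1 : |(i : ℝ) - j| ≤ 1
    · have h2 : ((i : ℝ) - j) ^ 2 ≤ 1 := by
        rw [← sq_abs]
        nlinarith [abs_nonneg ((i : ℝ) - j)]
      have h3 := quotSq_le ρ (abs_path_sub_le_of_mem w hz)
      have h4 : (1 + |ρ|) ^ 2 ≤ 4 := by nlinarith [abs_nonneg ρ]
      rw [le_div_iff₀ hpos]
      nlinarith [sq_nonneg D, quotSq_nonneg (path w) ρ z]
    · have h2 : 2 ≤ |(i : ℝ) - j| := by
        have h3 : ((1 : ℤ) : ℝ) < ((|(i : ℤ) - j| : ℤ) : ℝ) := by push_cast; simpa using h1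
        have h4 : (2 : ℤ) ≤ |(i : ℤ) - j| := Int.cast_lt.1 h3
        exact_mod_cast h4
      rw [quotSq_eq_div hzne]
      have ha := abs_le.1 (abs_dev_sub_le w hρ (Or.inl rfl) hz.1)
      have hb := abs_le.1 (abs_dev_sub_le w hρ (Or.inl rfl) hz.2)
      have h5 : |(i : ℝ) - j| ≤ 2 * |z.1 - z.2| := by
        have h6 : |(i : ℝ) - j| ≤ |z.1 - z.2| + 1 := by
          have h7 : |((i : ℝ) - j) - (z.1 - z.2)| ≤ 1 := by
            have := hz.1.1
            have := hz.1.2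
            have := hz.2.1
            have := hz.2.2
            rw [abs_le]
            constructor <;> linarith
          have := abs_sub_abs_le_abs_sub ((i : ℝ) - j) (z.1 - z.2)
          linarith
        linarith
      have h8 : ((i : ℝ) - j) ^ 2 ≤ 4 * (z.1 - z.2) ^ 2 := by
        rw [← sq_abs, ← sq_abs (z.1 - z.2)]
        nlinarith [abs_nonneg ((i : ℝ) - j)]
      have hz2 : 0 < (z.1 - z.2) ^ 2 := by
        have := sub_ne_zero.2 hzne
        positivity
      set X := (path w z.1 - ρ * z.1) - (path w z.2 - ρ * z.2) with hX
      have hXD : |X - D| ≤ 4 := by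
        rw [abs_le]
        constructor <;> linarith [ha.1, ha.2, hb.1, hb.2]
      have hX2 : X ^ 2 ≤ 2 * D ^ 2 + 32 := by
        have : (X - D) ^ 2 ≤ 16 := by
          rw [← sq_abs]
          nlinarith [abs_nonneg (X - D)]
        nlinarith [sq_nonneg (X - 2 * D)]
      rw [div_le_div_iff₀ hz2 hpos]
      nlinarith [sq_nonneg D, sq_nonneg X]
  have hh := hookPair_le w (i := i) (j := j)
  have h9 : 1 / ((i : ℝ) - j) ^ 2 ≤ (D ^ 2 + 1) / ((i : ℝ) - j) ^ 2 := by
    gcongr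
    nlinarith [sq_nonneg D]
  have h10 : 128 * (D ^ 2 + 1) / ((i : ℝ) - j) ^ 2 = 128 * ((D ^ 2 + 1) / ((i : ℝ) - j) ^ 2) := by
    ring
  have h11 : 17 * (D ^ 2 + 1) / ((i : ℝ) - j) ^ 2 = 17 * ((D ^ 2 + 1) / ((i : ℝ) - j) ^ 2) := by
    ring
  rw [inter, h11]
  linarith

/-- The converse of `inter_le`: large deviations force large interactions. Allowing `p = i + 1`
makes the right end of a window accessible through its last step. -/
theorem dev_sub_sq_le (w : ℕ → Bool) {ρ : ℝ} (hρ : |ρ| ≤ 1) {i j p : ℕ} (hp : p = i ∨ p = i + 1) :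
    (dev w ρ p - dev w ρ j) ^ 2 ≤ 16 * (|(i : ℝ) - j| + 1) ^ 2 * inter w ρ i j + 32 := by
  set t := |(i : ℝ) - j| + 1 with ht
  set D := dev w ρ p - dev w ρ j with hD
  have hp' : (p : ℝ) = i ∨ (p : ℝ) = i + 1 := by
    rcases hp with h | h
    · exact Or.inl (by exact_mod_cast h)
    · exact Or.inr (by exact_mod_cast h)
  have key : D ^ 2 ≤ ∫ z in Ioc (i : ℝ) (i + 1) ×ˢ Ioc (j : ℝ) (j + 1),
      (2 * t ^ 2 * quotSq (path w) ρ z + 32) := by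
    rw [← setIntegral_cell_const i j (D ^ 2)]
    refine setIntegral_mono_on_ae (integrableOn_const (volume_box_ne_top _ _ _ _))
      (((integrableOn_cell w ρ i j).const_mul _).add
      (integrableOn_const (volume_box_ne_top _ _ _ _))) (measurableSet_box _ _ _ _) ?_
    filter_upwards [ae_fst_ne_snd] with z hzne hz
    have ha := abs_le.1 (abs_dev_sub_le w hρ hp' hz.1)
    have hb := abs_le.1 (abs_dev_sub_le w hρ (Or.inl rfl) hz.2)
    set X := (path w z.1 - ρ * z.1) - (path w z.2 - ρ * z.2) with hX
    have hXD : |X - D| ≤ 4 := by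
      rw [abs_le]
      constructor <;> linarith [ha.1, ha.2, hb.1, hb.2]
    have hX2 : D ^ 2 ≤ 2 * X ^ 2 + 32 := by
      have : (X - D) ^ 2 ≤ 16 := by
        rw [← sq_abs]
        nlinarith [abs_nonneg (X - D)]
      nlinarith [sq_nonneg (D - 2 * X)]
    have h6 : |z.1 - z.2| ≤ t := by
      have h7 : |(z.1 - z.2) - ((i : ℝ) - j)| ≤ 1 := by
        have := hz.1.1
        have := hz.1.2
        have := hz.2.1
        have := hz.2.2
        rw [abs_le]
        constructor <;> linarith
      have := abs_sub_abs_le_abs_sub (z.1 - z.2) ((i : ℝ) - j)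
      linarith
    have h7 : (z.1 - z.2) ^ 2 ≤ t ^ 2 := by
      rw [← sq_abs]
      exact pow_le_pow_left₀ (abs_nonneg _) h6 2
    have hz2 : 0 < (z.1 - z.2) ^ 2 := by
      have := sub_ne_zero.2 hzne
      positivity
    have h8 : X ^ 2 = (z.1 - z.2) ^ 2 * quotSq (path w) ρ z := by
      rw [quotSq_eq_div hzne, mul_div_cancel₀ _ hz2.ne']
    have h9 := mul_le_mul_of_nonneg_right h7 (quotSq_nonneg (path w) ρ z)
    linarith
  rw [integral_add ((integrableOn_cell w ρ i j).const_mul _)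
    (integrableOn_const (volume_box_ne_top _ _ _ _)), integral_const_mul,
    setIntegral_cell_const] at key
  change D ^ 2 ≤ 2 * t ^ 2 * cellE (path w) ρ i j + 32 at key
  have h1 : cellE (path w) ρ i j ≤ 8 * inter w ρ i j := by
    have := hookPair_nonneg w i j
    rw [inter]
    linarith
  have h2 := mul_le_mul_of_nonneg_left h1 (show 0 ≤ 2 * t ^ 2 by positivity)
  linarith

/-! ### The cost of concatenating blocks -/

/-- The harmonic sum `1 + 1/2 + ... + 1/m`. -/
noncomputable def hsum (m : ℕ) : ℝ := ∑ i ∈ Finset.range m, 1 / ((i : ℝ) + 1)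

/-- A Hardy-type functional measuring the deviation of a word near both ends of `[0, m]`. -/
noncomputable def edge (w : ℕ → Bool) (ρ : ℝ) (m : ℕ) : ℝ :=
  ∑ i ∈ Finset.range m, (dev w ρ i ^ 2 / ((i : ℝ) + 1) +
    (dev w ρ m - dev w ρ i) ^ 2 / ((m : ℝ) - i))

theorem hsum_reflect (m : ℕ) : ∑ i ∈ Finset.range m, 1 / ((m : ℝ) - i) = hsum m := by
  rw [hsum, ← Finset.sum_range_reflect]
  refine Finset.sum_congr rfl fun i hi => ?_
  have := Finset.mem_range.1 hi
  have h : ((m - 1 - i : ℕ) : ℝ) = (m : ℝ) - 1 - i := by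
    rw [Nat.sub_sub, Nat.cast_sub (by omega)]
    push_cast
    ring
  rw [h]
  congr 1
  ring

theorem sum_inv_sq_left {I A : ℕ} (h : A ≤ I) :
    ∑ J ∈ Finset.range A, 1 / ((I : ℝ) - J) ^ 2 ≤ 2 / ((I : ℝ) + 1 - A) := by
  have hI : (0 : ℝ) ≤ I := I.cast_nonneg
  -- Strengthened for induction: `1 / t ^ 2 ≤ 2 / t - 2 / (t + 1)` for `t ≥ 1` makes the sum
  -- telescope.
  suffices ∑ J ∈ Finset.range A, 1 / ((I : ℝ) - J) ^ 2 ≤ 2 / ((I : ℝ) + 1 - A) - 2 / ((I : ℝ) + 1) by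
    have : 0 ≤ 2 / ((I : ℝ) + 1) := by positivity
    linarith
  induction A with
  | zero => simp
  | succ A ih =>
    rw [Finset.sum_range_succ]
    have ih' := ih (by omega)
    have h1 : (1 : ℝ) ≤ (I : ℝ) - A := by
      have : (A : ℝ) + 1 ≤ I := by exact_mod_cast h
      linarith
    have h2 : 1 / ((I : ℝ) - A) ^ 2 ≤ 2 / ((I : ℝ) - A) - 2 / ((I : ℝ) + 1 - A) := by
      rw [show (I : ℝ) + 1 - A = ((I : ℝ) - A) + 1 by ring]
      generalize (I : ℝ) - A = t at h1
      rw [div_sub_div _ _ (by positivity) (by positivity), div_le_div_iff₀ (by positivity)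
        (by positivity)]
      nlinarith
    push_cast
    rw [show (I : ℝ) + 1 - (A + 1) = I - A by ring]
    linarith

theorem sum_inv_sq_right {I B : ℕ} (h : I < B) (L : ℕ) :
    ∑ l ∈ Finset.range L, 1 / ((I : ℝ) - ((B + l : ℕ) : ℝ)) ^ 2 ≤ 2 / ((B : ℝ) - I) := by
  have hB : (I : ℝ) + 1 ≤ B := by exact_mod_cast h
  suffices ∑ l ∈ Finset.range L, 1 / ((I : ℝ) - ((B + l : ℕ) : ℝ)) ^ 2 ≤
      2 / ((B : ℝ) - I) - 2 / ((B : ℝ) + L - I) by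
    have h1 : (0 : ℝ) ≤ L := L.cast_nonneg
    have : 0 ≤ 2 / ((B : ℝ) + L - I) := div_nonneg zero_le_two (by linarith)
    linarith
  induction L with
  | zero => simp
  | succ L ih =>
    rw [Finset.sum_range_succ]
    have h0 : (0 : ℝ) ≤ L := L.cast_nonneg
    have h1 : (1 : ℝ) ≤ (B : ℝ) + L - I := by linarith
    have h2 : 1 / ((I : ℝ) - ((B + L : ℕ) : ℝ)) ^ 2 ≤
        2 / ((B : ℝ) + L - I) - 2 / ((B : ℝ) + (L + 1 : ℕ) - I) := by
      push_cast
      rw [show (B : ℝ) + (L + 1) - I = ((B : ℝ) + L - I) + 1 by ring,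
        show ((I : ℝ) - (B + L)) ^ 2 = ((B : ℝ) + L - I) ^ 2 by ring]
      generalize (B : ℝ) + L - I = t at h1
      rw [div_sub_div _ _ (by positivity) (by positivity), div_le_div_iff₀ (by positivity)
        (by positivity)]
      nlinarith
    linarith

theorem sum_range_mul {M m : ℕ} (F : ℕ → ℝ) :
    ∑ I ∈ Finset.range (M * m), F I =
      ∑ k ∈ Finset.range M, ∑ i ∈ Finset.range m, F (k * m + i) := by
  induction M with
  | zero => simp
  | succ M ih => rw [add_mul, one_mul, Finset.sum_range_add, ih, Finset.sum_range_succ]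

/-- The kernel of the interactions of different blocks of length `m`. -/
noncomputable def offBlock (m I J : ℕ) : ℝ := if I / m = J / m then 0 else 1 / ((I : ℝ) - J) ^ 2

theorem offBlock_comm (m I J : ℕ) : offBlock m I J = offBlock m J I := by
  unfold offBlock
  simp only [eq_comm (a := I / m)]
  split_ifs
  · rfl
  · congr 1
    ring

/-- Steps outside the block are at distance at least `i + 1` on the left and at least `m - i` on the
right; both tails telescope. -/
theorem sum_offBlock_le {m : ℕ} {k i : ℕ} (hi : i < m) (n : ℕ) :
    ∑ J ∈ Finset.range n, offBlock m (k * m + i) J ≤ 2 / ((i : ℝ) + 1) + 2 / ((m : ℝ) - i) := by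
  have hm : 0 < m := by omega
  set I := k * m + i with hI
  have hIk : I / m = k := by
    rw [hI, mul_comm, Nat.mul_add_div hm, Nat.div_eq_of_lt hi, add_zero]
  have h1 := sum_inv_sq_left (I := I) (A := k * m) (by omega)
  have h2 := sum_inv_sq_right (I := I) (B := (k + 1) * m) (by rw [add_mul]; omega) n
  have hIr : (I : ℝ) = k * m + i := by rw [hI]; push_cast; ring
  have e1 : (I : ℝ) + 1 - (k * m : ℕ) = i + 1 := by rw [hIr]; push_cast; ring
  have e2 : (((k + 1) * m : ℕ) : ℝ) - I = m - i := by rw [hIr]; push_cast; ring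
  rw [e1] at h1
  rw [e2] at h2
  refine le_trans ?_ (add_le_add h1 h2)
  have hle : ∀ J, offBlock m I J ≤ (if J < k * m then 1 / ((I : ℝ) - J) ^ 2 else 0) +
      (if (k + 1) * m ≤ J then 1 / ((I : ℝ) - J) ^ 2 else 0) := by
    intro J
    have hp : 0 ≤ 1 / ((I : ℝ) - J) ^ 2 := by positivity
    unfold offBlock
    rw [hIk]
    split_ifs with a b c <;> first | linarith | skip
    exfalso
    apply a
    symm
    rw [Nat.div_eq_iff hm]
    rw [add_mul, one_mul] at *
    omega
  refine (Finset.sum_le_sum fun J _ => hle J).trans ?_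
  rw [Finset.sum_add_distrib]
  refine add_le_add ?_ ?_
  · rw [← Finset.sum_filter]
    refine Finset.sum_le_sum_of_subset_of_nonneg ?_ fun _ _ _ => by positivity
    intro J hJ
    simp only [Finset.mem_filter, Finset.mem_range] at hJ ⊢
    exact hJ.2
  · rw [← Finset.sum_filter,
      ← Finset.sum_image (s := Finset.range n) (g := fun l => (k + 1) * m + l)
        (f := fun J : ℕ => 1 / ((I : ℝ) - (J : ℝ)) ^ 2) (by intro x _ y _ h; simpa using h)]
    refine Finset.sum_le_sum_of_subset_of_nonneg ?_ fun _ _ _ => by positivity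
    intro J hJ
    simp only [Finset.mem_filter, Finset.mem_range, Finset.mem_image] at hJ ⊢
    exact ⟨J - (k + 1) * m, by omega, by omega⟩

theorem dev_shift (w : ℕ → Bool) (ρ : ℝ) (a i : ℕ) :
    dev (shift a w) ρ i = dev w ρ (a + i) - dev w ρ a := by
  simp only [dev, ht_shift]
  push_cast
  ring

/-- Across blocks, `inter_le` and `(a - b) ^ 2 ≤ 2 * a ^ 2 + 2 * b ^ 2` let each step pay for its
own deviation against the two tails of the kernel. Because the path is within `2` of the line at the
block ends, that deviation can be measured from either end, which produces `edge`. -/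
theorem energy_mul_le (w : ℕ → Bool) {ρ : ℝ} (hρ : |ρ| ≤ 1) {M m : ℕ} (hm : 0 < m)
    (hdev : ∀ k ≤ M, |dev w ρ (k * m)| ≤ 2) :
    energy w ρ (M * m) ≤ ∑ k ∈ Finset.range M, (energy (shift (k * m) w) ρ m +
      272 * edge (shift (k * m) w) ρ m + 2244 * hsum m) := by
  have hle : ∀ I J, inter w ρ I J ≤ (if I / m = J / m then inter w ρ I J else 0) +
      (offBlock m I J * (17 * (2 * dev w ρ I ^ 2 + 1 / 2)) +
        offBlock m J I * (17 * (2 * dev w ρ J ^ 2 + 1 / 2))) := by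
    intro I J
    rw [offBlock_comm m J I]
    unfold offBlock
    split_ifs with h
    · simp
    · have hne : I ≠ J := fun h' => h (by rw [h'])
      refine (inter_le w hρ hne).trans ?_
      have h1 : 17 * ((dev w ρ I - dev w ρ J) ^ 2 + 1) / ((I : ℝ) - J) ^ 2 =
        1 / ((I : ℝ) - J) ^ 2 * (17 * ((dev w ρ I - dev w ρ J) ^ 2 + 1)) := by ring
      rw [h1, zero_add, ← mul_add]
      refine mul_le_mul_of_nonneg_left ?_ (by positivity)
      nlinarith [sq_nonneg (dev w ρ I + dev w ρ J)]
  have h1 : energy w ρ (M * m) ≤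
      ∑ I ∈ Finset.range (M * m), (∑ J ∈ Finset.range (M * m),
        (if I / m = J / m then inter w ρ I J else 0)) +
      ∑ I ∈ Finset.range (M * m), (∑ J ∈ Finset.range (M * m), offBlock m I J) *
        (17 * (4 * dev w ρ I ^ 2 + 1)) := by
    have h2 : energy w ρ (M * m) ≤ ∑ I ∈ Finset.range (M * m), ∑ J ∈ Finset.range (M * m),
        ((if I / m = J / m then inter w ρ I J else 0) +
      (offBlock m I J * (17 * (2 * dev w ρ I ^ 2 + 1 / 2)) +
        offBlock m J I * (17 * (2 * dev w ρ J ^ 2 + 1 / 2)))) :=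
      Finset.sum_le_sum fun I _ => Finset.sum_le_sum fun J _ => hle I J
    refine h2.trans_eq ?_
    simp only [Finset.sum_add_distrib]
    rw [Finset.sum_comm (f := fun I J => offBlock m J I * (17 * (2 * dev w ρ J ^ 2 + 1 / 2))),
      ← Finset.sum_add_distrib]
    congr 1
    refine Finset.sum_congr rfl fun I _ => ?_
    rw [← Finset.sum_mul]
    ring
  refine h1.trans ?_
  rw [sum_range_mul, sum_range_mul, ← Finset.sum_add_distrib]
  refine Finset.sum_le_sum fun k hk => ?_
  have hkM := Finset.mem_range.1 hk
  have hdiag : ∑ i ∈ Finset.range m, (∑ J ∈ Finset.range (M * m),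
      (if (k * m + i) / m = J / m then inter w ρ (k * m + i) J else 0)) =
      energy (shift (k * m) w) ρ m := by
    have hdiv : ∀ k' i, i < m → (k' * m + i) / m = k' := fun k' i hi => by
      rw [mul_comm, Nat.mul_add_div hm, Nat.div_eq_of_lt hi, add_zero]
    refine Finset.sum_congr rfl fun i hi => ?_
    rw [sum_range_mul, Finset.sum_eq_single k]
    · refine Finset.sum_congr rfl fun j hj => ?_
      rw [hdiv _ _ (Finset.mem_range.1 hi), hdiv _ _ (Finset.mem_range.1 hj), if_pos rfl,
        inter_shift]
    · intro k' _ hne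
      refine Finset.sum_eq_zero fun j hj => ?_
      rw [hdiv _ _ (Finset.mem_range.1 hi), hdiv _ _ (Finset.mem_range.1 hj), if_neg hne.symm]
    · exact fun h => absurd hk h
  rw [hdiag, add_assoc]
  refine add_le_add le_rfl ?_
  rw [edge, ← hsum_reflect]
  have hh : 2244 * ∑ i ∈ Finset.range m, 1 / ((m : ℝ) - i) =
      1122 * ∑ i ∈ Finset.range m, 1 / ((i : ℝ) + 1) +
        1122 * ∑ i ∈ Finset.range m, 1 / ((m : ℝ) - i) := by
    rw [hsum_reflect, hsum]
    ring
  rw [hh, Finset.mul_sum, Finset.mul_sum, Finset.mul_sum, ← Finset.sum_add_distrib,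
    ← Finset.sum_add_distrib]
  refine Finset.sum_le_sum fun i hi => ?_
  have him := Finset.mem_range.1 hi
  have hd1 := abs_le.1 (hdev k hkM.le)
  have hd2 := abs_le.1 (hdev (k + 1) hkM)
  rw [add_mul, one_mul] at hd2
  rw [dev_shift, dev_shift]
  set e := dev w ρ (k * m)
  set e' := dev w ρ (k * m + m)
  set u := dev w ρ (k * m + i)
  -- Each tail is compared with the block end on its own side. The constants come from `2 * 17 * (4
  -- * (8 + 2 * d ^ 2) + 1) = 1122 + 272 * d ^ 2`, with `1122` occurring once for each side.
  have hu1 : u ^ 2 ≤ 8 + 2 * (u - e) ^ 2 := by nlinarith [sq_nonneg (u - 2 * e)]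
  have hu2 : u ^ 2 ≤ 8 + 2 * (e' - e - (u - e)) ^ 2 := by
    rw [show e' - e - (u - e) = e' - u by ring]
    nlinarith [sq_nonneg (u - 2 * e')]
  have him' : (i : ℝ) + 1 ≤ m := by exact_mod_cast him
  have hp1 : (0 : ℝ) < 1 / (i + 1) := by positivity
  have hp2 : (0 : ℝ) < 1 / (m - i) := by
    have : (0 : ℝ) < m - i := by linarith
    positivity
  have hs := mul_le_mul_of_nonneg_right (sum_offBlock_le (k := k) him (M * m))
    (show 0 ≤ 17 * (4 * u ^ 2 + 1) by positivity)
  refine hs.trans ?_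
  have hA := mul_le_mul_of_nonneg_left hu1 hp1.le
  have hB := mul_le_mul_of_nonneg_left hu2 hp2.le
  rw [div_eq_mul_one_div 2 ((i : ℝ) + 1), div_eq_mul_one_div 2 ((m : ℝ) - i),
    div_eq_mul_one_div ((u - e) ^ 2) ((i : ℝ) + 1),
    div_eq_mul_one_div ((e' - e - (u - e)) ^ 2) ((m : ℝ) - i)]
  generalize 1 / ((i : ℝ) + 1) = A at *
  generalize 1 / ((m : ℝ) - i) = B at *
  linarith

/-! ### Existence and boundedness of the limit -/

theorem exists_word_of_downs {D : ℕ → ℕ} (h0 : D 0 = 0)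
    (h : ∀ k, D (k + 1) = D k ∨ D (k + 1) = D k + 1) : ∃ w : ℕ → Bool, ∀ i, downs w i = D i := by
  refine ⟨fun k => decide (D (k + 1) = D k), fun i => ?_⟩
  induction i with
  | zero => simp [downs, h0]
  | succ i ih =>
    rw [downs_succ, ih]
    rcases h i with h1 | h1 <;> simp [h1]

theorem floor_mul_succ {β : ℝ} {m : ℕ} (h0 : 0 ≤ β) (h1 : β ≤ m) (k : ℕ) :
    ⌊(k : ℝ) * β⌋₊ ≤ ⌊((k + 1 : ℕ) : ℝ) * β⌋₊ ∧
      ⌊((k + 1 : ℕ) : ℝ) * β⌋₊ ≤ ⌊(k : ℝ) * β⌋₊ + m := by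
  have hk : (0 : ℝ) ≤ k := k.cast_nonneg
  constructor
  · refine Nat.floor_le_floor ?_
    push_cast
    nlinarith
  · rw [← Nat.floor_add_natCast (by positivity)]
    refine Nat.floor_le_floor ?_
    push_cast
    nlinarith

theorem hsum_one : hsum 1 = 1 := by simp [hsum]

theorem dev_eq (w : ℕ → Bool) (ρ : ℝ) (i : ℕ) :
    dev w ρ i = 2 * ((1 - ρ) / 2 * i - downs w i) := by
  rw [dev, ht_eq]
  ring

/-- The balanced word, with `⌊k * β⌋` down-steps among its first `k`, always has deviation between
`0` and `2`, so it may be regarded as a concatenation of blocks of length one. -/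
theorem sigmaLoc_le_mul {ρ : ℝ} (hρ : |ρ| ≤ 1) (n : ℕ) : sigmaLoc n ρ ≤ 4000 * n := by
  have hρ' := abs_le.1 hρ
  set β := (1 - ρ) / 2 with hβ
  have hβ0 : 0 ≤ β := by rw [hβ]; linarith
  have hβ1 : β ≤ 1 := by rw [hβ]; linarith
  obtain ⟨w, hw⟩ := exists_word_of_downs (D := fun k => ⌊(k : ℝ) * β⌋₊) (by simp) fun k => by
    have := floor_mul_succ (m := 1) hβ0 (by simpa using hβ1) k
    omega
  have hdev : ∀ i, 0 ≤ dev w ρ i ∧ dev w ρ i ≤ 2 := by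
    intro i
    have hnn : 0 ≤ (i : ℝ) * β := by positivity
    have h1 := Nat.floor_le hnn
    have h2 := (Nat.lt_floor_add_one ((i : ℝ) * β)).le
    rw [dev_eq, hw, ← hβ, mul_comm β]
    constructor <;> linarith
  have h := energy_mul_le w hρ (M := n) (m := 1) one_pos fun k _ => by
    rw [abs_le]
    constructor <;> linarith [hdev (k * 1)]
  rw [mul_one] at h
  refine (sigmaLoc_le w ρ n).trans (h.trans ?_)
  have hle : ∀ k ∈ Finset.range n, energy (shift (k * 1) w) ρ 1 +
      272 * edge (shift (k * 1) w) ρ 1 + 2244 * hsum 1 ≤ 4000 := by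
    intro k _
    have h1 : energy (shift (k * 1) w) ρ 1 ≤ 1 / 2 := by
      simpa [energy] using inter_self_le (shift (k * 1) w) hρ 0
    have h2 : edge (shift (k * 1) w) ρ 1 ≤ 4 := by
      simp only [edge, Finset.sum_range_one, dev_shift, add_zero]
      have ha := hdev (k * 1 + 1)
      have hb := hdev (k * 1)
      simp only [CharP.cast_eq_zero, zero_add, Nat.cast_one, sub_zero, div_one]
      nlinarith
    rw [hsum_one]
    linarith
  refine (Finset.sum_le_sum hle).trans ?_
  simp [mul_comm]

theorem subadditive_neg_sigmaLoc (ρ : ℝ) : Subadditive fun n => -sigmaLoc n ρ := fun m n => by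
  have := sigmaLoc_add_le ρ m n
  linarith

theorem bddBelow_neg_sigmaLoc {ρ : ℝ} (hρ : |ρ| ≤ 1) :
    BddBelow (range fun n : ℕ => -sigmaLoc n ρ / n) := by
  refine ⟨-4000, ?_⟩
  rintro _ ⟨n, rfl⟩
  have := sigmaLoc_le_mul hρ n
  rcases n.eq_zero_or_pos with rfl | hn
  · simp
  · have hn' : (0 : ℝ) < n := by exact_mod_cast hn
    simp only
    rw [le_div_iff₀ hn']
    linarith

/-- Fekete's lemma for the subadditive sequence `-sigmaLoc n ρ`. -/
theorem tendsto_sigma {ρ : ℝ} (hρ : |ρ| ≤ 1) :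
    Tendsto (fun n : ℕ => sigmaLoc n ρ / n) atTop (𝓝 (sigma ρ)) := by
  have h := ((subadditive_neg_sigmaLoc ρ).tendsto_lim (bddBelow_neg_sigmaLoc hρ)).neg
  have h' : Tendsto (fun n : ℕ => sigmaLoc n ρ / n) atTop
      (𝓝 (-(subadditive_neg_sigmaLoc ρ).lim)) := by
    refine h.congr fun n => ?_
    rw [neg_div, neg_neg]
  rw [sigma, h'.limUnder_eq]
  exact h'

theorem sigma_nonneg {ρ : ℝ} (hρ : |ρ| ≤ 1) : 0 ≤ sigma ρ :=
  ge_of_tendsto' (tendsto_sigma hρ) fun n => div_nonneg (sigmaLoc_nonneg n ρ) n.cast_nonneg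

theorem sigma_le {ρ : ℝ} (hρ : |ρ| ≤ 1) : sigma ρ ≤ 4000 := by
  refine le_of_tendsto' (tendsto_sigma hρ) fun n => ?_
  exact div_le_of_le_mul₀ n.cast_nonneg (by norm_num) (sigmaLoc_le_mul hρ n)

/-! ### Bounding `sigma` by prescribed blocks -/

theorem dev_congr {w w' : ℕ → Bool} {n : ℕ} (h : ∀ k < n, w k = w' k) (ρ : ℝ) {i : ℕ}
    (hi : i ≤ n) : dev w ρ i = dev w' ρ i := by
  rw [dev, dev, ht_congr h hi]

theorem edge_congr {w w' : ℕ → Bool} {n : ℕ} (h : ∀ k < n, w k = w' k) (ρ : ℝ) :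
    edge w ρ n = edge w' ρ n :=
  Finset.sum_congr rfl fun i hi => by
    rw [dev_congr h ρ (Finset.mem_range.1 hi).le, dev_congr h ρ le_rfl]

theorem downs_congr {w w' : ℕ → Bool} {n : ℕ} (h : ∀ k < n, w k = w' k) :
    downs w n = downs w' n := by
  have h1 := ht_congr h le_rfl
  rw [ht_eq, ht_eq] at h1
  have : (downs w n : ℝ) = downs w' n := by linarith
  exact_mod_cast this

theorem downs_add (w : ℕ → Bool) (a b : ℕ) :
    downs w (a + b) = downs w a + downs (shift a w) b := by
  simp only [downs, Nat.count_add, shift]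
  congr

/-- Concatenating blocks of length `m` whose numbers of down-steps are adapted to the slope `ρ`
bounds `sigma ρ` from above. -/
theorem mul_sigma_le {ρ : ℝ} (hρ : |ρ| ≤ 1) {m : ℕ} (hm : 0 < m) {B : ℝ}
    (h : ∀ D : ℕ, D ≤ m → |(D : ℝ) - (1 - ρ) / 2 * m| ≤ 1 → ∃ g : ℕ → Bool, downs g m = D ∧
      energy g ρ m + 272 * edge g ρ m + 2244 * hsum m ≤ B) : m * sigma ρ ≤ B := by
  have hρ' := abs_le.1 hρ
  have hm' : (0 : ℝ) < m := by exact_mod_cast hm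
  set β := (1 - ρ) / 2 * m with hβ
  have hβ0 : 0 ≤ β := mul_nonneg (by linarith) hm'.le
  have hβ1 : β ≤ m := by
    rw [hβ]
    nlinarith
  -- Differences of `⌊k * β⌋` differ from `β` by at most one, and they keep the total number of
  -- down-steps after `k` blocks equal to `⌊k * β⌋`. The rounding errors therefore do not
  -- accumulate.
  have hex : ∀ k : ℕ, ∃ g : ℕ → Bool,
      downs g m = ⌊((k + 1 : ℕ) : ℝ) * β⌋₊ - ⌊(k : ℝ) * β⌋₊ ∧
      energy g ρ m + 272 * edge g ρ m + 2244 * hsum m ≤ B := by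
    intro k
    have hk := floor_mul_succ hβ0 hβ1 k
    refine h _ (by omega) ?_
    rw [Nat.cast_sub hk.1, abs_le]
    have hkn : (0 : ℝ) ≤ k := k.cast_nonneg
    have h1 := Nat.floor_le (show 0 ≤ (k : ℝ) * β by positivity)
    have h2 := (Nat.lt_floor_add_one ((k : ℝ) * β)).le
    have h3 := Nat.floor_le (show 0 ≤ ((k + 1 : ℕ) : ℝ) * β by positivity)
    have h4 := (Nat.lt_floor_add_one (((k + 1 : ℕ) : ℝ) * β)).le
    have h5 : ((k + 1 : ℕ) : ℝ) * β = k * β + β := by push_cast; ring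
    constructor <;> linarith
  choose g hg hgB using hex
  let G : ℕ → Bool := fun x => g (x / m) (x % m)
  have hG : ∀ k, ∀ i < m, shift (k * m) G i = g k i := by
    intro k i hi
    have h1 : (k * m + i) / m = k := by
      rw [mul_comm, Nat.mul_add_div hm, Nat.div_eq_of_lt hi, add_zero]
    have h2 : (k * m + i) % m = i := by rw [mul_comm, Nat.mul_add_mod, Nat.mod_eq_of_lt hi]
    simp only [shift, G, h1, h2]
  have hdowns : ∀ k : ℕ, downs G (k * m) = ⌊(k : ℝ) * β⌋₊ := by
    intro k
    induction k with
    | zero => simp [downs]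
    | succ k ih =>
      rw [add_mul, one_mul, downs_add, ih, downs_congr (hG k), hg]
      have := (floor_mul_succ hβ0 hβ1 k).1
      omega
  have hdev : ∀ k : ℕ, |dev G ρ (k * m)| ≤ 2 := by
    intro k
    have hnn : 0 ≤ (k : ℝ) * β := by positivity
    have h1 := Nat.floor_le hnn
    have h2 := (Nat.lt_floor_add_one ((k : ℝ) * β)).le
    have h3 : (1 - ρ) / 2 * ((k * m : ℕ) : ℝ) = k * β := by
      rw [hβ]
      push_cast
      ring
    rw [dev_eq, hdowns, h3, abs_le]
    constructor <;> linarith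
  have hM : ∀ M : ℕ, sigmaLoc (M * m) ρ ≤ M * B := by
    intro M
    refine (sigmaLoc_le G ρ _).trans ((energy_mul_le G hρ hm fun k _ => hdev k).trans ?_)
    have : ∑ k ∈ Finset.range M, (energy (shift (k * m) G) ρ m +
        272 * edge (shift (k * m) G) ρ m + 2244 * hsum m) ≤ ∑ k ∈ Finset.range M, B := by
      refine Finset.sum_le_sum fun k _ => ?_
      rw [energy_congr (hG k), edge_congr (hG k)]
      exact hgB k
    simpa using this
  -- The limit is already known to exist, so the subsequence of multiples of `m` determines it.
  have ht := (tendsto_sigma hρ).comp (tendsto_id.atTop_mul_const' hm)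
  rw [mul_comm, ← le_div_iff₀ hm']
  refine le_of_tendsto ht ?_
  filter_upwards [eventually_gt_atTop 0] with M hM0
  have hM0' : (0 : ℝ) < M := by exact_mod_cast hM0
  simp only [Function.comp, id]
  push_cast
  rw [div_le_div_iff₀ (by positivity) hm']
  have := mul_le_mul_of_nonneg_right (hM M) hm'.le
  linarith

/-! ### Kernel sums and weights -/

/-- Every distance from `i` occurs at most twice, once on each side. -/
theorem sum_dist_le {h : ℝ → ℝ} (hh : ∀ x, 0 ≤ h x) {i m : ℕ} (hi : i < m) :
    ∑ j ∈ Finset.range m, h (|(i : ℝ) - j| + 1) ≤ 2 * ∑ t ∈ Finset.range m, h ((t : ℝ) + 1) := by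
  obtain ⟨r, rfl⟩ : ∃ r, m = i + 1 + r := ⟨m - (i + 1), by omega⟩
  rw [Finset.sum_range_add, two_mul]
  have hmono : ∀ n ≤ i + 1 + r, ∑ t ∈ Finset.range n, h ((t : ℝ) + 1) ≤
      ∑ t ∈ Finset.range (i + 1 + r), h ((t : ℝ) + 1) := fun n hn =>
    Finset.sum_le_sum_of_subset_of_nonneg (Finset.range_subset_range.2 hn) fun _ _ _ => hh _
  refine add_le_add ((Eq.le ?_).trans (hmono (i + 1) (by omega)))
    (le_trans ?_ (hmono (r + 1) (by omega)))
  · rw [← Finset.sum_range_reflect]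
    refine Finset.sum_congr rfl fun j hj => ?_
    have hj' : j ≤ i := by have := Finset.mem_range.1 hj; omega
    rw [show i + 1 - 1 - j = i - j by omega, Nat.cast_sub hj', sub_sub_cancel, Nat.abs_cast]
  · rw [Finset.sum_range_succ' (fun t : ℕ => h ((t : ℝ) + 1))]
    refine le_trans (Finset.sum_le_sum fun l _ => Eq.le ?_) (le_add_of_nonneg_right (hh _))
    congr 2
    have h0 : (0 : ℝ) ≤ l := l.cast_nonneg
    rw [abs_sub_comm]
    push_cast
    rw [show (i : ℝ) + 1 + l - i = l + 1 by ring, abs_of_nonneg (by linarith)]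

theorem sum_inv_sq_le (m : ℕ) : ∑ t ∈ Finset.range m, 1 / ((t : ℝ) + 1) ^ 2 ≤ 2 := by
  have h := sum_inv_sq_left (I := m) (A := m) le_rfl
  rw [← Finset.sum_range_reflect] at h
  refine le_trans (Finset.sum_le_sum fun t ht => Eq.le ?_) (h.trans_eq (by ring))
  have : t < m := Finset.mem_range.1 ht
  rw [Nat.sub_sub, Nat.cast_sub (by omega)]
  push_cast
  congr 2
  ring

theorem sum_inv_sqrt_le (m : ℕ) : ∑ t ∈ Finset.range m, 1 / √((t : ℝ) + 1) ≤ 2 * √m := by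
  induction m with
  | zero => simp
  | succ m ih =>
    rw [Finset.sum_range_succ]
    have h0 : (0 : ℝ) ≤ m := m.cast_nonneg
    have h1 : 0 < √((m : ℝ) + 1) := Real.sqrt_pos.2 (by linarith)
    have h2 := Real.sq_sqrt h0
    have h3 := Real.sq_sqrt (show (0 : ℝ) ≤ m + 1 by linarith)
    have h4 : 1 / √((m : ℝ) + 1) ≤ 2 * √((m : ℝ) + 1) - 2 * √m := by
      rw [div_le_iff₀ h1]
      nlinarith [sq_nonneg (√((m : ℝ) + 1) - √m)]
    push_cast
    linarith

theorem hsum_nonneg (m : ℕ) : 0 ≤ hsum m := Finset.sum_nonneg fun _ _ => by positivity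

theorem hsum_mono : Monotone hsum := fun _ _ h =>
  Finset.sum_le_sum_of_subset_of_nonneg (Finset.range_subset_range.2 h) fun _ _ _ => by positivity

/-- The logarithm is traded for a small power: `log (p ^ 4) = 8 * log √p ≤ 8 * (√p - 1)`. The power
`1/2` is small enough for `p ^ 2 * hsum ^ 2` to be of order `p ^ 3`. -/
theorem hsum_pow_four_le {p : ℕ} (hp : 0 < p) : hsum (p ^ 4) ≤ 8 * √p := by
  have hp' : (1 : ℝ) ≤ p := by exact_mod_cast hp
  have h1 : hsum (p ^ 4) ≤ 1 + Real.log ((p ^ 4 : ℕ) : ℝ) := by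
    have := harmonic_le_one_add_log (p ^ 4)
    refine le_trans (Eq.le ?_) this
    simp [hsum, harmonic]
  have h2 : Real.log ((p ^ 4 : ℕ) : ℝ) = 8 * Real.log √p := by
    rw [Real.log_sqrt (by linarith)]
    push_cast
    rw [Real.log_pow]
    push_cast
    ring
  have hs : 0 < √(p : ℝ) := Real.sqrt_pos.2 (by linarith)
  have h3 := Real.log_le_sub_one_of_pos hs
  linarith

/-- The sum of `c` over the integers between `i` and `j`. -/
noncomputable def betweenSum (c : ℕ → ℝ) (m i j : ℕ) : ℝ :=
  ∑ k ∈ Finset.range m, if min i j ≤ k ∧ k ≤ max i j then c k else 0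

/-- Exchange the sums. For fixed `k`, the pairs `i ≤ k ≤ j` contribute at most `∑ 2 / (k + 1 - i)`
over `i ≤ k`, which is at most `2 * hsum m`; the two orders of `i` and `j` give the factor `4`. -/
theorem sum_betweenSum_le {c : ℕ → ℝ} (hc : ∀ k, 0 ≤ c k) (m : ℕ) :
    ∑ i ∈ Finset.range m, ∑ j ∈ Finset.range m, betweenSum c m i j / (|(i : ℝ) - j| + 1) ^ 2 ≤
      4 * hsum m * ∑ k ∈ Finset.range m, c k := by
  have hone : ∀ k < m, ∑ i ∈ Finset.range m, ∑ j ∈ Finset.range m,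
      (if i ≤ k ∧ k ≤ j then 1 / ((i : ℝ) - ((j + 1 : ℕ) : ℝ)) ^ 2 else 0) ≤ 2 * hsum m := by
    intro k hk
    have h1 : ∀ i, ∑ j ∈ Finset.range m,
        (if i ≤ k ∧ k ≤ j then 1 / ((i : ℝ) - ((j + 1 : ℕ) : ℝ)) ^ 2 else 0) ≤
        if i < k + 1 then 2 * (1 / (((k + 1 : ℕ) : ℝ) - i)) else 0 := by
      intro i
      by_cases hik : i ≤ k
      · rw [if_pos (by omega)]
        have h2 := sum_inv_sq_right (I := i) (B := k + 1) (by omega) m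
        rw [mul_one_div]
        refine le_trans ?_ h2
        simp only [hik, true_and]
        have himg : ∑ l ∈ Finset.range m, 1 / ((i : ℝ) - ((k + 1 + l : ℕ) : ℝ)) ^ 2 =
            ∑ j ∈ (Finset.range m).image (fun l => k + l),
              1 / ((i : ℝ) - ((j + 1 : ℕ) : ℝ)) ^ 2 := by
          rw [Finset.sum_image (by intro x _ y _ h; simpa using h)]
          refine Finset.sum_congr rfl fun l _ => ?_
          rw [show k + l + 1 = k + 1 + l by ring]
        rw [himg, ← Finset.sum_filter]
        refine Finset.sum_le_sum_of_subset_of_nonneg ?_ fun _ _ _ => by positivity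
        intro J hJ
        simp only [Finset.mem_filter, Finset.mem_range, Finset.mem_image] at hJ ⊢
        exact ⟨J - k, by omega, by omega⟩
      · rw [if_neg (by omega)]
        refine (Finset.sum_eq_zero fun j _ => ?_).le
        rw [if_neg (by omega)]
    refine (Finset.sum_le_sum fun i _ => h1 i).trans ?_
    rw [← Finset.sum_filter, ← Finset.mul_sum]
    have h2 : (Finset.range m).filter (fun i => i < k + 1) = Finset.range (k + 1) := by
      ext i
      simp only [Finset.mem_filter, Finset.mem_range]
      omega
    rw [h2, hsum_reflect]
    have := hsum_mono (show k + 1 ≤ m by omega)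
    linarith
  have hle : ∀ i j, betweenSum c m i j / (|(i : ℝ) - j| + 1) ^ 2 ≤
      ∑ k ∈ Finset.range m, c k *
        ((if i ≤ k ∧ k ≤ j then 1 / ((i : ℝ) - ((j + 1 : ℕ) : ℝ)) ^ 2 else 0) +
        (if j ≤ k ∧ k ≤ i then 1 / ((j : ℝ) - ((i + 1 : ℕ) : ℝ)) ^ 2 else 0)) := by
    intro i j
    rw [betweenSum, Finset.sum_div]
    refine Finset.sum_le_sum fun k _ => ?_
    rcases le_total i j with h | h
    · have h' : (i : ℝ) ≤ j := by exact_mod_cast h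
      rw [min_eq_left h, max_eq_right h, abs_of_nonpos (by linarith)]
      have e : (-((i : ℝ) - j) + 1) ^ 2 = ((i : ℝ) - ((j + 1 : ℕ) : ℝ)) ^ 2 := by push_cast; ring
      rw [e]
      have h2 : 0 ≤ c k * (if j ≤ k ∧ k ≤ i then 1 / ((j : ℝ) - ((i + 1 : ℕ) : ℝ)) ^ 2 else 0) :=
        mul_nonneg (hc k) (by split_ifs <;> positivity)
      rw [mul_add]
      refine le_trans (Eq.le ?_) (le_add_of_nonneg_right h2)
      split_ifs
      · ring
      · simp
    · have h' : (j : ℝ) ≤ i := by exact_mod_cast h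
      rw [min_eq_right h, max_eq_left h, abs_of_nonneg (by linarith)]
      have e : (((i : ℝ) - j) + 1) ^ 2 = ((j : ℝ) - ((i + 1 : ℕ) : ℝ)) ^ 2 := by push_cast; ring
      rw [e]
      have h2 : 0 ≤ c k * (if i ≤ k ∧ k ≤ j then 1 / ((i : ℝ) - ((j + 1 : ℕ) : ℝ)) ^ 2 else 0) :=
        mul_nonneg (hc k) (by split_ifs <;> positivity)
      rw [mul_add]
      refine le_trans (Eq.le ?_) (le_add_of_nonneg_left h2)
      split_ifs
      · ring
      · simp
  refine (Finset.sum_le_sum fun i _ => Finset.sum_le_sum fun j _ => hle i j).trans ?_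
  rw [Finset.sum_congr rfl fun i _ => Finset.sum_comm, Finset.sum_comm, Finset.mul_sum]
  refine Finset.sum_le_sum fun k hk => ?_
  have hk' := Finset.mem_range.1 hk
  simp only [← Finset.mul_sum, Finset.sum_add_distrib]
  rw [Finset.sum_comm (f := fun i j : ℕ => if j ≤ k ∧ k ≤ i then
    1 / ((j : ℝ) - ((i + 1 : ℕ) : ℝ)) ^ 2 else 0)]
  have := mul_le_mul_of_nonneg_left (hone k hk') (hc k)
  linarith

/-- The weight of the pair `i`, `j` at the scale `p ^ 4`. -/
noncomputable def wt (p i j : ℕ) : ℝ := √√(|(i : ℝ) - j| + 1) / p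

theorem wt_nonneg (p i j : ℕ) : 0 ≤ wt p i j := by unfold wt; positivity

theorem inv_le_wt {p : ℕ} (i j : ℕ) : 1 / (p : ℝ) ≤ wt p i j := by
  unfold wt
  have h : (1 : ℝ) ≤ √√(|(i : ℝ) - j| + 1) := by
    rw [Real.one_le_sqrt, Real.one_le_sqrt]
    linarith [abs_nonneg ((i : ℝ) - j)]
  gcongr

theorem abs_sub_add_one_le {m i j : ℕ} (hi : i < m) (hj : j < m) : |(i : ℝ) - j| + 1 ≤ m := by
  have h1 : (i : ℝ) + 1 ≤ m := by exact_mod_cast hi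
  have h2 : (j : ℝ) + 1 ≤ m := by exact_mod_cast hj
  have h3 : (0 : ℝ) ≤ i := i.cast_nonneg
  have h4 : (0 : ℝ) ≤ j := j.cast_nonneg
  have : |(i : ℝ) - j| ≤ m - 1 := by rw [abs_le]; constructor <;> linarith
  linarith

theorem sqrt_sqrt_pow_four (p : ℕ) : √√((p : ℝ) ^ 4) = p := by
  have hp : (0 : ℝ) ≤ p := p.cast_nonneg
  rw [show (p : ℝ) ^ 4 = ((p : ℝ) ^ 2) ^ 2 by ring, Real.sqrt_sq (by positivity),
    Real.sqrt_sq hp]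

theorem sqrt_sqrt_le {p i j : ℕ} (hi : i < p ^ 4) (hj : j < p ^ 4) :
    √√(|(i : ℝ) - j| + 1) ≤ p := by
  have := abs_sub_add_one_le hi hj
  push_cast at this
  exact (Real.sqrt_le_sqrt (Real.sqrt_le_sqrt this)).trans_eq (sqrt_sqrt_pow_four p)

/-- With `d = |i - j| + 1 ≤ p ^ 4` one has `p / d ^ (1/4) ≤ p ^ 2 / √d`, and the sum of `1 / √d`
along a row is at most `4 * p ^ 2`. Thus the inverse weight is bounded on average. -/
theorem sum_inv_wt_le (p : ℕ) :
    ∑ i ∈ Finset.range (p ^ 4), ∑ j ∈ Finset.range (p ^ 4), 1 / wt p i j ≤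
      4 * ((p ^ 4 : ℕ) : ℝ) ^ 2 := by
  have hp : (0 : ℝ) ≤ p := p.cast_nonneg
  have h1 : ∀ i ∈ Finset.range (p ^ 4), ∑ j ∈ Finset.range (p ^ 4), 1 / wt p i j ≤
      4 * ((p ^ 4 : ℕ) : ℝ) := by
    intro i hi
    have h2 := sum_dist_le (h := fun x => (p : ℝ) ^ 2 * (1 / √x)) (fun x => by positivity)
      (Finset.mem_range.1 hi)
    have h3 := sum_inv_sqrt_le (p ^ 4)
    simp only [← Finset.mul_sum] at h2
    have h4 : √((p ^ 4 : ℕ) : ℝ) = (p : ℝ) ^ 2 := by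
      push_cast
      rw [show (p : ℝ) ^ 4 = ((p : ℝ) ^ 2) ^ 2 by ring, Real.sqrt_sq (by positivity)]
    rw [h4] at h3
    have h5 : ∑ j ∈ Finset.range (p ^ 4), 1 / wt p i j ≤
        ∑ j ∈ Finset.range (p ^ 4), (p : ℝ) ^ 2 * (1 / √(|(i : ℝ) - j| + 1)) := by
      refine Finset.sum_le_sum fun j hj => ?_
      have h6 := sqrt_sqrt_le (Finset.mem_range.1 hi) (Finset.mem_range.1 hj)
      have h7 : 0 < √(|(i : ℝ) - j| + 1) :=
        Real.sqrt_pos.2 (by linarith [abs_nonneg ((i : ℝ) - j)])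
      have h8 : 0 < √√(|(i : ℝ) - j| + 1) := Real.sqrt_pos.2 h7
      have h9 := Real.mul_self_sqrt h7.le
      rw [wt, one_div_div, mul_one_div, div_le_div_iff₀ h8 h7]
      nlinarith [mul_nonneg (mul_nonneg hp h8.le) (sub_nonneg.2 h6)]
    have h10 := mul_le_mul_of_nonneg_left h3 (sq_nonneg (p : ℝ))
    rw [← Finset.mul_sum] at h5
    push_cast
    linarith
  refine (Finset.sum_le_sum h1).trans ?_
  simp only [Finset.sum_const, Finset.card_range, nsmul_eq_mul]
  exact (by ring : _ = _).le

/-! ### Tilting a word -/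

/-- The remainder when the path of `g` is compared with a tilt of the path of `w`. -/
noncomputable def rem (w g : ℕ → Bool) (τ x : ℝ) : ℝ := path g x - τ * path w x - (1 - τ) * x

/-- The slope of the remainder `rem` on the `k`-th unit interval. -/
noncomputable def remSlope (w g : ℕ → Bool) (τ : ℝ) (k : ℕ) : ℝ :=
  sg (g k) - τ * sg (w k) - (1 - τ)

theorem rem_cell (w g : ℕ → Bool) (τ : ℝ) {i : ℕ} {x : ℝ} (h0 : (i : ℝ) ≤ x) (h1 : x ≤ i + 1) :
    rem w g τ x = rem w g τ i + remSlope w g τ i * (x - i) := by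
  rw [rem, rem, path_cell g h0 h1, path_cell w h0 h1, path_nat, path_nat, remSlope]
  ring

theorem rem_succ (w g : ℕ → Bool) (τ : ℝ) (i : ℕ) :
    rem w g τ ((i + 1 : ℕ) : ℝ) = rem w g τ i + remSlope w g τ i := by
  rw [rem_cell w g τ (i := i) (x := ((i + 1 : ℕ) : ℝ)) (by push_cast; linarith)
    (by push_cast; linarith)]
  push_cast
  ring

theorem abs_rem_sub_le (w g : ℕ → Bool) {τ : ℝ} (h0 : 0 ≤ τ) (h1 : τ ≤ 1) {x y : ℝ} (hx : 0 ≤ x)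
    (hy : 0 ≤ y) : |rem w g τ x - rem w g τ y| ≤ 2 * |x - y| := by
  have hw := abs_le.1 (abs_path_sub_le w hx hy)
  have hg := abs_le.1 (abs_path_sub_le g hx hy)
  have hxy := abs_le.1 (le_refl |x - y|)
  unfold rem
  rw [abs_le]
  constructor <;> nlinarith

theorem rem_mem {w g : ℕ → Bool} {τ : ℝ} {m : ℕ}
    (hv : ∀ i : ℕ, i ≤ m → 0 ≤ rem w g τ i ∧ rem w g τ i ≤ 2) {i : ℕ} (hi : i < m) {x : ℝ}
    (hx : x ∈ Ioc (i : ℝ) (i + 1)) : 0 ≤ rem w g τ x ∧ rem w g τ x ≤ 2 := by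
  have ha := hv i hi.le
  have hb := hv (i + 1) hi
  rw [rem_succ] at hb
  rw [rem_cell w g τ hx.1.le hx.2]
  have h1 := hx.1
  have h2 := hx.2
  constructor <;> nlinarith

/-- The increment is a sum of slopes. The partial steps at the ends have length at most `min 1 |x -
y|`, and a full step in between forces `|x - y| ≥ 1`, so that the minimum is `1`. -/
theorem abs_rem_sub_le_of_le (w g : ℕ → Bool) (τ : ℝ) {m i j : ℕ} (hij : i ≤ j) (hj : j < m)
    {x y : ℝ} (hx : x ∈ Ioc (i : ℝ) (i + 1)) (hy : y ∈ Ioc (j : ℝ) (j + 1)) :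
    |rem w g τ x - rem w g τ y| ≤
      betweenSum (fun k => |remSlope w g τ k|) m i j * min 1 |x - y| := by
  have hb : betweenSum (fun k => |remSlope w g τ k|) m i j =
      ∑ k ∈ Finset.Icc i j, |remSlope w g τ k| := by
    rw [betweenSum, min_eq_left hij, max_eq_right hij, ← Finset.sum_filter]
    congr 1
    ext k
    simp only [Finset.mem_filter, Finset.mem_range, Finset.mem_Icc]
    omega
  have hx1 := hx.1
  have hx2 := hx.2
  have hy1 := hy.1
  have hy2 := hy.2
  rcases hij.eq_or_lt with rfl | hlt
  · have h1 : |x - y| ≤ 1 := by rw [abs_le]; constructor <;> linarith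
    rw [hb, Finset.Icc_self, Finset.sum_singleton, min_eq_right h1, rem_cell w g τ hx.1.le hx.2,
      rem_cell w g τ hy.1.le hy.2, ← abs_mul]
    exact (congrArg _ (by ring)).le
  · have hsum : ∀ l, i + 1 ≤ l → rem w g τ l - rem w g τ ((i + 1 : ℕ) : ℝ) =
        ∑ k ∈ Finset.Ico (i + 1) l, remSlope w g τ k := by
      intro l hl
      induction l, hl using Nat.le_induction with
      | base => simp
      | succ l hl ih => rw [Finset.sum_Ico_succ_top hl, ← ih, rem_succ]; ring
    have e1 : rem w g τ y - rem w g τ x = remSlope w g τ i * (i + 1 - x) +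
        ∑ k ∈ Finset.Ico (i + 1) j, remSlope w g τ k + remSlope w g τ j * (y - j) := by
      rw [← hsum j hlt, rem_succ, rem_cell w g τ hx.1.le hx.2, rem_cell w g τ hy.1.le hy.2]
      ring
    have e2 : ∑ k ∈ Finset.Icc i j, |remSlope w g τ k| = |remSlope w g τ i| +
        ∑ k ∈ Finset.Ico (i + 1) j, |remSlope w g τ k| + |remSlope w g τ j| := by
      rw [← Finset.Ico_succ_right_eq_Icc, Order.succ_eq_add_one, Finset.sum_Ico_succ_top hij,
        Finset.sum_eq_sum_Ico_succ_bot hlt]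
    have hij' : (i : ℝ) + 1 ≤ j := by exact_mod_cast hlt
    have hxy : |x - y| = y - x := by rw [abs_sub_comm, abs_of_nonneg (by linarith)]
    set μ := min 1 |x - y| with hμ
    have hμ0 : 0 ≤ μ := le_min zero_le_one (abs_nonneg _)
    have hm1 : (i : ℝ) + 1 - x ≤ μ := le_min (by linarith) (by rw [hxy]; linarith)
    have hm2 : y - j ≤ μ := le_min (by linarith) (by rw [hxy]; linarith)
    have hmid : |∑ k ∈ Finset.Ico (i + 1) j, remSlope w g τ k| ≤
        (∑ k ∈ Finset.Ico (i + 1) j, |remSlope w g τ k|) * μ := by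
      rcases (Nat.succ_le_of_lt hlt).eq_or_lt with h | h
      · rw [← h, Nat.succ_eq_add_one, Finset.Ico_self]
        simp
      · have h' : (i : ℝ) + 1 + 1 ≤ j := by exact_mod_cast h
        have : μ = 1 := min_eq_left (by rw [hxy]; linarith)
        rw [this, mul_one]
        exact Finset.abs_sum_le_sum_abs _ _
    rw [hb, e2, abs_sub_comm, e1, add_mul, add_mul]
    refine (abs_add_le _ _).trans (add_le_add ((abs_add_le _ _).trans (add_le_add ?_ hmid)) ?_)
    · rw [abs_mul, abs_of_nonneg (show 0 ≤ (i : ℝ) + 1 - x by linarith)]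
      exact mul_le_mul_of_nonneg_left hm1 (abs_nonneg _)
    · rw [abs_mul, abs_of_nonneg (show 0 ≤ y - (j : ℝ) by linarith)]
      exact mul_le_mul_of_nonneg_left hm2 (abs_nonneg _)

theorem betweenSum_comm (c : ℕ → ℝ) (m i j : ℕ) : betweenSum c m i j = betweenSum c m j i := by
  rw [betweenSum, betweenSum, min_comm, max_comm]

theorem betweenSum_nonneg {c : ℕ → ℝ} (hc : ∀ k, 0 ≤ c k) (m i j : ℕ) : 0 ≤ betweenSum c m i j :=
  Finset.sum_nonneg fun k _ => by split_ifs; exacts [hc k, le_rfl]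

/-- One factor of the square is bounded through the sum of slopes, the other through `0 ≤ rem ≤ 2`
and the Lipschitz bound. The result is linear in the slopes, whose absolute sum is proportional to
the number of changed steps. -/
theorem rem_div_sq_le {w g : ℕ → Bool} {τ : ℝ} (h0 : 0 ≤ τ) (h1 : τ ≤ 1) {m : ℕ}
    (hv : ∀ i : ℕ, i ≤ m → 0 ≤ rem w g τ i ∧ rem w g τ i ≤ 2) {i j : ℕ} (hi : i < m) (hj : j < m)
    {x y : ℝ} (hx : x ∈ Ioc (i : ℝ) (i + 1)) (hy : y ∈ Ioc (j : ℝ) (j + 1)) (hxy : x ≠ y) :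
    ((rem w g τ x - rem w g τ y) / (x - y)) ^ 2 ≤
      18 * (betweenSum (fun k => |remSlope w g τ k|) m i j / (|(i : ℝ) - j| + 1) ^ 2) := by
  set T := betweenSum (fun k => |remSlope w g τ k|) m i j with hT
  have hT0 : 0 ≤ T := betweenSum_nonneg (fun _ => abs_nonneg _) _ _ _
  have hx0 : 0 ≤ x := (Nat.cast_nonneg i).trans hx.1.le
  have hy0 : 0 ≤ y := (Nat.cast_nonneg j).trans hy.1.le
  set μ := min 1 |x - y| with hμ
  have hd : 0 < |x - y| := abs_pos.2 (sub_ne_zero.2 hxy)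
  have hμ0 : 0 ≤ μ := le_min zero_le_one hd.le
  have b1 : |rem w g τ x - rem w g τ y| ≤ T * μ := by
    rcases le_total i j with h | h
    · exact abs_rem_sub_le_of_le w g τ h hj hx hy
    · have := abs_rem_sub_le_of_le w g τ h hi hy hx
      rw [abs_sub_comm, hT, betweenSum_comm, hμ, abs_sub_comm x y]
      exact this
  have b2 : |rem w g τ x - rem w g τ y| ≤ 2 * μ := by
    have hmx := rem_mem hv hi hx
    have hmy := rem_mem hv hj hy
    have h3 := abs_rem_sub_le w g h0 h1 hx0 hy0
    rw [hμ]
    rcases le_total 1 |x - y| with h | h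
    · rw [min_eq_left h, abs_le]
      constructor <;> linarith
    · rwa [min_eq_right h]
  have b3 : (|(i : ℝ) - j| + 1) * μ ≤ 3 * |x - y| := by
    have h2 : |((i : ℝ) - j) - (x - y)| ≤ 1 := by
      have := hx.1
      have := hx.2
      have := hy.1
      have := hy.2
      rw [abs_le]
      constructor <;> linarith
    have h3 := abs_sub_abs_le_abs_sub ((i : ℝ) - j) (x - y)
    rw [hμ]
    rcases le_total 1 |x - y| with h | h
    · rw [min_eq_left h]
      linarith
    · rw [min_eq_right h]
      nlinarith
  have ht : 0 < |(i : ℝ) - j| + 1 := by positivity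
  rw [div_pow, mul_div_assoc', div_le_div_iff₀ (by rw [← sq_abs]; positivity) (by positivity),
    ← sq_abs (x - y), ← sq_abs (rem w g τ x - rem w g τ y)]
  have b4 : |rem w g τ x - rem w g τ y| ^ 2 ≤ T * μ * (2 * μ) := by
    rw [sq]
    exact mul_le_mul b1 b2 (abs_nonneg _) (by positivity)
  have b5 : ((|(i : ℝ) - j| + 1) * μ) ^ 2 ≤ (3 * |x - y|) ^ 2 :=
    pow_le_pow_left₀ (by positivity) b3 2
  calc |rem w g τ x - rem w g τ y| ^ 2 * (|(i : ℝ) - j| + 1) ^ 2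
      ≤ T * μ * (2 * μ) * (|(i : ℝ) - j| + 1) ^ 2 := by gcongr
    _ = 2 * T * ((|(i : ℝ) - j| + 1) * μ) ^ 2 := by ring
    _ ≤ 2 * T * (3 * |x - y|) ^ 2 := by gcongr
    _ = 18 * T * |x - y| ^ 2 := by ring

/-- The deviation of `g` is `τ` times that of `w`, plus a linear term of slope `(1 - τ) * (1 - ρ)`,
plus `rem`. The free `θ` in `(a + b) ^ 2 ≤ (1 + θ) * a ^ 2 + (1 + 1 / θ) * b ^ 2` is later chosen
depending on the distance. -/
theorem cellE_tilt_le {w g : ℕ → Bool} {τ ρ θ : ℝ} (h0 : 0 ≤ τ) (h1 : τ ≤ 1) {m : ℕ}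
    (hv : ∀ i : ℕ, i ≤ m → 0 ≤ rem w g τ i ∧ rem w g τ i ≤ 2) {i j : ℕ} (hi : i < m) (hj : j < m)
    (hθ : 0 < θ) :
    cellE (path g) ρ i j ≤ (1 + θ) * cellE (path w) ρ i j +
      (1 + 1 / θ) * (2 * ((1 - τ) * (1 - ρ)) ^ 2 +
        36 * (betweenSum (fun k => |remSlope w g τ k|) m i j / (|(i : ℝ) - j| + 1) ^ 2)) := by
  refine cellE_le_mul_add fun z hz hne => ?_
  have hr := rem_div_sq_le h0 h1 hv hi hj hz.1 hz.2 hne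
  have hzne : z.1 - z.2 ≠ 0 := sub_ne_zero.2 hne
  set b := (rem w g τ z.1 - rem w g τ z.2) / (z.1 - z.2) with hb
  set q := (path w z.1 - path w z.2) / (z.1 - z.2) - ρ with hq
  set l := (1 - τ) * (1 - ρ) with hl
  have e : (path g z.1 - path g z.2) / (z.1 - z.2) - ρ = τ * q + (l + b) := by
    rw [hb, hq, hl, rem, rem]
    field_simp
    ring
  simp only [quotSq]
  rw [e, ← hq]
  have h2 : (τ * q + (l + b)) ^ 2 ≤ (1 + θ) * (τ * q) ^ 2 + (1 + 1 / θ) * (l + b) ^ 2 := by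
    have h3 : (1 + θ) * (τ * q) ^ 2 + (1 + 1 / θ) * (l + b) ^ 2 - (τ * q + (l + b)) ^ 2 =
        (θ * (τ * q) - (l + b)) ^ 2 / θ := by
      field_simp
      ring
    have h4 : 0 ≤ (θ * (τ * q) - (l + b)) ^ 2 / θ := by positivity
    linarith
  have h5 : (τ * q) ^ 2 ≤ q ^ 2 := by
    rw [mul_pow]
    exact mul_le_of_le_one_left (sq_nonneg q) (pow_le_one₀ h0 h1)
  have h6 : (l + b) ^ 2 ≤ 2 * l ^ 2 + 36 * (betweenSum (fun k => |remSlope w g τ k|) m i j /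
      (|(i : ℝ) - j| + 1) ^ 2) := by nlinarith [sq_nonneg (l - b)]
  have h7 : 0 ≤ 1 / θ := by positivity
  refine h2.trans (add_le_add ?_ ?_)
  · exact mul_le_mul_of_nonneg_left h5 (by linarith)
  · exact mul_le_mul_of_nonneg_left h6 (by linarith)

/-- The quadratic part of the energy of a word. -/
noncomputable def cellSum (w : ℕ → Bool) (ρ : ℝ) (m : ℕ) : ℝ :=
  ∑ i ∈ Finset.range m, ∑ j ∈ Finset.range m, cellE (path w) ρ i j

/-- The quadratic part of the energy of a word, weighted by `wt`. -/
noncomputable def cellWtSum (w : ℕ → Bool) (ρ : ℝ) (p : ℕ) : ℝ :=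
  ∑ i ∈ Finset.range (p ^ 4), ∑ j ∈ Finset.range (p ^ 4), wt p i j * cellE (path w) ρ i j

theorem edge_nonneg (w : ℕ → Bool) (ρ : ℝ) (m : ℕ) : 0 ≤ edge w ρ m :=
  Finset.sum_nonneg fun i hi => by
    have : (i : ℝ) + 1 ≤ m := by exact_mod_cast Finset.mem_range.1 hi
    have : (0 : ℝ) ≤ m - i := by linarith
    positivity

theorem cellSum_tilt_le {w g : ℕ → Bool} {τ ρ : ℝ} (h0 : 0 ≤ τ) (h1 : τ ≤ 1) {p : ℕ} (hp : 0 < p)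
    (hv : ∀ i : ℕ, i ≤ p ^ 4 → 0 ≤ rem w g τ i ∧ rem w g τ i ≤ 2) :
    cellSum g ρ (p ^ 4) ≤ cellSum w ρ (p ^ 4) + cellWtSum w ρ p +
      10 * ((1 - τ) * (1 - ρ) * (p ^ 4 : ℕ)) ^ 2 +
      288 * p * hsum (p ^ 4) * ∑ k ∈ Finset.range (p ^ 4), |remSlope w g τ k| := by
  have hp' : (1 : ℝ) ≤ p := by exact_mod_cast hp
  set l := (1 - τ) * (1 - ρ) with hl
  set c := fun k => |remSlope w g τ k| with hc
  have hle : ∀ i ∈ Finset.range (p ^ 4), ∀ j ∈ Finset.range (p ^ 4), cellE (path g) ρ i j ≤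
      cellE (path w) ρ i j + wt p i j * cellE (path w) ρ i j + (2 * l ^ 2 + 2 * l ^ 2 * (1 / wt p i j))
      + 72 * p * (betweenSum c (p ^ 4) i j / (|(i : ℝ) - j| + 1) ^ 2) := by
    intro i hi j hj
    have hw1 := inv_le_wt (p := p) i j
    have hw0 : 0 < wt p i j := lt_of_lt_of_le (by positivity) hw1
    -- The choice `θ = wt p i j` makes the loss on the main term small at short distances, while `1
    -- / θ` never exceeds `p` and is bounded on average.
    have h := cellE_tilt_le (ρ := ρ) h0 h1 hv (Finset.mem_range.1 hi) (Finset.mem_range.1 hj) hw0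
    have h2 : 1 / wt p i j ≤ p := by
      rw [div_le_iff₀ hw0]
      rw [div_le_iff₀ (by positivity)] at hw1
      linarith
    have h3 : 0 ≤ betweenSum c (p ^ 4) i j / (|(i : ℝ) - j| + 1) ^ 2 :=
      div_nonneg (betweenSum_nonneg (fun _ => abs_nonneg _) _ _ _) (by positivity)
    rw [← hl] at h
    have h4 : (1 + 1 / wt p i j) * (36 * (betweenSum c (p ^ 4) i j / (|(i : ℝ) - j| + 1) ^ 2)) ≤
        (2 * p) * (36 * (betweenSum c (p ^ 4) i j / (|(i : ℝ) - j| + 1) ^ 2)) :=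
      mul_le_mul_of_nonneg_right (by linarith) (by linarith)
    linarith
  refine (Finset.sum_le_sum fun i hi => Finset.sum_le_sum fun j hj => hle i hi j hj).trans ?_
  simp only [Finset.sum_add_distrib, ← Finset.mul_sum, Finset.sum_const, Finset.card_range,
    nsmul_eq_mul]
  have s1 := mul_le_mul_of_nonneg_left (sum_inv_wt_le p) (show 0 ≤ 2 * l ^ 2 by positivity)
  have s2 := mul_le_mul_of_nonneg_left (sum_betweenSum_le (c := c) (fun _ => abs_nonneg _) (p ^ 4))
    (show (0 : ℝ) ≤ 72 * p by positivity)
  simp only [cellSum, cellWtSum]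
  linarith

theorem edge_tilt_le {w g : ℕ → Bool} {τ ρ : ℝ} (h0 : 0 ≤ τ) (h1 : τ ≤ 1) {m : ℕ}
    (hv : ∀ i : ℕ, i ≤ m → 0 ≤ rem w g τ i ∧ rem w g τ i ≤ 2) :
    edge g ρ m ≤ 3 * edge w ρ m + 6 * ((1 - τ) * (1 - ρ) * m) ^ 2 + 24 * hsum m := by
  set l := (1 - τ) * (1 - ρ) with hl
  have hdev : ∀ i : ℕ, dev g ρ i = τ * dev w ρ i + l * i + rem w g τ i := by
    intro i
    rw [dev, dev, rem, path_nat, path_nat, hl]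
    ring
  have hτ : τ ^ 2 ≤ 1 := pow_le_one₀ h0 h1
  have key : ∀ a x b t : ℝ, 1 ≤ t → t ≤ m + 1 → |b| ≤ 2 → x ^ 2 ≤ t * m →
      (τ * a + l * x + b) ^ 2 / t ≤ 3 * (a ^ 2 / t) + 3 * l ^ 2 * m + 12 * (1 / t) := by
    intro a x b t ht _ hb hx
    have ht0 : 0 < t := by linarith
    have hb2 : b ^ 2 ≤ 4 := by
      rw [← sq_abs]
      nlinarith [abs_nonneg b]
    have h2 : (τ * a) ^ 2 ≤ a ^ 2 := by
      rw [mul_pow]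
      exact mul_le_of_le_one_left (sq_nonneg a) hτ
    have h3 : l ^ 2 * x ^ 2 ≤ l ^ 2 * (t * m) := mul_le_mul_of_nonneg_left hx (sq_nonneg l)
    rw [show 3 * (a ^ 2 / t) + 3 * l ^ 2 * m + 12 * (1 / t) =
      (3 * a ^ 2 + 3 * (l ^ 2 * (t * m)) + 12) / t by field_simp]
    gcongr
    nlinarith [sq_nonneg (τ * a - l * x), sq_nonneg (τ * a - b), sq_nonneg (l * x - b)]
  have hle : ∀ i ∈ Finset.range m, dev g ρ i ^ 2 / ((i : ℝ) + 1) +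
      (dev g ρ m - dev g ρ i) ^ 2 / ((m : ℝ) - i) ≤ 3 * (dev w ρ i ^ 2 / ((i : ℝ) + 1) +
      (dev w ρ m - dev w ρ i) ^ 2 / ((m : ℝ) - i)) + 6 * l ^ 2 * m +
      (12 * (1 / ((i : ℝ) + 1)) + 12 * (1 / ((m : ℝ) - i))) := by
    intro i hi
    have him := Finset.mem_range.1 hi
    have him' : (i : ℝ) + 1 ≤ m := by exact_mod_cast him
    have hi0 : (0 : ℝ) ≤ i := i.cast_nonneg
    have hvi := hv i him.le
    have hvm := hv m le_rfl
    have k1 := key (dev w ρ i) i (rem w g τ i) (i + 1) (by linarith) (by linarith)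
      (by rw [abs_le]; constructor <;> linarith) (by nlinarith)
    have k2 := key (dev w ρ m - dev w ρ i) (m - i) (rem w g τ m - rem w g τ i) (m - i)
      (by linarith) (by linarith) (by rw [abs_le]; constructor <;> linarith) (by nlinarith)
    have e : dev g ρ m - dev g ρ i = τ * (dev w ρ m - dev w ρ i) + l * (m - i) +
        (rem w g τ m - rem w g τ i) := by rw [hdev, hdev]; ring
    rw [← hdev] at k1
    rw [← e] at k2
    linarith
  refine (Finset.sum_le_sum hle).trans ?_
  simp only [Finset.sum_add_distrib, ← Finset.mul_sum, Finset.sum_const, Finset.card_range,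
    nsmul_eq_mul, hsum_reflect]
  change 3 * _ + _ + (12 * hsum m + _) ≤ _
  rw [edge, Finset.sum_add_distrib]
  linarith

/-- Removing down-steps evenly, in proportion to their number. -/
theorem exists_tilt_down (w : ℕ → Bool) {ρ : ℝ} (hρ : |ρ| ≤ 1) {p : ℕ} (hp : 0 < p) {D F : ℕ}
    (hD : downs w (p ^ 4) = D + F) (hD' : (1 - ρ) / 2 * (p ^ 4 : ℕ) ≤ D + 1) :
    ∃ g : ℕ → Bool, downs g (p ^ 4) = D ∧
      ((Finset.range (p ^ 4)).filter fun k => w k ≠ g k).card = F ∧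
      cellSum g ρ (p ^ 4) ≤ cellSum w ρ (p ^ 4) + cellWtSum w ρ p + 40 * F ^ 2 +
        1152 * p * hsum (p ^ 4) * F ∧
      edge g ρ (p ^ 4) ≤ 3 * edge w ρ (p ^ 4) + 24 * F ^ 2 + 24 * hsum (p ^ 4) := by
  have hρ' := abs_le.1 hρ
  have hh := hsum_nonneg (p ^ 4)
  -- If no step has to be changed, `w` itself serves. Otherwise `F ≥ 1` absorbs the rounding error
  -- in `hD'`, giving `(1 - ρ) * m ≤ 2 * (D + F)`.
  rcases F.eq_zero_or_pos with rfl | hF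
  · refine ⟨w, hD, by simp, ?_, ?_⟩
    · have : 0 ≤ cellWtSum w ρ p := Finset.sum_nonneg fun _ _ => Finset.sum_nonneg fun _ _ =>
        mul_nonneg (wt_nonneg _ _ _) (cellE_nonneg _ _ _ _)
      simp only [CharP.cast_eq_zero]
      linarith
    · have := edge_nonneg w ρ (p ^ 4)
      simp only [CharP.cast_eq_zero]
      linarith
  set m := p ^ 4 with hm
  have hE : 0 < D + F := by omega
  -- The number of down-steps is scaled by `τ = D / (D + F)` and rounded down. It grows only where
  -- `w` steps down, so `g` arises by turning `F` down-steps up, and `rem` at an integer is twice a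
  -- rounding error, between `0` and `2`.
  obtain ⟨g, hg⟩ := exists_word_of_downs (D := fun i => D * downs w i / (D + F))
    (by simp [downs]) fun k => by
      rw [downs_succ]
      split_ifs
      · have h1 : D * downs w k / (D + F) ≤ D * (downs w k + 1) / (D + F) :=
          Nat.div_le_div_right (by rw [mul_add]; omega)
        have h2 : D * (downs w k + 1) / (D + F) ≤ D * downs w k / (D + F) + 1 := by
          rw [← Nat.add_div_right _ hE]
          exact Nat.div_le_div_right (by rw [mul_add]; omega)
        omega
      · exact Or.inl rfl
  have hdown : ∀ k, g k = false → w k = false := by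
    intro k hk
    have h1 := downs_succ g k
    rw [if_pos hk, hg, hg] at h1
    by_contra h
    have h2 := downs_succ w k
    rw [if_neg h, add_zero] at h2
    rw [h2] at h1
    omega
  have hcard : ∀ n, downs w n = downs g n + ((Finset.range n).filter fun k => w k ≠ g k).card := by
    intro n
    induction n with
    | zero => simp [downs]
    | succ n ih =>
      rw [downs_succ, downs_succ, ih, Finset.range_add_one, Finset.filter_insert]
      have := hdown n
      cases hw : w n <;> cases hgn : g n <;> simp [hw, hgn] at this ⊢ <;> omega
  have hgm : downs g m = D := by
    rw [hg]
    simp only [hD]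
    exact Nat.mul_div_cancel _ hE
  have hFc : ((Finset.range m).filter fun k => w k ≠ g k).card = F := by
    have := hcard m
    omega
  have hEr : (0 : ℝ) < D + F := by exact_mod_cast hE
  have hDr : (0 : ℝ) ≤ D := D.cast_nonneg
  have hFr : (0 : ℝ) ≤ F := F.cast_nonneg
  set τ : ℝ := D / (D + F) with hτ
  have h0 : 0 ≤ τ := by positivity
  have h1 : τ ≤ 1 := by
    rw [hτ, div_le_one hEr]
    linarith
  have h1τ : 1 - τ = F / (D + F) := by
    rw [hτ]
    field_simp
    ring
  have hv : ∀ i : ℕ, i ≤ m → 0 ≤ rem w g τ i ∧ rem w g τ i ≤ 2 := by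
    intro i _
    have e : rem w g τ i = 2 * (τ * downs w i - downs g i) := by
      rw [rem, path_nat, path_nat, ht_eq, ht_eq]
      ring
    have e2 : τ * downs w i = ((D * downs w i : ℕ) : ℝ) / ((D + F : ℕ) : ℝ) := by
      rw [hτ]
      push_cast
      ring
    have k1 : ((D * downs w i / (D + F) : ℕ) : ℝ) ≤
        ((D * downs w i : ℕ) : ℝ) / ((D + F : ℕ) : ℝ) := Nat.cast_div_le
    have k2 : ((D * downs w i : ℕ) : ℝ) / ((D + F : ℕ) : ℝ) ≤
        ((D * downs w i / (D + F) : ℕ) : ℝ) + 1 := by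
      rw [div_le_iff₀ (by exact_mod_cast hE)]
      have := (Nat.lt_mul_div_succ (D * downs w i) hE).le
      have h3 : ((D * downs w i : ℕ) : ℝ) ≤
          ((D + F : ℕ) : ℝ) * (((D * downs w i / (D + F) : ℕ) : ℝ) + 1) := by exact_mod_cast this
      linarith
    rw [e, e2, hg]
    constructor <;> linarith
  -- An up-step of `w` has remainder slope `0`. The `D` kept down-steps contribute `2 * (1 - τ)`
  -- each, at most `2 * F` together, and the `F` changed ones at most `2` each.
  have hslope : ∑ k ∈ Finset.range m, |remSlope w g τ k| ≤ 4 * F := by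
    have k1 : ∀ k, |remSlope w g τ k| ≤ (if g k = false then 2 * (1 - τ) else 0) +
        (if w k ≠ g k then 2 else 0) := by
      intro k
      have := hdown k
      have h2 : 0 ≤ 1 - τ := by linarith
      cases hw : w k <;> cases hgn : g k <;> simp [hw, hgn, remSlope, sg] at this ⊢
      · rw [abs_le]; constructor <;> linarith
      · rw [abs_le]; constructor <;> linarith
    refine (Finset.sum_le_sum fun k _ => k1 k).trans ?_
    rw [Finset.sum_add_distrib, ← Finset.sum_filter, ← Finset.sum_filter, Finset.sum_const,
      Finset.sum_const, hFc]
    have h3 : ((Finset.range m).filter fun k => g k = false).card = D := by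
      rw [← hgm, downs, Nat.count_eq_card_filter_range]
    rw [h3, nsmul_eq_mul, nsmul_eq_mul, h1τ]
    have h4 : (D : ℝ) * (F / (D + F)) ≤ F := by
      rw [mul_div_assoc', div_le_iff₀ hEr]
      nlinarith
    linarith
  have hl0 : 0 ≤ (1 - τ) * (1 - ρ) * (m : ℝ) :=
    mul_nonneg (mul_nonneg (by linarith) (by linarith)) m.cast_nonneg
  have hl : (1 - τ) * (1 - ρ) * (m : ℝ) ≤ 2 * F := by
    have hF1 : (1 : ℝ) ≤ F := by exact_mod_cast hF
    rw [h1τ, mul_assoc, div_mul_eq_mul_div, div_le_iff₀ hEr]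
    have : (1 - ρ) * (m : ℝ) ≤ 2 * (D + F) := by linarith
    nlinarith
  have hl2 : ((1 - τ) * (1 - ρ) * (m : ℝ)) ^ 2 ≤ 4 * F ^ 2 := by nlinarith
  refine ⟨g, hgm, hFc, ?_, ?_⟩
  · have := cellSum_tilt_le (ρ := ρ) h0 h1 hp hv
    have h5 := mul_le_mul_of_nonneg_left hslope (show 0 ≤ 288 * p * hsum (p ^ 4) by positivity)
    linarith
  · have := edge_tilt_le (ρ := ρ) h0 h1 hv
    linarith

/-- The word with up-steps and down-steps exchanged. -/
def flip (w : ℕ → Bool) : ℕ → Bool := fun k => !w k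

theorem sg_not (b : Bool) : sg (!b) = -sg b := by cases b <;> simp [sg]

theorem ht_flip (w : ℕ → Bool) (i : ℕ) : ht (flip w) i = -ht w i := by
  simp [ht, flip, sg_not]

theorem path_flip (w : ℕ → Bool) (x : ℝ) : path (flip w) x = -path w x := by
  rw [path, path, ht_flip, flip, sg_not]
  ring

theorem cellE_flip (w : ℕ → Bool) (ρ : ℝ) (i j : ℕ) :
    cellE (path (flip w)) (-ρ) i j = cellE (path w) ρ i j := by
  rw [cellE, cellE]
  congr 1
  ext z
  rw [quotSq, quotSq, path_flip, path_flip]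
  ring

theorem dev_flip (w : ℕ → Bool) (ρ : ℝ) (i : ℕ) : dev (flip w) (-ρ) i = -dev w ρ i := by
  rw [dev, dev, ht_flip]
  ring

theorem edge_flip (w : ℕ → Bool) (ρ : ℝ) (m : ℕ) : edge (flip w) (-ρ) m = edge w ρ m := by
  simp only [edge, dev_flip]
  refine Finset.sum_congr rfl fun i _ => ?_
  ring

theorem cellSum_flip (w : ℕ → Bool) (ρ : ℝ) (m : ℕ) : cellSum (flip w) (-ρ) m = cellSum w ρ m := by
  simp only [cellSum, cellE_flip]

theorem cellWtSum_flip (w : ℕ → Bool) (ρ : ℝ) (p : ℕ) :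
    cellWtSum (flip w) (-ρ) p = cellWtSum w ρ p := by
  simp only [cellWtSum, cellE_flip]

theorem downs_flip (w : ℕ → Bool) (n : ℕ) : downs (flip w) n = ups w n := by
  simp [downs, ups, flip]

/-- A surplus of down-steps is removed directly; a deficit becomes a surplus after exchanging up and
down and replacing `ρ` by `-ρ`. The number of changes is within `1` of `|dev w ρ (p ^ 4)| / 2`. -/
theorem exists_tilt (w : ℕ → Bool) {ρ : ℝ} (hρ : |ρ| ≤ 1) {p : ℕ} (hp : 0 < p) {D : ℕ}
    (hD : D ≤ p ^ 4) (hD' : |(D : ℝ) - (1 - ρ) / 2 * (p ^ 4 : ℕ)| ≤ 1) :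
    ∃ (g : ℕ → Bool) (F : ℕ), downs g (p ^ 4) = D ∧ (F : ℝ) ≤ |dev w ρ (p ^ 4)| / 2 + 1 ∧
      ((Finset.range (p ^ 4)).filter fun k => w k ≠ g k).card = F ∧
      cellSum g ρ (p ^ 4) ≤ cellSum w ρ (p ^ 4) + cellWtSum w ρ p + 40 * F ^ 2 +
        1152 * p * hsum (p ^ 4) * F ∧
      edge g ρ (p ^ 4) ≤ 3 * edge w ρ (p ^ 4) + 24 * F ^ 2 + 24 * hsum (p ^ 4) := by
  have hd := dev_eq w ρ (p ^ 4)
  have ha := abs_le.1 hD'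
  have hud := ups_add_downs w (p ^ 4)
  have hb := abs_le.1 (le_refl |dev w ρ (p ^ 4)|)
  rcases le_total D (downs w (p ^ 4)) with h | h
  · obtain ⟨F, hF⟩ := Nat.exists_eq_add_of_le h
    obtain ⟨g, h1, h2, h3, h4⟩ := exists_tilt_down w hρ hp hF (by linarith)
    refine ⟨g, F, h1, ?_, h2, h3, h4⟩
    have : (downs w (p ^ 4) : ℝ) = D + F := by exact_mod_cast hF
    linarith
  · obtain ⟨F, hF⟩ := Nat.exists_eq_add_of_le h
    have hFr : (D : ℝ) = downs w (p ^ 4) + F := by exact_mod_cast hF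
    have hsub : ((p ^ 4 - D : ℕ) : ℝ) = (p ^ 4 : ℕ) - D := Nat.cast_sub hD
    obtain ⟨g, h1, h2, h3, h4⟩ := exists_tilt_down (flip w) (ρ := -ρ) (by rwa [abs_neg]) hp
      (D := p ^ 4 - D) (F := F) (by rw [downs_flip]; omega) (by rw [hsub]; linarith)
    have e : edge (flip g) ρ (p ^ 4) = edge g (-ρ) (p ^ 4) := by
      simpa using edge_flip g (-ρ) (p ^ 4)
    have e' : cellSum (flip g) ρ (p ^ 4) = cellSum g (-ρ) (p ^ 4) := by
      simpa using cellSum_flip g (-ρ) (p ^ 4)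
    refine ⟨flip g, F, ?_, ?_, ?_, ?_, ?_⟩
    · rw [downs_flip]
      have := ups_add_downs g (p ^ 4)
      omega
    · linarith
    · rw [← h2]
      congr 1
      ext k
      simp only [flip]
      cases w k <;> cases g k <;> simp
    · rw [e']
      rwa [cellSum_flip, cellWtSum_flip] at h3
    · rw [e]
      rwa [edge_flip] at h4

/-! ### The bound at a single scale -/

/-- A hook term can increase only if one of its two steps was changed; distinct steps satisfy `1 / d
^ 2 ≤ 4 / (d + 1) ^ 2`. -/
theorem hookPair_le_add (w g : ℕ → Bool) (i j : ℕ) :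
    hookPair g i j ≤ hookPair w i j + ((if w i ≠ g i then 4 / (|(i : ℝ) - j| + 1) ^ 2 else 0) +
      (if w j ≠ g j then 4 / (|(i : ℝ) - j| + 1) ^ 2 else 0)) := by
  have h0 := hookPair_nonneg w i j
  have ht : 0 ≤ 4 / (|(i : ℝ) - j| + 1) ^ 2 := by positivity
  by_cases hi : w i = g i
  · by_cases hj : w j = g j
    · simp [hookPair, hi, hj]
    · rw [if_neg (not_not.2 hi), if_pos hj, zero_add]
      refine le_trans ?_ (le_add_of_nonneg_left h0)
      by_cases hij : i = j
      · subst hij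
        exact absurd hi hj
      · refine (hookPair_le g).trans ?_
        have h1 : 1 ≤ |(i : ℝ) - j| := by
          have h2 : (1 : ℤ) ≤ |(i : ℤ) - j| := Int.one_le_abs (by omega)
          exact_mod_cast h2
        rw [← sq_abs ((i : ℝ) - j), div_le_div_iff₀ (by positivity) (by positivity)]
        nlinarith
  · have h2 : 0 ≤ if w j ≠ g j then 4 / (|(i : ℝ) - j| + 1) ^ 2 else 0 := by
      split_ifs
      exacts [ht, le_rfl]
    rw [if_pos hi]
    by_cases hij : i = j
    · subst hij
      simp only [hookPair, lt_irrefl, false_and, if_false] at *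
      linarith
    · have h1 : 1 ≤ |(i : ℝ) - j| := by
        have h2 : (1 : ℤ) ≤ |(i : ℤ) - j| := Int.one_le_abs (by omega)
        exact_mod_cast h2
      have h3 : 1 / ((i : ℝ) - j) ^ 2 ≤ 4 / (|(i : ℝ) - j| + 1) ^ 2 := by
        rw [← sq_abs ((i : ℝ) - j), div_le_div_iff₀ (by positivity) (by positivity)]
        nlinarith
      have := hookPair_le g (i := i) (j := j)
      linarith

theorem sum_four_div_le {i m : ℕ} (hi : i < m) :
    ∑ j ∈ Finset.range m, 4 / (|(i : ℝ) - j| + 1) ^ 2 ≤ 16 := by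
  have h1 := sum_dist_le (h := fun x => 4 * (1 / x ^ 2)) (fun x => by positivity) hi
  simp only [mul_one_div] at h1
  have h2 := sum_inv_sq_le m
  have h3 : ∑ t ∈ Finset.range m, 4 / ((t : ℝ) + 1) ^ 2 ≤ 8 := by
    have : ∑ t ∈ Finset.range m, 4 / ((t : ℝ) + 1) ^ 2 =
        4 * ∑ t ∈ Finset.range m, 1 / ((t : ℝ) + 1) ^ 2 := by
      rw [Finset.mul_sum]
      simp only [mul_one_div]
    linarith
  linarith

theorem sum_hookPair_le_add (w g : ℕ → Bool) (m : ℕ) :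
    ∑ i ∈ Finset.range m, ∑ j ∈ Finset.range m, hookPair g i j ≤
      ∑ i ∈ Finset.range m, ∑ j ∈ Finset.range m, hookPair w i j +
        32 * ((Finset.range m).filter fun k => w k ≠ g k).card := by
  refine (Finset.sum_le_sum fun i _ => Finset.sum_le_sum fun j _ =>
    hookPair_le_add w g i j).trans ?_
  simp only [Finset.sum_add_distrib]
  have h1 : ∑ i ∈ Finset.range m, ∑ j ∈ Finset.range m,
      (if w i ≠ g i then 4 / (|(i : ℝ) - j| + 1) ^ 2 else (0 : ℝ)) ≤
      16 * (((Finset.range m).filter fun k => w k ≠ g k).card : ℝ) := by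
    have h2 : ∀ i ∈ Finset.range m, ∑ j ∈ Finset.range m,
        (if w i ≠ g i then 4 / (|(i : ℝ) - j| + 1) ^ 2 else (0 : ℝ)) ≤
        if w i ≠ g i then 16 else 0 := by
      intro i hi
      split_ifs
      · exact sum_four_div_le (Finset.mem_range.1 hi)
      · simp
    refine (Finset.sum_le_sum h2).trans_eq ?_
    rw [← Finset.sum_filter, Finset.sum_const, nsmul_eq_mul, mul_comm]
  have h2 : ∑ i ∈ Finset.range m, ∑ j ∈ Finset.range m,
      (if w j ≠ g j then 4 / (|(i : ℝ) - j| + 1) ^ 2 else (0 : ℝ)) ≤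
      16 * (((Finset.range m).filter fun k => w k ≠ g k).card : ℝ) := by
    rw [Finset.sum_comm]
    refine le_trans (Finset.sum_le_sum fun i _ => Finset.sum_le_sum fun j _ => Eq.le ?_) h1
    rw [abs_sub_comm (j : ℝ)]
  linarith

/-- For every `i`, one of `dev w ρ i` and `dev w ρ m - dev w ρ i` is at least half of `dev w ρ m` in
size, and every denominator in `edge` is at most `m`. -/
theorem dev_sq_le_edge (w : ℕ → Bool) (ρ : ℝ) {m : ℕ} (hm : 0 < m) :
    dev w ρ m ^ 2 ≤ 2 * edge w ρ m := by
  have hm' : (0 : ℝ) < m := by exact_mod_cast hm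
  have h : ∀ i ∈ Finset.range m, dev w ρ m ^ 2 / (2 * m) ≤ dev w ρ i ^ 2 / ((i : ℝ) + 1) +
      (dev w ρ m - dev w ρ i) ^ 2 / ((m : ℝ) - i) := by
    intro i hi
    have h1 : (i : ℝ) + 1 ≤ m := by exact_mod_cast Finset.mem_range.1 hi
    have h2 : (0 : ℝ) ≤ i := i.cast_nonneg
    have h3 : dev w ρ i ^ 2 / m ≤ dev w ρ i ^ 2 / ((i : ℝ) + 1) := by gcongr
    have h4 : (dev w ρ m - dev w ρ i) ^ 2 / m ≤ (dev w ρ m - dev w ρ i) ^ 2 / ((m : ℝ) - i) := by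
      refine div_le_div_of_nonneg_left (sq_nonneg _) (by linarith) (by linarith)
    have h5 : dev w ρ m ^ 2 / (2 * m) ≤ dev w ρ i ^ 2 / m + (dev w ρ m - dev w ρ i) ^ 2 / m := by
      rw [← add_div, div_le_div_iff₀ (by positivity) hm']
      nlinarith [mul_nonneg hm'.le (sq_nonneg (dev w ρ m - 2 * dev w ρ i))]
    linarith
  have h2 := Finset.sum_le_sum h
  rw [Finset.sum_const, Finset.card_range, nsmul_eq_mul] at h2
  have h3 : (m : ℝ) * (dev w ρ m ^ 2 / (2 * m)) = dev w ρ m ^ 2 / 2 := by field_simp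
  rw [h3] at h2
  change _ ≤ edge w ρ m at h2
  linarith

/-- The energy of a word, weighted by `wt`. -/
noncomputable def interWtSum (w : ℕ → Bool) (ρ : ℝ) (p : ℕ) : ℝ :=
  ∑ i ∈ Finset.range (p ^ 4), ∑ j ∈ Finset.range (p ^ 4), wt p i j * inter w ρ i j

theorem cellWtSum_le (w : ℕ → Bool) (ρ : ℝ) (p : ℕ) : cellWtSum w ρ p ≤ 8 * interWtSum w ρ p := by
  rw [cellWtSum, interWtSum, Finset.mul_sum]
  refine Finset.sum_le_sum fun i _ => ?_
  rw [Finset.mul_sum]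
  refine Finset.sum_le_sum fun j _ => ?_
  have h1 : cellE (path w) ρ i j ≤ 8 * inter w ρ i j := by
    have := hookPair_nonneg w i j
    rw [inter]
    linarith
  have := mul_le_mul_of_nonneg_left h1 (wt_nonneg p i j)
  linarith

theorem energy_eq (w : ℕ → Bool) (ρ : ℝ) (m : ℕ) : energy w ρ m = 1 / 8 * cellSum w ρ m +
    ∑ i ∈ Finset.range m, ∑ j ∈ Finset.range m, hookPair w i j := by
  simp only [energy, inter, cellSum, Finset.sum_add_distrib, Finset.mul_sum]

/-- Tilted copies of `w` provide a block for every admissible number of down-steps. The tilting cost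
is quadratic in `F`, hence controlled by `edge`; the mixed term `p * hsum * F` is split into `F ^ 2`
and `p ^ 2 * hsum ^ 2`, the latter of order `p ^ 3`. -/
theorem pow_mul_sigma_le (w : ℕ → Bool) {ρ : ℝ} (hρ : |ρ| ≤ 1) {p : ℕ} (hp : 0 < p) :
    ((p ^ 4 : ℕ) : ℝ) * sigma ρ ≤ energy w ρ (p ^ 4) + interWtSum w ρ p +
      500000 * (edge w ρ (p ^ 4) + p ^ 3) := by
  have hp' : (1 : ℝ) ≤ p := by exact_mod_cast hp
  refine mul_sigma_le hρ (by positivity) fun D hD hD' => ?_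
  obtain ⟨g, F, h1, h2, h3, h4, h5⟩ := exists_tilt w hρ hp hD hD'
  refine ⟨g, h1, ?_⟩
  have hh := hsum_nonneg (p ^ 4)
  have hh8 := hsum_pow_four_le hp
  have hk := sum_hookPair_le_add w g (p ^ 4)
  have hc := cellWtSum_le w ρ p
  have hde := dev_sq_le_edge w ρ (m := p ^ 4) (by positivity)
  have he := edge_nonneg w ρ (p ^ 4)
  rw [h3] at hk
  rw [energy_eq, energy_eq]
  set h := hsum (p ^ 4)
  have hF0 : (0 : ℝ) ≤ F := F.cast_nonneg
  have hF2 : (F : ℝ) ^ 2 ≤ edge w ρ (p ^ 4) + 2 := by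
    rw [← sq_abs] at hde
    nlinarith [sq_nonneg (|dev w ρ (p ^ 4)| - 2), abs_nonneg (dev w ρ (p ^ 4))]
  have hsq : √(p : ℝ) ^ 2 = p := Real.sq_sqrt (by linarith)
  have hs0 : 0 ≤ √(p : ℝ) := Real.sqrt_nonneg _
  have hh2 : h ^ 2 ≤ 64 * p := by nlinarith
  have hp3 : (p : ℝ) ≤ p ^ 3 := by nlinarith [mul_nonneg (show (0 : ℝ) ≤ p by linarith) (show (0 : ℝ) ≤ p ^ 2 - 1 by nlinarith)]
  have hh1 : h ≤ 8 * p ^ 3 := by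
    have : √(p : ℝ) ≤ p := by nlinarith [Real.one_le_sqrt.2 hp']
    linarith
  have hph : (p : ℝ) ^ 2 * h ^ 2 ≤ 64 * p ^ 3 := by
    have := mul_le_mul_of_nonneg_left hh2 (sq_nonneg (p : ℝ))
    linarith
  have hphF : 144 * p * h * F ≤ F ^ 2 + 5184 * (p ^ 2 * h ^ 2) := by
    nlinarith [sq_nonneg ((F : ℝ) - 72 * (p * h))]
  have hF32 : 32 * (F : ℝ) ≤ F ^ 2 + 256 := by nlinarith [sq_nonneg ((F : ℝ) - 16)]
  linarith

/-! ### Averaging over windows -/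

theorem sum_shift_le {f : ℕ → ℝ} (hf : ∀ k, 0 ≤ f k) {a L n : ℕ} (h : a + L ≤ n) :
    ∑ l ∈ Finset.range L, f (a + l) ≤ ∑ I ∈ Finset.range n, f I := by
  have h1 : ∑ I ∈ Finset.range (a + L), f I ≤ ∑ I ∈ Finset.range n, f I :=
    Finset.sum_le_sum_of_subset_of_nonneg (Finset.range_subset_range.2 h) fun k _ _ => hf k
  rw [Finset.sum_range_add] at h1
  have h2 : 0 ≤ ∑ I ∈ Finset.range a, f I := Finset.sum_nonneg fun k _ => hf k
  linarith

/-- Every pair is contained in at most `m` windows of length `m`. -/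
theorem sum_windows_le {A B : ℕ → ℕ → ℝ} (hB : ∀ I J, 0 ≤ B I J) {m n : ℕ} (hmn : m ≤ n)
    (hAB : ∀ a, ∀ i < m, ∀ j < m, A (a + i) (a + j) ≤ B (a + i) (a + j)) :
    ∑ a ∈ Finset.range (n - m + 1), ∑ i ∈ Finset.range m, ∑ j ∈ Finset.range m,
      A (a + i) (a + j) ≤ m * ∑ I ∈ Finset.range n, ∑ J ∈ Finset.range n, B I J := by
  rw [Finset.sum_comm, ← nsmul_eq_mul]
  refine (Finset.sum_le_card_nsmul _ _ (∑ I ∈ Finset.range n, ∑ J ∈ Finset.range n, B I J)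
    fun i hi => ?_).trans_eq (by rw [Finset.card_range])
  have hi' := Finset.mem_range.1 hi
  have h1 : ∀ a ∈ Finset.range (n - m + 1), ∑ j ∈ Finset.range m, A (a + i) (a + j) ≤
      ∑ J ∈ Finset.range n, B (i + a) J := by
    intro a ha
    have ha' := Finset.mem_range.1 ha
    rw [add_comm i a]
    exact (Finset.sum_le_sum fun j hj => hAB a i hi' j (Finset.mem_range.1 hj)).trans
      (sum_shift_le (f := fun J => B (a + i) J) (hB _) (by omega))
  exact (Finset.sum_le_sum h1).trans (sum_shift_le (f := fun I => ∑ J ∈ Finset.range n, B I J)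
    (fun I => Finset.sum_nonneg fun J _ => hB I J) (by omega))

/-- The weight `wt`, cut off at distance `p ^ 4`. -/
noncomputable def bwt (p i j : ℕ) : ℝ := if |(i : ℝ) - j| + 1 ≤ (p : ℝ) ^ 4 then wt p i j else 0

theorem bwt_nonneg (p i j : ℕ) : 0 ≤ bwt p i j := by
  unfold bwt
  split_ifs
  exacts [wt_nonneg _ _ _, le_rfl]

theorem bwt_of_lt {p a i j : ℕ} (hi : i < p ^ 4) (hj : j < p ^ 4) :
    bwt p (a + i) (a + j) = wt p (a + i) (a + j) := by
  rw [bwt, if_pos]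
  have := abs_sub_add_one_le hi hj
  push_cast at this ⊢
  rwa [add_sub_add_left_eq_sub]

theorem wt_add (p a i j : ℕ) : wt p (a + i) (a + j) = wt p i j := by
  simp only [wt]
  push_cast
  rw [add_sub_add_left_eq_sub]

/-- With `s` the fourth root of the distance plus one, `s ^ 4 ≤ p ^ 3 * s`. This turns the factor
lost in `dev_sub_sq_le` into the weight `wt`. -/
theorem dist_le_mul_wt {p i j : ℕ} (hi : i < p ^ 4) (hj : j < p ^ 4) :
    |(i : ℝ) - j| + 1 ≤ (p : ℝ) ^ 4 * wt p i j := by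
  have h1 := sqrt_sqrt_le hi hj
  have ht : 0 ≤ |(i : ℝ) - j| + 1 := by positivity
  rw [wt]
  have hp : (0 : ℝ) < p := by
    rcases p.eq_zero_or_pos with rfl | hp
    · simp at hi
    · exact_mod_cast hp
  set s := √√(|(i : ℝ) - j| + 1) with hs
  have hs0 : 0 ≤ s := Real.sqrt_nonneg _
  have hs4 : s ^ 4 = |(i : ℝ) - j| + 1 := by
    rw [show s ^ 4 = (s ^ 2) ^ 2 by ring, hs, Real.sq_sqrt (Real.sqrt_nonneg _), Real.sq_sqrt ht]
  rw [← hs4, show (p : ℝ) ^ 4 * (s / p) = p ^ 3 * s by field_simp,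
    show s ^ 4 = s ^ 3 * s by ring]
  have := pow_le_pow_left₀ hs0 h1 3
  gcongr

/-- The energy of a word, weighted by `bwt`. -/
noncomputable def interBwtSum (w : ℕ → Bool) (ρ : ℝ) (p n : ℕ) : ℝ :=
  ∑ I ∈ Finset.range n, ∑ J ∈ Finset.range n, bwt p I J * inter w ρ I J

theorem bwt_mul_inter_nonneg (w : ℕ → Bool) (ρ : ℝ) (p I J : ℕ) : 0 ≤ bwt p I J * inter w ρ I J :=
  mul_nonneg (bwt_nonneg _ _ _) (inter_nonneg _ _ _ _)

theorem sum_energy_windows_le (w : ℕ → Bool) (ρ : ℝ) {m n : ℕ} (hmn : m ≤ n) :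
    ∑ a ∈ Finset.range (n - m + 1), energy (shift a w) ρ m ≤ m * energy w ρ n := by
  simp only [energy, inter_shift]
  exact sum_windows_le (A := inter w ρ) (B := inter w ρ) (fun _ _ => inter_nonneg _ _ _ _) hmn
    fun _ _ _ _ _ => le_rfl

theorem sum_interWtSum_windows_le (w : ℕ → Bool) (ρ : ℝ) {p n : ℕ} (hmn : p ^ 4 ≤ n) :
    ∑ a ∈ Finset.range (n - p ^ 4 + 1), interWtSum (shift a w) ρ p ≤
      (p ^ 4 : ℕ) * interBwtSum w ρ p n := by
  simp only [interWtSum, inter_shift, interBwtSum]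
  have := sum_windows_le (A := fun I J => wt p I J * inter w ρ I J)
    (B := fun I J => bwt p I J * inter w ρ I J) (bwt_mul_inter_nonneg w ρ p) hmn
    fun a i hi j hj => by rw [bwt_of_lt hi hj]
  simpa only [wt_add] using this

/-- The edge terms of a window are bounded by interactions with its first or its last step. As the
window moves, each ordered pair occurs at most once in either role, so the factor `p ^ 4` comes from
`dist_le_mul_wt` rather than from multiplicity. -/
theorem sum_edge_windows_le (w : ℕ → Bool) {ρ : ℝ} (hρ : |ρ| ≤ 1) {p n : ℕ} (hp : 0 < p)
    (hmn : p ^ 4 ≤ n) :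
    ∑ a ∈ Finset.range (n - p ^ 4 + 1), edge (shift a w) ρ (p ^ 4) ≤
      32 * (p ^ 4 : ℕ) * interBwtSum w ρ p n + 64 * n * hsum (p ^ 4) := by
  set m := p ^ 4 with hm
  have hm0 : 0 < m := by positivity
  have key : ∀ a, ∀ i < m, ∀ j < m, ∀ q, (q = a + i ∨ q = a + i + 1) →
      (dev w ρ q - dev w ρ (a + j)) ^ 2 / (|(i : ℝ) - j| + 1) ≤
      16 * m * (bwt p (a + i) (a + j) * inter w ρ (a + i) (a + j)) +
        32 * (1 / (|(i : ℝ) - j| + 1)) := by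
    intro a i hi j hj q hq
    have h1 := dev_sub_sq_le w hρ (i := a + i) (j := a + j) hq
    have h2 := dist_le_mul_wt hi hj
    rw [bwt_of_lt hi hj, wt_add]
    push_cast at h1
    rw [add_sub_add_left_eq_sub] at h1
    have ht : 0 < |(i : ℝ) - j| + 1 := by positivity
    have h3 := mul_le_mul_of_nonneg_right h2 (inter_nonneg w ρ (a + i) (a + j))
    have hmr : (m : ℝ) = (p : ℝ) ^ 4 := by rw [hm]; push_cast; ring
    rw [← hmr] at h3
    generalize |(i : ℝ) - j| + 1 = t at *
    rw [div_le_iff₀ ht, add_mul, mul_assoc 32, one_div_mul_cancel ht.ne']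
    nlinarith
  have hle : ∀ a, edge (shift a w) ρ m ≤
      16 * m * ∑ i ∈ Finset.range m, bwt p (a + i) a * inter w ρ (a + i) a +
      16 * m * ∑ i ∈ Finset.range m,
        bwt p (a + (m - 1)) (a + i) * inter w ρ (a + (m - 1)) (a + i) + 64 * hsum m := by
    intro a
    have h1 : ∀ i ∈ Finset.range m, dev (shift a w) ρ i ^ 2 / ((i : ℝ) + 1) +
        (dev (shift a w) ρ m - dev (shift a w) ρ i) ^ 2 / ((m : ℝ) - i) ≤
        16 * m * (bwt p (a + i) a * inter w ρ (a + i) a) +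
        16 * m * (bwt p (a + (m - 1)) (a + i) * inter w ρ (a + (m - 1)) (a + i)) +
        (32 * (1 / ((i : ℝ) + 1)) + 32 * (1 / ((m : ℝ) - i))) := by
      intro i hi
      have hi' := Finset.mem_range.1 hi
      have him : (i : ℝ) + 1 ≤ m := by exact_mod_cast hi'
      have k1 := key a i hi' 0 hm0 (a + i) (Or.inl rfl)
      have k2 := key a (m - 1) (by omega) i hi' (a + m) (Or.inr (by omega))
      have e1 : |(i : ℝ) - (0 : ℕ)| + 1 = i + 1 := by
        rw [Nat.cast_zero, sub_zero, Nat.abs_cast]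
      have e2 : |((m - 1 : ℕ) : ℝ) - i| + 1 = m - i := by
        rw [Nat.cast_sub hm0, Nat.cast_one, abs_of_nonneg (by linarith)]
        ring
      rw [e1, add_zero] at k1
      rw [e2] at k2
      rw [dev_shift, dev_shift, sub_sub_sub_cancel_right]
      linarith
    refine (Finset.sum_le_sum h1).trans ?_
    simp only [Finset.sum_add_distrib, ← Finset.mul_sum, hsum_reflect]
    change _ + (32 * hsum m + _) ≤ _
    linarith
  refine (Finset.sum_le_sum fun a _ => hle a).trans ?_
  simp only [Finset.sum_add_distrib, ← Finset.mul_sum, Finset.sum_const, Finset.card_range,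
    nsmul_eq_mul]
  have s1 : ∑ a ∈ Finset.range (n - m + 1), ∑ i ∈ Finset.range m,
      bwt p (a + i) a * inter w ρ (a + i) a ≤ interBwtSum w ρ p n := by
    rw [interBwtSum, Finset.sum_comm (s := Finset.range n)]
    have h2 : ∀ a ∈ Finset.range (n - m + 1), ∑ i ∈ Finset.range m,
        bwt p (a + i) a * inter w ρ (a + i) a ≤
        ∑ I ∈ Finset.range n, bwt p I (0 + a) * inter w ρ I (0 + a) := by
      intro a ha
      have := Finset.mem_range.1 ha
      rw [zero_add]
      exact sum_shift_le (f := fun I => bwt p I a * inter w ρ I a)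
        (fun _ => bwt_mul_inter_nonneg _ _ _ _ _) (by omega)
    exact (Finset.sum_le_sum h2).trans (sum_shift_le
      (f := fun J => ∑ I ∈ Finset.range n, bwt p I J * inter w ρ I J)
      (fun _ => Finset.sum_nonneg fun _ _ => bwt_mul_inter_nonneg _ _ _ _ _) (by omega))
  have s2 : ∑ a ∈ Finset.range (n - m + 1), ∑ i ∈ Finset.range m,
      bwt p (a + (m - 1)) (a + i) * inter w ρ (a + (m - 1)) (a + i) ≤ interBwtSum w ρ p n := by
    rw [interBwtSum]
    have h2 : ∀ a ∈ Finset.range (n - m + 1), ∑ i ∈ Finset.range m,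
        bwt p (a + (m - 1)) (a + i) * inter w ρ (a + (m - 1)) (a + i) ≤
        ∑ J ∈ Finset.range n, bwt p (m - 1 + a) J * inter w ρ (m - 1 + a) J := by
      intro a ha
      have := Finset.mem_range.1 ha
      rw [add_comm (m - 1) a]
      exact sum_shift_le (f := fun J => bwt p (a + (m - 1)) J * inter w ρ (a + (m - 1)) J)
        (fun _ => bwt_mul_inter_nonneg _ _ _ _ _) (by omega)
    exact (Finset.sum_le_sum h2).trans (sum_shift_le
      (f := fun I => ∑ J ∈ Finset.range n, bwt p I J * inter w ρ I J)
      (fun _ => Finset.sum_nonneg fun _ _ => bwt_mul_inter_nonneg _ _ _ _ _) (by omega))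
  have s3 : ((n - m + 1 : ℕ) : ℝ) * (64 * hsum m) ≤ n * (64 * hsum m) := by
    have := hsum_nonneg m
    have h4 : ((n - m + 1 : ℕ) : ℝ) ≤ n := by exact_mod_cast (by omega : n - m + 1 ≤ n)
    gcongr
  have hm16 : (0 : ℝ) ≤ 16 * m := by positivity
  have t1 := mul_le_mul_of_nonneg_left s1 hm16
  have t2 := mul_le_mul_of_nonneg_left s2 hm16
  linarith

theorem hsum_pow_four_le' {p : ℕ} (hp : 0 < p) : hsum (p ^ 4) ≤ 8 * p ^ 3 := by
  have hp' : (1 : ℝ) ≤ p := by exact_mod_cast hp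
  have h1 := hsum_pow_four_le hp
  have h2 : √(p : ℝ) ≤ p := by
    nlinarith [Real.one_le_sqrt.2 hp', Real.sq_sqrt (show (0 : ℝ) ≤ p by linarith)]
  have h3 : (p : ℝ) ≤ p ^ 3 := le_self_pow₀ hp' (by norm_num)
  linarith

/-- Sum `pow_mul_sigma_le` over all windows and divide by their length. The constants are `1 + 32 *
500000` and `500000 * (64 * 8 + 1)`; the last term pays for having only `n - p ^ 4 + 1` windows
instead of `n`. -/
theorem mul_sigma_le_of_scale (w : ℕ → Bool) {ρ : ℝ} (hρ : |ρ| ≤ 1) {p n : ℕ} (hp : 0 < p)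
    (hmn : p ^ 4 ≤ n) : n * sigma ρ ≤ energy w ρ n + 16000001 * interBwtSum w ρ p n +
      256500000 * (n / p) + 4000 * p ^ 4 := by
  have hp' : (1 : ℝ) ≤ p := by exact_mod_cast hp
  have h := Finset.sum_le_sum fun a (_ : a ∈ Finset.range (n - p ^ 4 + 1)) =>
    pow_mul_sigma_le (shift a w) hρ hp
  simp only [Finset.sum_add_distrib, ← Finset.mul_sum, Finset.sum_const, Finset.card_range,
    nsmul_eq_mul] at h
  have h1 := sum_energy_windows_le w ρ hmn
  have h2 := sum_interWtSum_windows_le w ρ hmn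
  have h3 := sum_edge_windows_le w hρ hp hmn
  have hs := hsum_pow_four_le' hp
  have hn0 : (0 : ℝ) ≤ n := n.cast_nonneg
  have hs' := mul_le_mul_of_nonneg_left hs hn0
  have hc : ((n - p ^ 4 + 1 : ℕ) : ℝ) ≤ n := by
    have : 0 < p ^ 4 := by positivity
    exact_mod_cast (by omega : n - p ^ 4 + 1 ≤ n)
  have hc' : (n : ℝ) - (p ^ 4 : ℕ) ≤ ((n - p ^ 4 + 1 : ℕ) : ℝ) := by
    rw [Nat.cast_add, Nat.cast_sub hmn]
    simp
  have hσ := sigma_nonneg hρ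
  have hσ' := sigma_le hρ
  have hp3 : (0 : ℝ) ≤ (p : ℝ) ^ 3 := by positivity
  have h4 := mul_le_mul_of_nonneg_right hc hp3
  have hmr : ((p ^ 4 : ℕ) : ℝ) = (p : ℝ) ^ 4 := by push_cast; ring
  rw [hmr] at h h1 h2 h3 hc'
  have hp4 : (0 : ℝ) < (p : ℝ) ^ 4 := by positivity
  have h5 : ((n : ℝ) - p ^ 4) * (p ^ 4 * sigma ρ) ≤
      ((n - p ^ 4 + 1 : ℕ) : ℝ) * (p ^ 4 * sigma ρ) :=
    mul_le_mul_of_nonneg_right hc' (by positivity)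
  have h6 : (p : ℝ) ^ 4 * ((n - p ^ 4) * sigma ρ) ≤ p ^ 4 * (energy w ρ n +
      16000001 * interBwtSum w ρ p n + 256500000 * (n / p)) := by
    have e : (p : ℝ) ^ 4 * (256500000 * (n / p)) = 256500000 * (n * p ^ 3) := by field_simp
    rw [mul_add, e]
    linarith
  have h7 := le_of_mul_le_mul_left h6 hp4
  have h8 : (p : ℝ) ^ 4 * sigma ρ ≤ p ^ 4 * 4000 := mul_le_mul_of_nonneg_left hσ' hp4.le
  linarith

/-! ### Summing over dyadic scales -/

/-- A geometric series starting with a term at most `1`; the subtracted `s / 2 ^ K` is the remaining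
tail and makes the induction close. -/
theorem sum_scales_le (s : ℝ) (K : ℕ) :
    ∑ k ∈ Finset.range K, (if s ≤ 2 ^ (k + 1) then s / 2 ^ (k + 1) else 0) ≤
      if s ≤ 2 ^ K then 2 - s / 2 ^ K else 0 := by
  induction K with
  | zero =>
    simp only [Finset.range_zero, Finset.sum_empty, pow_zero, div_one]
    split_ifs <;> linarith
  | succ K ih =>
    rw [Finset.sum_range_succ]
    have hK : (0 : ℝ) < 2 ^ K := by positivity
    have e : s / 2 ^ (K + 1) = s / 2 ^ K / 2 := by rw [pow_succ, div_div]
    by_cases h1 : s ≤ 2 ^ K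
    · have h2 : s ≤ 2 ^ (K + 1) := by rw [pow_succ]; linarith
      rw [if_pos h1] at ih
      rw [if_pos h2, if_pos h2, e]
      linarith
    · rw [if_neg h1] at ih
      split_ifs with h2
      · have : s / 2 ^ (K + 1) ≤ 1 := div_le_one_of_le₀ h2 (by positivity)
        linarith
      · linarith

/-- In terms of the fourth root `s` of the distance plus one, the cut-off reads `s ≤ p` and the
weight is `s / p`. -/
theorem sum_bwt_le (i j K : ℕ) : ∑ k ∈ Finset.range K, bwt (2 ^ (k + 1)) i j ≤ 2 := by
  have ht : 0 ≤ |(i : ℝ) - j| + 1 := by positivity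
  set s := √√(|(i : ℝ) - j| + 1) with hs
  have hs0 : 0 ≤ s := Real.sqrt_nonneg _
  have hs4 : s ^ 4 = |(i : ℝ) - j| + 1 := by
    rw [show s ^ 4 = (s ^ 2) ^ 2 by ring, hs, Real.sq_sqrt (Real.sqrt_nonneg _), Real.sq_sqrt ht]
  have h := sum_scales_le s K
  have h2 : (if s ≤ 2 ^ K then 2 - s / 2 ^ K else 0) ≤ 2 := by
    split_ifs
    · have : 0 ≤ s / 2 ^ K := by positivity
      linarith
    · norm_num
  refine le_trans (Finset.sum_le_sum fun k _ => Eq.le ?_) (h.trans h2)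
  rw [bwt, wt, ← hs, ← hs4]
  push_cast
  simp only [pow_le_pow_iff_left₀ hs0 (show (0 : ℝ) ≤ 2 ^ (k + 1) by positivity)
    (show 4 ≠ 0 by norm_num)]

theorem sum_interBwtSum_le (w : ℕ → Bool) (ρ : ℝ) (K n : ℕ) :
    ∑ k ∈ Finset.range K, interBwtSum w ρ (2 ^ (k + 1)) n ≤ 2 * energy w ρ n := by
  simp only [interBwtSum]
  rw [Finset.sum_comm, energy, Finset.mul_sum]
  refine Finset.sum_le_sum fun i _ => ?_
  rw [Finset.sum_comm, Finset.mul_sum]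
  refine Finset.sum_le_sum fun j _ => ?_
  rw [← Finset.sum_mul]
  exact mul_le_mul_of_nonneg_right (sum_bwt_le i j K) (inter_nonneg _ _ _ _)

/-- The rate of convergence of `sigmaLoc n ρ / n`. -/
theorem mul_sigma_le_energy_add : ∃ C : ℝ, 0 < C ∧ ∀ (w : ℕ → Bool) (ρ : ℝ), |ρ| ≤ 1 →
    ∀ n K : ℕ, 0 < K → 16 ^ K ≤ n → n * sigma ρ ≤ energy w ρ n + C * (n / K) := by
  refine ⟨128300000000, by norm_num, fun w ρ hρ n K hK hKn => ?_⟩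
  have hn0 : (0 : ℝ) ≤ n := n.cast_nonneg
  have hK0 : (0 : ℝ) < K := by exact_mod_cast hK
  have hnK : 0 ≤ (n : ℝ) / K := by positivity
  -- A larger energy makes the claim trivial by `sigma_le`. Otherwise the bounds at `p = 2, 4, …, 2
  -- ^ K` are added: the weighted energies sum to at most `2 * energy ≤ 8000 * n`, the terms `n / p`
  -- to at most `n` and the terms `p ^ 4` to at most `2 * n`. Division by `K` gives the claim.
  by_cases hE : energy w ρ n ≤ 4000 * n
  · have h1 := Finset.sum_le_sum fun k (hk : k ∈ Finset.range K) =>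
      mul_sigma_le_of_scale w hρ (p := 2 ^ (k + 1)) (n := n) (by positivity) (by
        refine le_trans ?_ hKn
        rw [← pow_mul, mul_comm, pow_mul]
        exact Nat.pow_le_pow_right (by norm_num) (Finset.mem_range.1 hk))
    simp only [Finset.sum_add_distrib, ← Finset.mul_sum, Finset.sum_const, Finset.card_range,
      nsmul_eq_mul] at h1
    have h2 := sum_interBwtSum_le w ρ K n
    have h3 : ∑ k ∈ Finset.range K, (n : ℝ) / ((2 ^ (k + 1) : ℕ) : ℝ) ≤ n := by
      have e : ∀ K : ℕ, ∑ k ∈ Finset.range K, (n : ℝ) / ((2 ^ (k + 1) : ℕ) : ℝ) =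
          n - n / 2 ^ K := by
        intro K
        induction K with
        | zero => simp
        | succ K ih =>
          rw [Finset.sum_range_succ, ih]
          push_cast
          field_simp
          ring
      rw [e]
      have : 0 ≤ (n : ℝ) / 2 ^ K := by positivity
      linarith
    have h4 : ∑ k ∈ Finset.range K, (((2 ^ (k + 1) : ℕ) : ℝ)) ^ 4 ≤ 2 * n := by
      have e : ∀ K : ℕ, ∑ k ∈ Finset.range K, (((2 ^ (k + 1) : ℕ) : ℝ)) ^ 4 ≤ 2 * 16 ^ K := by
        intro K
        induction K with
        | zero => simp
        | succ K ih =>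
          rw [Finset.sum_range_succ]
          push_cast
          have e2 : ((2 : ℝ) ^ (K + 1)) ^ 4 = 16 ^ K * 16 := by
            rw [← pow_mul, mul_comm, pow_mul]
            norm_num [pow_succ]
          rw [e2, pow_succ]
          have : (0 : ℝ) ≤ 16 ^ K := by positivity
          push_cast at ih
          linarith
      have h5 : (16 : ℝ) ^ K ≤ n := by exact_mod_cast hKn
      linarith [e K]
    have h6 : (K : ℝ) * (n * sigma ρ) ≤ K * (energy w ρ n + 128300000000 * (n / K)) := by
      have e : (K : ℝ) * (128300000000 * (n / K)) = 128300000000 * n := by field_simp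
      rw [mul_add, e]
      linarith
    exact le_of_mul_le_mul_left h6 hK0
  · have h1 := mul_le_mul_of_nonneg_left (sigma_le hρ) hn0
    linarith

/-! ### The derivative of the limit shape -/

/-- The derivative of the limit shape. -/
noncomputable def slope (x : ℝ) : ℝ := 2 / Real.pi * Real.arcsin x

theorem continuous_slope : Continuous slope := Real.continuous_arcsin.const_mul _

theorem slope_mono : Monotone slope := fun x y h => by
  have := Real.monotone_arcsin h
  have := Real.pi_pos
  unfold slope
  gcongr

theorem abs_slope_le (x : ℝ) : |slope x| ≤ 1 := by
  have h1 := Real.neg_pi_div_two_le_arcsin x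
  have h2 := Real.arcsin_le_pi_div_two x
  have hp := Real.pi_pos
  rw [slope, div_mul_eq_mul_div, abs_le, le_div_iff₀ hp, div_le_iff₀ hp]
  constructor <;> linarith

theorem slope_of_one_le {x : ℝ} (h : 1 ≤ x) : slope x = 1 := by
  have hp := Real.pi_pos
  rw [slope, Real.arcsin_of_one_le h]
  field_simp

theorem slope_of_le_neg_one {x : ℝ} (h : x ≤ -1) : slope x = -1 := by
  have hp := Real.pi_pos
  rw [slope, Real.arcsin_of_le_neg_one h]
  field_simp

/-- `Real.arcsin` is constant on either side of `[-1, 1]`, so `slope` is continuous on the line with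
the correct values `±1` outside. The integral form yields the derivative at `±1` without one-sided
arguments. -/
theorem Omega_eq_integral (x : ℝ) : Omega x = 1 + ∫ t in (-1 : ℝ)..x, slope t := by
  have hp := Real.pi_pos
  have hint : ∀ a b : ℝ, IntervalIntegrable slope volume a b := fun a b =>
    continuous_slope.intervalIntegrable a b
  have hmid : ∀ y : ℝ, -1 ≤ y → y ≤ 1 →
      2 / Real.pi * (y * Real.arcsin y + √(1 - y ^ 2)) = 1 + ∫ t in (-1 : ℝ)..y, slope t := by
    intro y hy1 hy2
    have h := intervalIntegral.integral_eq_sub_of_hasDerivAt_of_le hy1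
      (f := fun y => 2 / Real.pi * (y * Real.arcsin y + √(1 - y ^ 2))) (f' := slope)
      (by
        have := Real.continuous_arcsin
        fun_prop)
      (fun t ht => by
        have ht1 : t ≠ -1 := ht.1.ne'
        have ht2 : t ≠ 1 := (ht.2.trans_le hy2).ne
        have hpos : 0 < 1 - t ^ 2 := by nlinarith [ht.1, ht.2.trans_le hy2]
        have d1 := (hasDerivAt_id t).mul (Real.hasDerivAt_arcsin ht1 ht2)
        have d2 : HasDerivAt (fun t : ℝ => √(1 - t ^ 2)) (-(2 * t) / (2 * √(1 - t ^ 2))) t := by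
          have := (((hasDerivAt_id t).pow 2).const_sub 1).sqrt (by simpa using hpos.ne')
          simpa using this
        have d := (d1.add d2).const_mul (2 / Real.pi)
        refine d.congr_deriv ?_
        have hs : √(1 - t ^ 2) ≠ 0 := (Real.sqrt_pos.2 hpos).ne'
        rw [slope]
        simp only [id]
        field_simp
        ring)
      (hint _ _)
    rw [h]
    have : Real.arcsin (-1) = -(Real.pi / 2) := by rw [Real.arcsin_neg, Real.arcsin_one]
    rw [this]
    norm_num
  have h1 : (1 : ℝ) + ∫ t in (-1 : ℝ)..1, slope t = 1 := by
    rw [← hmid 1 (by norm_num) le_rfl]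
    norm_num
  unfold Omega
  split_ifs with h
  · exact hmid x (abs_le.1 h).1 (abs_le.1 h).2
  · rcases le_total 0 x with h0 | h0
    · rw [abs_of_nonneg h0] at h ⊢
      push Not at h
      rw [← intervalIntegral.integral_add_adjacent_intervals (hint (-1) 1) (hint 1 x), ← add_assoc,
        h1, intervalIntegral.integral_congr (g := fun _ => (1 : ℝ))]
      · simp
      · intro t ht
        rw [uIcc_of_le h.le] at ht
        exact slope_of_one_le ht.1
    · rw [abs_of_nonpos h0] at h ⊢
      push Not at h
      rw [intervalIntegral.integral_congr (g := fun _ => (-1 : ℝ))]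
      · simp
      · intro t ht
        rw [uIcc_of_ge (by linarith)] at ht
        exact slope_of_le_neg_one ht.2

theorem hasDerivAt_Omega (x : ℝ) : HasDerivAt Omega (slope x) x := by
  have h : Omega = fun x => 1 + ∫ t in (-1 : ℝ)..x, slope t := funext Omega_eq_integral
  rw [h]
  exact (continuous_slope.integral_hasStrictDerivAt (-1) x).hasDerivAt.const_add 1

theorem deriv_Omega (x : ℝ) : deriv Omega x = slope x := (hasDerivAt_Omega x).deriv

/-! ### Integrability of `sigma` along the slope -/

theorem quotSq_expand (f : ℝ → ℝ) (ρ : ℝ) (z : ℝ × ℝ) :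
    quotSq f ρ z = (1 - ρ) * quotSq f 0 z + ρ * quotSq f 1 z + (ρ ^ 2 - ρ) := by
  unfold quotSq
  ring

/-- The integral is a quadratic polynomial in `ρ` with leading coefficient `1`, interpolated here at
`0` and `1`. -/
theorem cellE_expand (w : ℕ → Bool) (ρ : ℝ) (i j : ℕ) : cellE (path w) ρ i j =
    (1 - ρ) * cellE (path w) 0 i j + ρ * cellE (path w) 1 i j + (ρ ^ 2 - ρ) := by
  have h0 := (integrableOn_cell w 0 i j).const_mul (1 - ρ)
  have h1 := (integrableOn_cell w 1 i j).const_mul ρ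
  have hc : IntegrableOn (fun _ : ℝ × ℝ => ρ ^ 2 - ρ)
    (Ioc (i : ℝ) (i + 1) ×ˢ Ioc (j : ℝ) (j + 1)) := integrableOn_const (volume_box_ne_top _ _ _ _)
  have h01 : IntegrableOn (fun z => (1 - ρ) * quotSq (path w) 0 z + ρ * quotSq (path w) 1 z)
    (Ioc (i : ℝ) (i + 1) ×ˢ Ioc (j : ℝ) (j + 1)) := h0.add h1
  rw [cellE, funext (quotSq_expand (path w) ρ), integral_add h01 hc, integral_add h0 h1,
    integral_const_mul, integral_const_mul, setIntegral_cell_const]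
  rfl

theorem continuous_energy (w : ℕ → Bool) (n : ℕ) : Continuous fun ρ => energy w ρ n := by
  have h : ∀ i j, Continuous fun ρ => cellE (path w) ρ i j := fun i j => by
    rw [funext fun ρ => cellE_expand w ρ i j]
    fun_prop
  simp only [energy, inter]
  fun_prop

/-- An infimum of continuous functions of `ρ` is upper semicontinuous. -/
theorem measurable_sigmaLoc (n : ℕ) : Measurable (sigmaLoc n) := by
  have h : sigmaLoc n = fun ρ => ⨅ w : ℕ → Bool, energy w ρ n := funext (sigmaLoc_eq n)
  rw [h]
  exact (upperSemicontinuous_ciInf (fun ρ => bddBelow_energy ρ n)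
    fun w => (continuous_energy w n).upperSemicontinuous).measurable

theorem measurable_sigma_comp {g : ℝ → ℝ} (hg : Measurable g) (h : ∀ x, |g x| ≤ 1) :
    Measurable fun x => sigma (g x) := by
  refine measurable_of_tendsto_metrizable (f := fun (n : ℕ) x => sigmaLoc n (g x) / n)
    (fun n => ((measurable_sigmaLoc n).comp hg).div_const _) ?_
  rw [tendsto_pi_nhds]
  exact fun x => tendsto_sigma (h x)

theorem intervalIntegrable_sigma_comp {g : ℝ → ℝ} (hg : Measurable g) (h : ∀ x, |g x| ≤ 1)
    (a b : ℝ) : IntervalIntegrable (fun x => sigma (g x)) volume a b := by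
  rw [intervalIntegrable_iff]
  refine Measure.integrableOn_of_bounded (M := 4000) (by rw [uIoc]; exact measure_Ioc_lt_top.ne)
    (measurable_sigma_comp hg h).aestronglyMeasurable (Eventually.of_forall fun x => ?_)
  rw [Real.norm_of_nonneg (sigma_nonneg (h x))]
  exact sigma_le (h x)

/-! ### Global step functions as words -/

/-- Translation of cells along a down-edge of the diagram. -/
def slide (M : ℕ) (p : ℤ × ℤ) : ℤ × ℤ := (p.1 + M, p.2)

theorem slide_injective (M : ℕ) : Function.Injective (slide M) := by
  rintro ⟨a, b⟩ ⟨c, d⟩ h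
  simpa [slide] using h

theorem hookLength_slide (M : ℕ) (D : Set (ℤ × ℤ)) (p : ℤ × ℤ) :
    hookLength (slide M '' D) (slide M p) = hookLength D p := by
  unfold hookLength
  rw [← Set.ncard_image_of_injective {q ∈ D | _} (slide_injective M)]
  congr 1
  ext q
  constructor
  · rintro ⟨⟨r, hr, rfl⟩, h⟩
    refine ⟨r, ⟨hr, ?_⟩, rfl⟩
    simpa [slide] using h
  · rintro ⟨r, ⟨hr, h⟩, rfl⟩
    exact ⟨⟨r, hr, rfl⟩, by simpa [slide] using h⟩

theorem hookSum_slide (M : ℕ) (D : Set (ℤ × ℤ)) : hookSum (slide M '' D) = hookSum D := by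
  unfold hookSum
  rw [finsum_mem_image (slide_injective M).injOn]
  simp only [hookLength_slide]

/-- The translation takes the point `(-M, M)` of the graph to the origin. The wedge `|x|` becomes
`max (-x) (x - 2 * M)`, the lower boundary of the local diagram, as the translated function vanishes
at `2 * M`. -/
theorem cells_eq_image {f : ℝ → ℝ} {M : ℕ} (hM : ∀ x : ℝ, (M : ℝ) ≤ |x| → f x = |x|) :
    cells f = slide M '' localCells (2 * M) fun x => f (x - M) - M := by
  have hfM : f M = M := by simpa using hM M (by simp)
  have e : ((2 * M : ℕ) : ℝ) - M = M := by push_cast; ring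
  ext ⟨i, j⟩
  have e2 : (j : ℝ) - (i - M) - M = j - i := by ring
  constructor
  · rintro ⟨h1, h2⟩
    simp only at h1 h2
    have h3 : |(j : ℝ) - i| < M := by
      by_contra! h
      rw [hM _ h] at h2
      linarith
    rw [abs_lt] at h3
    have h4 : -(M : ℤ) < j - i := by exact_mod_cast h3.1
    have h5 : j - i < (M : ℤ) := by exact_mod_cast h3.2
    rw [abs_le] at h1
    refine ⟨(i - M, j), ⟨by simp only; omega, by simp only; push_cast; omega, ?_, ?_⟩,
      by simp [slide]⟩
    · simp only [e, hfM]
      push_cast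
      rw [max_le_iff]
      constructor <;> linarith
    · push_cast
      rw [e2]
      linarith
  · rintro ⟨⟨i', j'⟩, ⟨-, -, h3, h4⟩, h⟩
    simp only [slide, Prod.mk.injEq] at h
    obtain ⟨rfl, rfl⟩ := h
    simp only [e, hfM] at h3 h4
    push_cast at h3 h4
    rw [max_le_iff] at h3
    have e3 : (j' : ℝ) - i' - M = j' - (i' + M) := by ring
    rw [e3] at h4
    refine ⟨?_, ?_⟩
    · simp only
      push_cast
      rw [abs_le]
      constructor <;> linarith
    · simp only
      push_cast
      linarith

/-- The lower bound `B` on `M` allows any prescribed bounded region to be covered by the word. -/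
theorem exists_global_word {f : ℝ → ℝ} (hf : f ∈ StepFun) (B : ℝ) :
    ∃ (M : ℕ) (w : ℕ → Bool), B ≤ M ∧ (∀ x ∈ Icc (-(M : ℝ)) M, f x = path w (M + x) + M) ∧
      (∀ x : ℝ, (M : ℝ) ≤ |x| → f x = |x|) ∧
      hookSum (cells f) = ∑ i ∈ Finset.range (2 * M), ∑ j ∈ Finset.range (2 * M),
        hookPair w i j := by
  obtain ⟨hc, hd, M0, hM0⟩ := hf
  obtain ⟨M, hM⟩ := exists_nat_ge (max M0 B)
  have hM' : ∀ x : ℝ, (M : ℝ) ≤ |x| → f x = |x| := fun x hx =>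
    hM0 x (((le_max_left _ _).trans hM).trans hx)
  have hloc : (fun x => f (x - M) - M) ∈ LocalStepFun (2 * M) := by
    refine ⟨by fun_prop, ?_, fun x _ hx => ?_⟩
    · have := hM' (-M) (by simp)
      simp [this]
    · have hx' : x - M ∉ range ((↑) : ℤ → ℝ) := by
        rintro ⟨z, hz⟩
        exact hx ⟨z + M, by push_cast; linarith⟩
      rcases hd _ hx' with h | h
      · exact Or.inl ((h.comp_sub_const x M).sub_const _)
      · exact Or.inr ((h.comp_sub_const x M).sub_const _)
  obtain ⟨w, hw⟩ := exists_word hloc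
  refine ⟨M, w, (le_max_right _ _).trans hM, fun x hx => ?_, hM', ?_⟩
  · rw [← hw (M + x) ⟨by linarith [hx.1], by push_cast; linarith [hx.2]⟩]
    simp
  · rw [cells_eq_image hM', hookSum_slide, ← hookSum_localCells_path]
    congr 1
    have h2M : (0 : ℝ) ≤ (2 * M : ℕ) := Nat.cast_nonneg _
    ext p
    simp only [localCells, Set.mem_ofPred_eq]
    refine and_congr_right fun h1 => and_congr_right fun h2 => ?_
    rify at h1 h2
    rw [← hw _ ⟨h2M, le_rfl⟩, ← hw ((p.2 : ℝ) - p.1) ⟨h1.le, by push_cast; exact h2.le⟩]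

theorem abs_stepFun_sub_le {f : ℝ → ℝ} (hf : f ∈ StepFun) (x y : ℝ) : |f x - f y| ≤ |x - y| := by
  obtain ⟨M, w, hB, hw, -⟩ := exists_global_word hf (max |x| |y|)
  have hx := abs_le.1 ((le_max_left _ _).trans hB)
  have hy := abs_le.1 ((le_max_right _ _).trans hB)
  rw [hw x hx, hw y hy, add_sub_add_right_eq_sub]
  refine (abs_path_sub_le w (by linarith [hx.1]) (by linarith [hy.1])).trans_eq ?_
  rw [add_sub_add_left_eq_sub]

/-! ### Convergence of the double integral -/

theorem hasDerivAt_OmegaN {N : ℕ} (hN : 0 < N) (x : ℝ) :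
    HasDerivAt (OmegaN N) (slope (x / √(4 * N))) x := by
  have hL : √(4 * N : ℝ) ≠ 0 := (Real.sqrt_pos.2 (by positivity)).ne'
  have h := ((hasDerivAt_Omega (x / √(4 * N))).comp x
    ((hasDerivAt_id x).div_const (√(4 * N : ℝ)))).const_mul (√(4 * N : ℝ))
  refine h.congr_deriv ?_
  field_simp

theorem exists_OmegaN_slope {N : ℕ} (hN : 0 < N) {x y : ℝ} (h : x < y) :
    ∃ c ∈ Ioo x y, (OmegaN N x - OmegaN N y) / (x - y) = slope (c / √(4 * N)) := by
  obtain ⟨c, hc, hc'⟩ := exists_hasDerivAt_eq_slope (OmegaN N) (fun x => slope (x / √(4 * N))) h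
    (fun x _ => (hasDerivAt_OmegaN hN x).continuousAt.continuousWithinAt)
    fun x _ => hasDerivAt_OmegaN hN x
  refine ⟨c, hc, ?_⟩
  rw [hc', ← neg_sub (OmegaN N y), ← neg_sub y, neg_div_neg_eq]

theorem OmegaN_quot_mem {N : ℕ} (hN : 0 < N) {a b x y : ℝ} (hx : x ∈ Ioc a b) (hy : y ∈ Ioc a b)
    (h : x ≠ y) : (OmegaN N x - OmegaN N y) / (x - y) ∈
      Icc (slope (a / √(4 * N))) (slope (b / √(4 * N))) := by
  have key : ∀ x ∈ Ioc a b, ∀ y ∈ Ioc a b, x < y → (OmegaN N x - OmegaN N y) / (x - y) ∈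
      Icc (slope (a / √(4 * N))) (slope (b / √(4 * N))) := by
    intro x hx y hy h
    obtain ⟨c, hc, e⟩ := exists_OmegaN_slope hN h
    rw [e]
    refine ⟨slope_mono ?_, slope_mono ?_⟩ <;> gcongr
    exacts [(hx.1.trans hc.1).le, hc.2.le.trans hy.2]
  rcases h.lt_or_gt with h | h
  · exact key x hx y hy h
  · have := key y hy x hx h
    rwa [← neg_sub (OmegaN N x), ← neg_sub x, neg_div_neg_eq] at this

theorem abs_OmegaN_sub_le {N : ℕ} (hN : 0 < N) (x y : ℝ) :
    |OmegaN N x - OmegaN N y| ≤ |x - y| := by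
  have key : ∀ x y : ℝ, x < y → |OmegaN N x - OmegaN N y| ≤ |x - y| := by
    intro x y h
    obtain ⟨c, hc, e⟩ := exists_OmegaN_slope hN h
    have h1 : x - y ≠ 0 := (sub_neg.2 h).ne
    rw [div_eq_iff h1] at e
    rw [e, abs_mul]
    exact mul_le_of_le_one_left (abs_nonneg _) (abs_slope_le _)
  rcases lt_trichotomy x y with h | rfl | h
  · exact key x y h
  · simp
  · rw [abs_sub_comm, abs_sub_comm x]
    exact key y x h

theorem OmegaN_of_le {N : ℕ} (hN : 0 < N) {x : ℝ} (h : √(4 * N) < |x|) : OmegaN N x = |x| := by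
  have hL : 0 < √(4 * N : ℝ) := Real.sqrt_pos.2 (by positivity)
  have h1 : |x / √(4 * N)| = |x| / √(4 * N) := by rw [abs_div, abs_of_pos hL]
  rw [OmegaN, Omega, if_neg, h1]
  · field_simp
  · rw [h1, not_le, lt_div_iff₀ hL]
    linarith

theorem measurable_OmegaN {N : ℕ} (hN : 0 < N) : Measurable (OmegaN N) :=
  (continuous_iff_continuousAt.2 fun x => (hasDerivAt_OmegaN hN x).continuousAt).measurable

/-- The squared difference quotient of a compactly supported Lipschitz function is integrable over
the plane. -/
theorem integrable_sq_quot {g : ℝ → ℝ} {B : ℝ} (hg : Measurable g)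
    (hl : ∀ x y, |g x - g y| ≤ 2 * |x - y|) (hB : ∀ x, B < |x| → g x = 0) :
    Integrable fun z : ℝ × ℝ => ((g z.1 - g z.2) / (z.1 - z.2)) ^ 2 := by
  have hbd : ∃ G, 0 ≤ G ∧ ∀ x, |g x| ≤ G := by
    refine ⟨4 * (|B| + 1), by positivity, fun x => ?_⟩
    by_cases hx : B < |x|
    · rw [hB x hx, abs_zero]
      positivity
    · have h1 := hl x (|B| + 1)
      have h2 : g (|B| + 1) = 0 := hB _ (by
        rw [abs_of_pos (by positivity)]
        linarith [le_abs_self B])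
      rw [h2, sub_zero] at h1
      have h3 : |x - (|B| + 1)| ≤ |x| + (|B| + 1) := by
        refine (abs_sub _ _).trans ?_
        rw [abs_of_pos (show 0 < |B| + 1 by positivity)]
      linarith [le_abs_self B]
  obtain ⟨G, hG0, hG⟩ := hbd
  let k : ℝ → ℝ := (Icc (-B) B).indicator fun _ => 1
  have hk0 : ∀ x, 0 ≤ k x := fun x => indicator_nonneg (fun _ _ => zero_le_one) x
  have hk1 : ∀ x, ¬ B < |x| → k x = 1 := fun x hx =>
    indicator_of_mem (s := Icc (-B) B) (abs_le.1 (not_lt.1 hx)) fun _ => (1 : ℝ)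
  have hk : Integrable k := (integrable_indicator_iff measurableSet_Icc).2
    (integrableOn_const measure_Icc_lt_top.ne)
  -- The majorant: one point lies in `[-B, B]`, and the square is bounded by `4` near the diagonal
  -- and decays like `(x - y) ^ (-2)` away from it. The product is integrable as the integrand of a
  -- convolution.
  have hc : Integrable fun z : ℝ × ℝ => k z.2 * (1 + (z.1 - z.2) ^ 2)⁻¹ :=
    Integrable.convolution_integrand (ContinuousLinearMap.mul ℝ ℝ) hk integrable_inv_one_add_sq
  have hc' : Integrable fun z : ℝ × ℝ => k z.1 * (1 + (z.2 - z.1) ^ 2)⁻¹ := hc.swap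
  refine ((hc.add hc').const_mul (4 + 4 * G ^ 2)).mono'
    (Measurable.aestronglyMeasurable (by fun_prop)) (Eventually.of_forall fun z => ?_)
  obtain ⟨x, y⟩ := z
  simp only [Pi.add_apply]
  rw [Real.norm_of_nonneg (sq_nonneg _), sub_sq_comm y x, ← add_mul, ← div_eq_mul_inv,
    mul_div_assoc', le_div_iff₀ (by positivity)]
  by_cases hxy : x = y
  · have := hk0 x
    have := hk0 y
    rw [sub_eq_zero.2 hxy, div_zero, zero_pow two_ne_zero, zero_mul]
    positivity
  have ht : x - y ≠ 0 := sub_ne_zero.2 hxy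
  by_cases hout : B < |x| ∧ B < |y|
  · have := hk0 x
    have := hk0 y
    rw [hB x hout.1, hB y hout.2]
    rw [sub_self, zero_div, zero_pow two_ne_zero, zero_mul]
    positivity
  have h1 : 1 ≤ k y + k x := by
    rcases not_and_or.1 hout with h | h
    · linarith [hk1 x h, hk0 y]
    · linarith [hk1 y h, hk0 x]
  have h2 : ((g x - g y) / (x - y)) ^ 2 ≤ 4 := by
    have : |(g x - g y) / (x - y)| ≤ 2 := by
      rw [abs_div]
      exact (div_le_iff₀ (abs_pos.2 ht)).2 (hl x y)
    rw [← sq_abs]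
    nlinarith [abs_nonneg ((g x - g y) / (x - y))]
  have h3 : ((g x - g y) / (x - y)) ^ 2 * (x - y) ^ 2 ≤ 4 * G ^ 2 := by
    rw [← mul_pow, div_mul_cancel₀ _ ht]
    have h4 := abs_le.1 (hG x)
    have h5 := abs_le.1 (hG y)
    nlinarith
  have h6 : (4 + 4 * G ^ 2) * 1 ≤ (4 + 4 * G ^ 2) * (k y + k x) := by gcongr
  linarith

theorem integrable_thetaIntegrand {N : ℕ} (hN : 0 < N) {f : ℝ → ℝ} (hf : f ∈ StepFun) :
    Integrable fun z : ℝ × ℝ => thetaIntegrand N f z.1 z.2 := by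
  obtain ⟨M, hM⟩ := hf.2.2
  have h := integrable_sq_quot (g := fun x => f x - OmegaN N x) (B := max M √(4 * N))
    (hf.1.measurable.sub (measurable_OmegaN hN)) (fun x y => ?_) fun x hx => ?_
  · refine h.congr (Eventually.of_forall fun z => ?_)
    simp only [thetaIntegrand, ← sub_div]
    congr 2
    ring
  · have h1 := abs_le.1 (abs_stepFun_sub_le hf x y)
    have h2 := abs_le.1 (abs_OmegaN_sub_le hN x y)
    rw [abs_le]
    constructor <;> linarith
  · rw [hM x ((le_max_left _ _).trans hx.le), OmegaN_of_le hN ((le_max_right _ _).trans_lt hx),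
      sub_self]

theorem theta_eq_integral {N : ℕ} (hN : 0 < N) {f : ℝ → ℝ} (hf : f ∈ StepFun) :
    theta N f = ∫ z : ℝ × ℝ, thetaIntegrand N f z.1 z.2 := by
  rw [Measure.volume_eq_prod, integral_prod _ (integrable_thetaIntegrand hN hf), theta]

/-! ### From windows to the global bound -/

theorem energy_shift_eq {f : ℝ → ℝ} {w : ℕ → Bool} {M a n : ℕ} (han : a + n ≤ 2 * M)
    (hw : ∀ x ∈ Icc (-(M : ℝ)) M, f x = path w (M + x) + M) (ρ : ℝ) :
    energy (shift a w) ρ n =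
      1 / 8 * (∫ z in Ioc ((a : ℝ) - M) (a - M + n) ×ˢ Ioc ((a : ℝ) - M) (a - M + n),
        quotSq f ρ z) +
      ∑ i ∈ Finset.range n, ∑ j ∈ Finset.range n, hookPair w (a + i) (a + j) := by
  have hmp : MeasurePreserving (fun z : ℝ × ℝ => ((a : ℝ) - M, (a : ℝ) - M) + z) volume volume :=
    measurePreserving_add_left volume _
  have hemb : MeasurableEmbedding (fun z : ℝ × ℝ => ((a : ℝ) - M, (a : ℝ) - M) + z) :=
    (MeasurableEquiv.addLeft ((a : ℝ) - M, (a : ℝ) - M)).measurableEmbedding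
  have h := hmp.setIntegral_preimage_emb hemb (quotSq f ρ)
    (Ioc ((a : ℝ) - M) (a - M + n) ×ˢ Ioc ((a : ℝ) - M) (a - M + n))
  have hset : (fun z : ℝ × ℝ => ((a : ℝ) - M, (a : ℝ) - M) + z) ⁻¹'
      (Ioc ((a : ℝ) - M) (a - M + n) ×ˢ Ioc ((a : ℝ) - M) (a - M + n)) =
      Ioc (0 : ℝ) n ×ˢ Ioc (0 : ℝ) n := by
    ext ⟨x, y⟩
    simp only [mem_preimage, mem_prod, Prod.mk_add_mk, mem_Ioc]
    constructor <;> rintro ⟨⟨h1, h2⟩, h3, h4⟩ <;> refine ⟨⟨?_, ?_⟩, ?_, ?_⟩ <;> linarith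
  have han' : (a : ℝ) + n ≤ 2 * M := by exact_mod_cast han
  have ha : (0 : ℝ) ≤ a := a.cast_nonneg
  have hf : ∀ x ∈ Ioc (0 : ℝ) n, f (a - M + x) = path (shift a w) x + path w a + M := by
    intro x hx
    rw [path_shift w a hx.1.le, hw _ ⟨by linarith [hx.1], by linarith [hx.2]⟩]
    ring_nf
  have hint : ∫ z in Ioc (0 : ℝ) n ×ˢ Ioc (0 : ℝ) n,
      quotSq f ρ (((a : ℝ) - M, (a : ℝ) - M) + z) =
      ∫ z in Ioc (0 : ℝ) n ×ˢ Ioc (0 : ℝ) n, quotSq (path (shift a w)) ρ z := by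
    refine setIntegral_congr_fun (measurableSet_box _ _ _ _) fun z hz => ?_
    simp only [quotSq, Prod.fst_add, Prod.snd_add, hf _ hz.1, hf _ hz.2]
    congr 3 <;> ring
  rw [← h, hset, hint, setIntegral_quotSq_eq_sum]
  simp only [energy, inter, Finset.sum_add_distrib, Finset.mul_sum]
  congr 1
  refine Finset.sum_congr rfl fun i _ => Finset.sum_congr rfl fun j _ => ?_
  simp only [hookPair, shift, Nat.add_sub_add_left, add_lt_add_iff_left]
  congr

/-- With difference quotients `p` of `f` and `q` of `OmegaN`, `(p - ρ) ^ 2 - (p - q) ^ 2 = (q - ρ) *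
(2 * p - q - ρ)`. The second factor is at most `4` in size; the first is at most the variation of
the slope over the window, as `q` is a slope at an intermediate point. -/
theorem setIntegral_quotSq_le {N : ℕ} (hN : 0 < N) {f : ℝ → ℝ} (hf : f ∈ StepFun) (n : ℕ) {b t : ℝ}
    (ht : t ∈ Ioc b (b + n)) :
    ∫ z in Ioc b (b + n) ×ˢ Ioc b (b + n), quotSq f (slope (t / √(4 * N))) z ≤
      (∫ z in Ioc b (b + n) ×ˢ Ioc b (b + n), thetaIntegrand N f z.1 z.2) +
        4 * (slope ((b + n) / √(4 * N)) - slope (b / √(4 * N))) * n ^ 2 := by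
  set ρ := slope (t / √(4 * N)) with hρ
  set δ := slope ((b + n) / √(4 * N)) - slope (b / √(4 * N)) with hδ
  set S : Set (ℝ × ℝ) := Ioc b (b + n) ×ˢ Ioc b (b + n) with hS
  have hSm : MeasurableSet S := measurableSet_box _ _ _ _
  have hSv : volume S ≠ ⊤ := volume_box_ne_top _ _ _ _
  have hconst : ∫ _ in S, 4 * δ = 4 * δ * n ^ 2 := by
    rw [setIntegral_const, Measure.real, hS, Measure.volume_eq_prod, Measure.prod_prod,
      Real.volume_Ioc]
    simp [ENNReal.toReal_mul, pow_two]
    ring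
  have hθ := (integrable_thetaIntegrand hN hf).integrableOn (s := S)
  have hc : IntegrableOn (fun _ : ℝ × ℝ => 4 * δ) S := integrableOn_const hSv
  rw [← hconst, ← integral_add hθ hc]
  refine setIntegral_mono_on_ae (integrableOn_quotSq hf.1.measurable ρ hSm hSv
    fun z _ => abs_stepFun_sub_le hf _ _) (hθ.add hc) hSm ?_
  filter_upwards [ae_fst_ne_snd] with z hne hz
  have h1 := OmegaN_quot_mem hN hz.1 hz.2 hne
  have h2 : ρ ∈ Icc (slope (b / √(4 * N))) (slope ((b + n) / √(4 * N))) := by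
    refine ⟨slope_mono ?_, slope_mono ?_⟩ <;> gcongr
    exacts [ht.1.le, ht.2]
  have h3 := abs_le.1 (abs_div_sub_le (abs_stepFun_sub_le hf z.1 z.2))
  have h4 := abs_le.1 (abs_div_sub_le (abs_OmegaN_sub_le hN z.1 z.2))
  have h5 := abs_le.1 (abs_slope_le (t / √(4 * N)))
  rw [← hρ] at h5
  simp only [quotSq, thetaIntegrand]
  generalize (f z.1 - f z.2) / (z.1 - z.2) = p at *
  generalize (OmegaN N z.1 - OmegaN N z.2) / (z.1 - z.2) = q at *
  have h6 : |q - ρ| ≤ δ := by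
    rw [abs_le]
    constructor <;> linarith [h1.1, h1.2, h2.1, h2.2]
  have h7 : |2 * p - q - ρ| ≤ 4 := by
    rw [abs_le]
    constructor <;> linarith
  have h8 : (q - ρ) * (2 * p - q - ρ) ≤ δ * 4 :=
    (le_abs_self _).trans (by
      rw [abs_mul]
      exact mul_le_mul h6 h7 (abs_nonneg _) ((abs_nonneg _).trans h6))
  linarith

/-- The contribution of a window to the functional bounds the integral of `sigma` over it. -/
theorem integral_window_le {C : ℝ} {n K : ℕ} (hn : 0 < n)
    (hC : ∀ (w : ℕ → Bool) (ρ : ℝ), |ρ| ≤ 1 → n * sigma ρ ≤ energy w ρ n + C * (n / K))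
    {N : ℕ} (hN : 0 < N) {f : ℝ → ℝ} (hf : f ∈ StepFun) {w : ℕ → Bool} {M a : ℕ}
    (han : a + n ≤ 2 * M) (hw : ∀ x ∈ Icc (-(M : ℝ)) M, f x = path w (M + x) + M) {b : ℝ}
    (hb : b = a - M) :
    ∫ t in b..b + n, sigma (slope (t / √(4 * N))) ≤
      1 / 8 * (∫ z in Ioc b (b + n) ×ˢ Ioc b (b + n), thetaIntegrand N f z.1 z.2) +
      ∑ i ∈ Finset.range n, ∑ j ∈ Finset.range n, hookPair w (a + i) (a + j) +
      n ^ 2 / 2 * (slope ((b + n) / √(4 * N)) - slope (b / √(4 * N))) + C * (n / K) := by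
  subst hb
  have hn' : (0 : ℝ) < n := by exact_mod_cast hn
  have hm : Measurable fun t => slope (t / √(4 * N)) :=
    continuous_slope.measurable.comp (measurable_id.div_const _)
  refine le_of_mul_le_mul_left ?_ hn'
  rw [← intervalIntegral.integral_const_mul]
  have hle : (a : ℝ) - M ≤ a - M + n := by linarith
  -- Each `t` in the window may supply the slope `ρ`, and the resulting bound does not depend on
  -- `t`; integrating over length `n` matches the factor `n` on the left.
  refine (intervalIntegral.integral_mono_on_of_le_Ioo hle
    ((intervalIntegrable_sigma_comp hm (fun x => abs_slope_le _) _ _).const_mul _)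
    (g := fun _ => 1 / 8 * (∫ z in Ioc ((a : ℝ) - M) (a - M + n) ×ˢ Ioc ((a : ℝ) - M) (a - M + n),
        thetaIntegrand N f z.1 z.2) +
      ∑ i ∈ Finset.range n, ∑ j ∈ Finset.range n, hookPair w (a + i) (a + j) +
      n ^ 2 / 2 * (slope ((a - M + n) / √(4 * N)) - slope ((a - M) / √(4 * N))) + C * (n / K))
    intervalIntegrable_const fun t ht => ?_).trans_eq ?_
  · have h1 := hC (shift a w) _ (abs_slope_le (t / √(4 * N)))
    rw [energy_shift_eq han hw] at h1
    have h2 := setIntegral_quotSq_le hN hf n (Ioo_subset_Ioc_self ht)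
    linarith
  · rw [intervalIntegral.integral_const, smul_eq_mul]
    ring

theorem sum_blocks_le {F : ℕ → ℕ → ℝ} (hF : ∀ i j, 0 ≤ F i j) {a n Q m : ℕ}
    (h : a + Q * n ≤ m) :
    ∑ k ∈ Finset.range Q, ∑ i ∈ Finset.range n, ∑ j ∈ Finset.range n,
      F (a + k * n + i) (a + k * n + j) ≤
      ∑ I ∈ Finset.range m, ∑ J ∈ Finset.range m, F I J := by
  have h1 := sum_shift_le (f := fun I => ∑ J ∈ Finset.range m, F I J)
    (fun I => Finset.sum_nonneg fun J _ => hF I J) h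
  rw [sum_range_mul] at h1
  refine le_trans (Finset.sum_le_sum fun k hk => Finset.sum_le_sum fun i _ => ?_) h1
  rw [← add_assoc]
  refine sum_shift_le (f := fun J => F (a + k * n + i) J) (hF _) ?_
  have := Nat.mul_le_mul_right n (Nat.succ_le_of_lt (Finset.mem_range.1 hk))
  rw [Nat.succ_mul] at this
  omega

theorem sum_setIntegral_squares_le {g : ℝ × ℝ → ℝ} (hg : Integrable g) (hg0 : ∀ z, 0 ≤ g z)
    {u : ℕ → ℝ} (hu : Monotone u) (Q : ℕ) :
    ∑ k ∈ Finset.range Q, ∫ z in Ioc (u k) (u (k + 1)) ×ˢ Ioc (u k) (u (k + 1)), g z ≤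
      ∫ z, g z := by
  rw [← integral_biUnion_finset]
  · exact setIntegral_le_integral hg (Eventually.of_forall hg0)
  · exact fun k _ => measurableSet_box _ _ _ _
  · intro i _ j _ hij
    exact Set.disjoint_prod.2 (Or.inl (hu.pairwise_disjoint_on_Ioc_succ hij))
  · exact fun k _ => hg.integrableOn

/-- The windows yield disjoint squares along the diagonal, and all other contributions to `bigTheta`
are nonnegative. The slope variations telescope to at most `2`, whence `n ^ 2`. -/
theorem mul_integral_sigma_le {C : ℝ} (hC0 : 0 ≤ C) {n K : ℕ} (hn : 0 < n)
    (hC : ∀ (w : ℕ → Bool) (ρ : ℝ), |ρ| ≤ 1 → n * sigma ρ ≤ energy w ρ n + C * (n / K))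
    {N : ℕ} (hN : 0 < N) {f : ℝ → ℝ} (hf : f ∈ StepFun) :
    √(4 * N) * ∫ x in (-1 : ℝ)..1, sigma (slope x) ≤
      bigTheta N f + n ^ 2 + C * (2 * √(4 * N) / K) + 4000 * (n + 2) := by
  have hL : 0 < √(4 * N : ℝ) := Real.sqrt_pos.2 (by positivity)
  obtain ⟨M, w, hB, hw, -, hh⟩ := exists_global_word hf (√(4 * N))
  have hn' : (0 : ℝ) < n := by exact_mod_cast hn
  have hm : Measurable fun t => slope (t / √(4 * N)) :=
    continuous_slope.measurable.comp (measurable_id.div_const _)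
  have hii := intervalIntegrable_sigma_comp hm fun x => abs_slope_le _
  set ℓ := ⌊√(4 * N : ℝ)⌋₊ with hℓ
  have hℓ1 : (ℓ : ℝ) ≤ √(4 * N) := Nat.floor_le hL.le
  have hℓ2 : √(4 * N) < (ℓ : ℝ) + 1 := Nat.lt_floor_add_one _
  have hℓM : ℓ ≤ M := by exact_mod_cast hℓ1.trans hB
  set Q := 2 * ℓ / n with hQ
  have hQ1 : Q * n ≤ 2 * ℓ := Nat.div_mul_le_self _ _
  have hQ2 : 2 * ℓ < Q * n + n := by
    have := Nat.lt_mul_div_succ (2 * ℓ) hn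
    rw [mul_add, mul_one, mul_comm n] at this
    exact this
  have hQ1' : (Q : ℝ) * n ≤ 2 * ℓ := by exact_mod_cast hQ1
  have hQ2' : 2 * (ℓ : ℝ) < Q * n + n := by exact_mod_cast hQ2
  set u : ℕ → ℝ := fun k => -ℓ + k * n with hu
  have hus : ∀ k, u (k + 1) = u k + n := fun k => by simp only [hu]; push_cast; ring
  have hum : Monotone u := monotone_nat_of_le_succ fun k => by rw [hus]; linarith
  have hwin : ∀ k ∈ Finset.range Q, ∫ t in u k..u (k + 1), sigma (slope (t / √(4 * N))) ≤
      1 / 8 * (∫ z in Ioc (u k) (u (k + 1)) ×ˢ Ioc (u k) (u (k + 1)),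
        thetaIntegrand N f z.1 z.2) +
      ∑ i ∈ Finset.range n, ∑ j ∈ Finset.range n,
        hookPair w (M - ℓ + k * n + i) (M - ℓ + k * n + j) +
      n ^ 2 / 2 * (slope (u (k + 1) / √(4 * N)) - slope (u k / √(4 * N))) + C * (n / K) := by
    intro k hk
    have hk' := Nat.mul_le_mul_right n (Nat.succ_le_of_lt (Finset.mem_range.1 hk))
    rw [Nat.succ_mul] at hk'
    rw [hus]
    refine integral_window_le hn hC hN hf (a := M - ℓ + k * n) (by omega) hw ?_
    simp only [hu]
    push_cast [hℓM]
    ring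
  have hsum := Finset.sum_le_sum hwin
  simp only [Finset.sum_add_distrib, ← Finset.mul_sum] at hsum
  rw [intervalIntegral.sum_integral_adjacent_intervals fun k _ => hii _ _,
    Finset.sum_range_sub fun k => slope (u k / √(4 * N)), Finset.sum_const, Finset.card_range,
    nsmul_eq_mul] at hsum
  have h1 := sum_setIntegral_squares_le (integrable_thetaIntegrand hN hf) (fun z => sq_nonneg _)
    hum Q
  rw [← theta_eq_integral hN hf] at h1
  have h2 := sum_blocks_le (hookPair_nonneg w) (show M - ℓ + Q * n ≤ 2 * M by omega)
  rw [← hh] at h2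
  have h3 : (n : ℝ) ^ 2 / 2 * (slope (u Q / √(4 * N)) - slope (u 0 / √(4 * N))) ≤ n ^ 2 := by
    have h4 := abs_le.1 (abs_slope_le (u Q / √(4 * N)))
    have h5 := abs_le.1 (abs_slope_le (u 0 / √(4 * N)))
    nlinarith [sq_nonneg (n : ℝ)]
  have h4 : Q * (C * (n / K)) ≤ C * (2 * √(4 * N) / K) := by
    rw [show Q * (C * (n / K)) = C * (Q * n / K) by ring]
    exact mul_le_mul_of_nonneg_left
      (div_le_div_of_nonneg_right (by linarith) K.cast_nonneg) hC0
  have hu0 : u 0 = -ℓ := by simp [hu]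
  have huQ : u Q = -ℓ + Q * n := rfl
  have hbd : ∀ a b : ℝ, a ≤ b → ∫ t in a..b, sigma (slope (t / √(4 * N))) ≤ 4000 * (b - a) := by
    intro a b hab
    have := intervalIntegral.integral_mono_on hab (hii a b) (intervalIntegrable_const (c := 4000))
      fun t _ => sigma_le (abs_slope_le (t / √(4 * N)))
    rw [intervalIntegral.integral_const, smul_eq_mul] at this
    linarith
  -- The uncovered ends have length at most `1` on the left and `n + 1` on the right.
  have h5 := hbd (-√(4 * N)) (u 0) (by linarith)
  have h6 := hbd (u Q) (√(4 * N)) (by linarith)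
  have h7 : √(4 * N) * ∫ x in (-1 : ℝ)..1, sigma (slope x) =
      ∫ t in (-√(4 * N))..√(4 * N), sigma (slope (t / √(4 * N))) := by
    rw [intervalIntegral.integral_comp_div (fun x => sigma (slope x)) hL.ne', neg_div,
      div_self hL.ne', smul_eq_mul]
  rw [h7, ← intervalIntegral.integral_add_adjacent_intervals (hii _ (u 0)) (hii _ _),
    ← intervalIntegral.integral_add_adjacent_intervals (hii (u 0) (u Q)) (hii _ _), bigTheta]
  linarith

/-! ### The choice of scale -/

theorem log_le_sqrt_sqrt {x : ℝ} (hx : 0 ≤ x) : Real.log x ≤ 4 * √√x := by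
  have h1 := Real.log_sqrt hx
  have h2 := Real.log_sqrt (Real.sqrt_nonneg x)
  have h3 := Real.log_le_self (Real.sqrt_nonneg (√x))
  linarith

/-- The choice of the window length. -/
theorem exists_scale {C : ℝ} (hC : 0 ≤ C) {N : ℕ} (hN : 2 ≤ N) : ∃ n K : ℕ, 0 < n ∧ 0 < K ∧
    16 ^ K ≤ n ∧ (n : ℝ) ^ 2 + C * (2 * √(4 * N) / K) + 4000 * (n + 2) ≤
      (292000 + 128 * C) * √N / Real.log N := by
  set l := Nat.log 2 N with hl
  -- The eighth power of `16 ^ q` is `2 ^ (32 * q) ≤ N`, so `n ^ 2` is of order at most `N ^ (1/4)`,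
  -- while `q + 1` is still at least `log N / 32`.
  set q := l / 32 with hq
  refine ⟨16 ^ (q + 1), q + 1, by positivity, q.succ_pos, le_rfl, ?_⟩
  have hN' : (2 : ℝ) ≤ N := by exact_mod_cast hN
  have hlog : 0 < Real.log N := Real.log_pos (by linarith)
  set y : ℝ := √√(N : ℝ) with hy
  have hy0 : 0 ≤ y := Real.sqrt_nonneg _
  have hyy : y * y = √N := Real.mul_self_sqrt (Real.sqrt_nonneg _)
  have hsN : √(N : ℝ) * √N = N := Real.mul_self_sqrt (by linarith)
  have hs4 : √(4 * N : ℝ) = 2 * √N := by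
    rw [Real.sqrt_mul (by norm_num), show (4 : ℝ) = 2 ^ 2 by norm_num, Real.sqrt_sq (by norm_num)]
  have hu1 : (1 : ℝ) ≤ 16 ^ q := one_le_pow₀ (by norm_num)
  have hu8 : ((16 : ℝ) ^ q) ^ 8 ≤ N := by
    have h1 : (2 : ℕ) ^ (32 * q) ≤ N :=
      (Nat.pow_le_pow_right (by norm_num) (Nat.mul_div_le l 32)).trans
        (Nat.pow_log_le_self 2 (by omega))
    have h2 : ((2 : ℝ)) ^ (32 * q) ≤ N := by exact_mod_cast h1
    refine le_trans (le_of_eq ?_) h2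
    rw [← pow_mul, show (16 : ℝ) = 2 ^ 4 by norm_num, ← pow_mul]
    congr 1
    ring
  have huy : ((16 : ℝ) ^ q) ^ 2 ≤ y := by
    refine Real.le_sqrt_of_sq_le (Real.le_sqrt_of_sq_le ?_)
    rw [← pow_mul, ← pow_mul]
    exact hu8
  have hK : Real.log N ≤ 32 * ((q + 1 : ℕ) : ℝ) := by
    have h1 : N < 2 ^ (l + 1) := Nat.lt_pow_succ_log_self (by norm_num) N
    have h2 : (N : ℝ) ≤ 2 ^ (l + 1) := by exact_mod_cast h1.le
    have h3 := Real.log_le_log (by linarith) h2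
    rw [Real.log_pow] at h3
    have h4 := Real.log_two_lt_d9
    have h5 : l + 1 ≤ 32 * (q + 1) := by omega
    have h6 : ((l + 1 : ℕ) : ℝ) ≤ 32 * ((q + 1 : ℕ) : ℝ) := by exact_mod_cast h5
    have h7 : (0 : ℝ) ≤ (l + 1 : ℕ) := Nat.cast_nonneg _
    nlinarith
  have hKpos : (0 : ℝ) < (q + 1 : ℕ) := by positivity
  rw [le_div_iff₀ hlog]
  have e1 : y * Real.log N ≤ 4 * √N := by
    have := mul_le_mul_of_nonneg_left (log_le_sqrt_sqrt (show (0 : ℝ) ≤ N by linarith)) hy0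
    rw [← hyy]
    linarith
  have e2 : C * (2 * √(4 * N) / (q + 1 : ℕ)) * Real.log N ≤ 128 * C * √N := by
    rw [hs4, show C * (2 * (2 * √(N : ℝ)) / (q + 1 : ℕ)) * Real.log N =
      4 * C * √N * (Real.log N / (q + 1 : ℕ)) by ring,
      show 128 * C * √(N : ℝ) = 4 * C * √N * 32 by ring]
    gcongr
    rwa [div_le_iff₀ hKpos]
  -- With `u = 16 ^ q ≥ 1` and `u ^ 2 ≤ y`, the left side is at most `(256 + 4000 * 18) * u ^ 2`.
  have e3 : ((16 ^ (q + 1) : ℕ) : ℝ) ^ 2 + 4000 * ((16 ^ (q + 1) : ℕ) + 2) ≤ 73000 * y := by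
    push_cast
    rw [pow_succ 16 q]
    nlinarith
  nlinarith [mul_le_mul_of_nonneg_right e3 hlog.le]

end MaxDim

theorem proposition4p1 :
    (∀ ρ ∈ Set.Icc (-1 : ℝ) 1,
      Filter.Tendsto (fun n : ℕ => MaxDim.sigmaLoc n ρ / n) Filter.atTop
        (nhds (MaxDim.sigma ρ))) ∧
    IntervalIntegrable (fun x : ℝ => MaxDim.sigma (deriv MaxDim.Omega x))
      MeasureTheory.volume (-1) 1 ∧
    ∃ C : ℝ, 0 < C ∧ ∀ N : ℕ, 2 ≤ N → ∀ f ∈ MaxDim.StepFunOfSize N,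
      MeasureTheory.Integrable
        (fun z : ℝ × ℝ => MaxDim.thetaIntegrand N f z.1 z.2) ∧
      2 * √(N : ℝ) * (∫ x in (-1 : ℝ)..1, MaxDim.sigma (deriv MaxDim.Omega x))
          - C * √(N : ℝ) / Real.log N ≤ MaxDim.bigTheta N f := by
  simp only [MaxDim.deriv_Omega]
  refine ⟨fun ρ hρ => MaxDim.tendsto_sigma (abs_le.2 hρ),
    MaxDim.intervalIntegrable_sigma_comp MaxDim.continuous_slope.measurable
      MaxDim.abs_slope_le _ _, ?_⟩
  obtain ⟨C, hC, h⟩ := MaxDim.mul_sigma_le_energy_add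
  refine ⟨292000 + 128 * C, by positivity, fun N hN f hf =>
    ⟨MaxDim.integrable_thetaIntegrand (by omega) hf.1, ?_⟩⟩
  obtain ⟨n, K, hn, hK, hnK, hle⟩ := MaxDim.exists_scale hC.le hN
  have h1 := MaxDim.mul_integral_sigma_le hC.le hn (fun w ρ hρ => h w ρ hρ n K hK hnK)
    (show 0 < N by omega) hf.1
  have h2 : √(4 * N : ℝ) = 2 * √N := by
    rw [Real.sqrt_mul (by norm_num), show (4 : ℝ) = 2 ^ 2 by norm_num, Real.sqrt_sq (by norm_num)]
  rw [h2] at h1 hle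
  linarith
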